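/- Let $k$ be an algebraically closed field. Let $A = k[T]$ be the polynomial algebra, viewed as a differential graded algebra with zero differential and with $T$ in homological degree $-1$ (equivalently, cohomological degree $1$). Let $\mathsf{D}(A)$ be the derived category of DG left $A$-modules, and let $\mathsf{T} = \langle k \rangle$ be the thick subcategory of $\mathsf{D}(A)$ generated by the trivial DG module $k = A/(T)$. (This is the case $w = 0$ of the triangulated category classically generated by a $w$-spherical object, in which $T$ has homological degree $w - 1$.) Let $\mathbb{Z}A_\infty$ be the quiver with vertices $(n,r)$ for $n \in \mathbb{Z}$ and $r \in \mathbb{Z}_{\ge 0}$, and with arrows $(n,r) \to (n,r+1)$ (going up and right) and $(n,r+1) \to (n+1,r)$ (going down and right). The Auslander--Reiten quiver of $\mathsf{T}$ has as vertices the isomorphism classes of indecomposable objects, with an arrow $X \to Y$ when there is an irreducible morphism $X \to Y$; its components are of the form $\mathbb{Z}A_\infty$. For an indecomposable object $t$ of $\mathsf{T}$ at the vertex $(n,r)$ of such a component, let $F^+(t)$ be the set of indecomposable objects at the vertices $(m,s)$ of the same component with $$n \le m \le n + r, \qquad m + s \ge n + r,$$ and let $F^-(t)$ be the set of those at the vertices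 $(m,s)$ with $$m \le n, \qquad n \le m + s \le n + r .$$ That is, $F^+(t)$ and $F^-(t)$ are the rectangles, boundaries included, with corner $t$ that extend down to the base line $r = 0$ and stretch off to infinity upwards to the right, respectively upwards to the left. In particular $t \in F^{\pm}(t)$. Let $t, u$ be indecomposable objects of $\mathsf{T}$, considered up to isomorphism. Then $$\dim_k \mathsf{T}(t,u) = \begin{cases} 2 & \text{if } u \cong t,\\ 1 & \text{if } u \in F^+(t) \cup F^-(t) \text{ and } u \not\cong t,\\ 0 & \text{otherwise.}\end{cases}$$ -/

import Mathlib

universe u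

namespace DGCat

open CategoryTheory CategoryTheory.Limits

/-! ## Differential graded algebras and modules

All gradings are cohomological: differentials raise the degree by one, and "homological degree `d`"
means "cohomological degree `-d`". -/

/-- A differential graded algebra over the field `k`, given by its graded pieces. The product of
elements of degrees `i` and `j` is placed in degree `l` whenever `i + j = l`. -/
structure DGAlgebra (k : Type u) [Field k] where
  /-- the piece of degree `i` -/
  X : ℤ → Type u
  [addCommGroup : ∀ i, AddCommGroup (X i)]
  [module : ∀ i, Module k (X i)]
  /-- the differential -/
  d : ∀ i, X i →ₗ[k] X (i + 1)
  /-- the product -/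
  mul : ∀ i j l, i + j = l → X i →ₗ[k] X j →ₗ[k] X l
  /-- the unit -/
  one : X 0
  one_mul : ∀ j (x : X j), mul 0 j j (zero_add j) one x = x
  mul_one : ∀ j (x : X j), mul j 0 j (add_zero j) x one = x
  mul_assoc : ∀ i j l ij jl m (h₁ : i + j = ij) (h₂ : ij + l = m) (h₃ : j + l = jl)
    (h₄ : i + jl = m) (a : X i) (b : X j) (c : X l),
    mul ij l m h₂ (mul i j ij h₁ a b) c = mul i jl m h₄ a (mul j l jl h₃ b c)
  d_d : ∀ i (x : X i), d (i + 1) (d i x) = 0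
  leibniz : ∀ i j l (h : i + j = l) (a : X i) (b : X j),
    d l (mul i j l h a b) =
      mul (i + 1) j (l + 1) (by omega) (d i a) b +
        i.negOnePow • mul i (j + 1) (l + 1) (by omega) a (d j b)

attribute [instance] DGAlgebra.addCommGroup DGAlgebra.module

/-- A differential graded left module over the DG algebra `A`. -/
structure DGModule {k : Type u} [Field k] (A : DGAlgebra k) where
  /-- the piece of degree `i` -/
  X : ℤ → Type u
  [addCommGroup : ∀ i, AddCommGroup (X i)]
  [module : ∀ i, Module k (X i)]
  /-- the differential -/
  d : ∀ i, X i →ₗ[k] X (i + 1)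
  /-- the action of `A` -/
  act : ∀ i j l, i + j = l → A.X i →ₗ[k] X j →ₗ[k] X l
  one_act : ∀ j (x : X j), act 0 j j (zero_add j) A.one x = x
  mul_act : ∀ i j l ij jl m (h₁ : i + j = ij) (h₂ : ij + l = m) (h₃ : j + l = jl)
    (h₄ : i + jl = m) (a : A.X i) (b : A.X j) (x : X l),
    act ij l m h₂ (A.mul i j ij h₁ a b) x = act i jl m h₄ a (act j l jl h₃ b x)
  d_d : ∀ i (x : X i), d (i + 1) (d i x) = 0
  leibniz : ∀ i j l (h : i + j = l) (a : A.X i) (x : X j),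
    d l (act i j l h a x) =
      act (i + 1) j (l + 1) (by omega) (A.d i a) x +
        i.negOnePow • act i (j + 1) (l + 1) (by omega) a (d j x)

attribute [instance] DGModule.addCommGroup DGModule.module

section Modules

variable {k : Type u} [Field k] {A : DGAlgebra k}

/-- A morphism of DG modules: `A`-linear, of degree zero, commuting with the differentials. -/
@[ext]
structure DGModule.Hom (M N : DGModule A) where
  /-- the component in degree `i` -/
  f : ∀ i, M.X i →ₗ[k] N.X i
  comm_d : ∀ i (x : M.X i), f (i + 1) (M.d i x) = N.d i (f i x)
  comm_act : ∀ i j l (h : i + j = l) (a : A.X i) (x : M.X j),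
    f l (M.act i j l h a x) = N.act i j l h a (f j x)

instance : Category (DGModule A) where
  Hom := DGModule.Hom
  id M := ⟨fun _ => LinearMap.id, fun _ _ => rfl, fun _ _ _ _ _ _ => rfl⟩
  comp g h := ⟨fun i => (h.f i).comp (g.f i), fun i x => by simp [g.comm_d, h.comm_d],
    fun i j l e a x => by simp [g.comm_act, h.comm_act]⟩

theorem hom_ext {M N : DGModule A} {g h : M ⟶ N} (e : ∀ i x, g.f i x = h.f i x) : g = h :=
  DGModule.Hom.ext (funext fun i => LinearMap.ext (e i))

@[simp] theorem id_f (M : DGModule A) (i : ℤ) (x : M.X i) : (𝟙 M : M ⟶ M).f i x = x := rfl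

@[simp] theorem comp_f {M N P : DGModule A} (g : M ⟶ N) (h : N ⟶ P) (i : ℤ) (x : M.X i) :
    (g ≫ h).f i x = h.f i (g.f i x) := rfl

instance (M N : DGModule A) : Zero (M ⟶ N) where
  zero := ⟨fun _ => 0, by simp, by simp⟩

instance (M N : DGModule A) : Add (M ⟶ N) where
  add g h := ⟨fun i => g.f i + h.f i, by simp [g.comm_d, h.comm_d],
    by simp [g.comm_act, h.comm_act]⟩

instance (M N : DGModule A) : Neg (M ⟶ N) where
  neg g := ⟨fun i => -g.f i, by simp [g.comm_d], by simp [g.comm_act]⟩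

instance (M N : DGModule A) : SMul k (M ⟶ N) where
  smul c g := ⟨fun i => c • g.f i, by simp [g.comm_d], by simp [g.comm_act]⟩

@[simp] theorem zero_f (M N : DGModule A) (i : ℤ) (x : M.X i) : (0 : M ⟶ N).f i x = 0 := rfl

@[simp] theorem add_f {M N : DGModule A} (g h : M ⟶ N) (i : ℤ) (x : M.X i) :
    (g + h).f i x = g.f i x + h.f i x := rfl

@[simp] theorem neg_f {M N : DGModule A} (g : M ⟶ N) (i : ℤ) (x : M.X i) :
    (-g).f i x = -g.f i x := rfl

@[simp] theorem smul_f {M N : DGModule A} (c : k) (g : M ⟶ N) (i : ℤ) (x : M.X i) :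
    (c • g).f i x = c • g.f i x := rfl

instance (M N : DGModule A) : AddCommGroup (M ⟶ N) where
  add_assoc _ _ _ := hom_ext fun _ _ => by simp [add_assoc]
  zero_add _ := hom_ext fun _ _ => by simp
  add_zero _ := hom_ext fun _ _ => by simp
  add_comm _ _ := hom_ext fun _ _ => by simp [add_comm]
  neg_add_cancel _ := hom_ext fun _ _ => by simp
  nsmul := nsmulRec
  zsmul := zsmulRec

@[simp] theorem sub_f {M N : DGModule A} (g h : M ⟶ N) (i : ℤ) (x : M.X i) :
    (g - h).f i x = g.f i x - h.f i x := by
  rw [sub_eq_add_neg, sub_eq_add_neg]; rfl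

instance (M N : DGModule A) : Module k (M ⟶ N) where
  one_smul _ := hom_ext fun _ _ => by simp
  mul_smul _ _ _ := hom_ext fun _ _ => by simp [mul_smul]
  smul_zero _ := hom_ext fun _ _ => by simp
  smul_add _ _ _ := hom_ext fun _ _ => by simp
  add_smul _ _ _ := hom_ext fun _ _ => by simp [add_smul]
  zero_smul _ := hom_ext fun _ _ => by simp

instance : Preadditive (DGModule A) where
  add_comp _ _ _ _ _ _ := hom_ext fun _ _ => by simp
  comp_add _ _ _ _ _ _ := hom_ext fun _ _ => by simp

instance : Linear k (DGModule A) where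
  smul_comp _ _ _ _ _ _ := hom_ext fun _ _ => by simp
  comp_smul _ _ _ _ _ _ := hom_ext fun _ _ => by simp

/-! ## The homotopy category -/

/-- A homotopy from `h` to `g`: an `A`-linear map `s` of degree `-1` with `g - h = d s + s d`. -/
structure Homotopy {M N : DGModule A} (g h : M ⟶ N) where
  /-- the component from degree `i + 1` to degree `i` -/
  s : ∀ i, M.X (i + 1) →ₗ[k] N.X i
  s_act : ∀ i j l (e : i + j = l) (a : A.X i) (x : M.X (j + 1)),
    s l (M.act i (j + 1) (l + 1) (by omega) a x) = i.negOnePow • N.act i j l e a (s j x)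
  comm : ∀ i (x : M.X (i + 1)),
    g.f (i + 1) x - h.f (i + 1) x = N.d i (s i x) + s (i + 1) (M.d (i + 1) x)

/-- The relation "`g` and `h` are homotopic" on morphisms of DG modules. -/
def homotopic (A : DGAlgebra k) : HomRel (DGModule A) := fun _ _ g h => Nonempty (Homotopy g h)

theorem units_smul_map {M N : Type u} [AddCommGroup M] [Module k M] [AddCommGroup N] [Module k N]
    (f : M →ₗ[k] N) (c : ℤˣ) (x : M) : f (c • x) = c • f x := by
  rcases Int.units_eq_one_or c with h | h <;> subst h <;> simp

theorem homotopic_refl {M N : DGModule A} (g : M ⟶ N) : homotopic A g g :=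
  ⟨⟨fun _ => 0, by simp, by simp⟩⟩

theorem homotopic_symm {M N : DGModule A} {g h : M ⟶ N} (H : homotopic A g h) :
    homotopic A h g := by
  obtain ⟨H⟩ := H
  refine ⟨⟨fun i => -H.s i, fun i j l e a x => by simp [H.s_act i j l e], fun i x => ?_⟩⟩
  have := H.comm i x
  simp only [LinearMap.neg_apply, map_neg]
  rw [← neg_sub, this]; abel

theorem homotopic_add {M N : DGModule A} {g g' h h' : M ⟶ N} (H : homotopic A g h)
    (H' : homotopic A g' h') : homotopic A (g + g') (h + h') := by
  obtain ⟨H⟩ := H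
  obtain ⟨H'⟩ := H'
  refine ⟨⟨fun i => H.s i + H'.s i, fun i j l e a x => by
    simp [H.s_act i j l e, H'.s_act i j l e],
    fun i x => ?_⟩⟩
  have h₁ := H.comm i x
  have h₂ := H'.comm i x
  simp only [LinearMap.add_apply, map_add, add_f]
  rw [add_sub_add_comm, h₁, h₂]; abel

theorem homotopic_trans {M N : DGModule A} {g h l : M ⟶ N} (H : homotopic A g h)
    (H' : homotopic A h l) : homotopic A g l := by
  obtain ⟨H⟩ := H
  obtain ⟨H'⟩ := H'
  refine ⟨⟨fun i => H.s i + H'.s i, fun i j l e a x => by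
    simp [H.s_act i j l e, H'.s_act i j l e],
    fun i x => ?_⟩⟩
  have h₁ := H.comm i x
  have h₂ := H'.comm i x
  simp only [LinearMap.add_apply, map_add]
  rw [← sub_add_sub_cancel, h₁, h₂]; abel

theorem homotopic_smul {M N : DGModule A} (c : k) {g h : M ⟶ N} (H : homotopic A g h) :
    homotopic A (c • g) (c • h) := by
  obtain ⟨H⟩ := H
  refine ⟨⟨fun i => c • H.s i, fun i j l e a x => ?_, fun i x => ?_⟩⟩
  · simp [H.s_act i j l e, smul_comm c]
  · simp [← smul_sub, H.comm]

theorem homotopic_comp_left {M N P : DGModule A} (l : M ⟶ N) {g h : N ⟶ P}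
    (H : homotopic A g h) : homotopic A (l ≫ g) (l ≫ h) := by
  obtain ⟨H⟩ := H
  exact ⟨⟨fun i => (H.s i).comp (l.f (i + 1)), fun i j l' e a x => by
    simp [l.comm_act, H.s_act i j l' e], fun i x => by simp [H.comm, l.comm_d]⟩⟩

theorem homotopic_comp_right {M N P : DGModule A} {g h : M ⟶ N} (H : homotopic A g h)
    (l : N ⟶ P) : homotopic A (g ≫ l) (h ≫ l) := by
  obtain ⟨H⟩ := H
  exact ⟨⟨fun i => (l.f i).comp (H.s i), fun i j l' e a x => by
    simp [l.comm_act, H.s_act i j l' e], fun i x => by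
    simp [← map_sub, H.comm, l.comm_d]⟩⟩

instance : Congruence (homotopic A) where
  equivalence := ⟨homotopic_refl, homotopic_symm, homotopic_trans⟩
  comp_left f _ _ H := homotopic_comp_left f H
  comp_right f H := homotopic_comp_right H f

variable (A) in
/-- The homotopy category `K(A)` of DG left `A`-modules. -/
abbrev HomotopyCat := CategoryTheory.Quotient (homotopic A)

variable (A) in
/-- The functor from DG modules to the homotopy category. -/
abbrev toK : DGModule A ⥤ HomotopyCat A := CategoryTheory.Quotient.functor (homotopic A)

noncomputable instance : Preadditive (HomotopyCat A) :=
  CategoryTheory.Quotient.preadditive _ fun _ _ _ _ _ _ H H' => homotopic_add H H'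

instance : (toK A).Additive :=
  CategoryTheory.Quotient.functor_additive _ fun _ _ _ _ _ _ H H' => homotopic_add H H'

noncomputable instance : Linear k (HomotopyCat A) :=
  CategoryTheory.Quotient.linear k _ fun c _ _ _ _ H => homotopic_smul c H

/-! ## Quasi-isomorphisms, suspension and mapping cones -/

/-- `g` is a quasi-isomorphism: it is injective and surjective on `ker d / im d` in each degree. -/
structure IsQuasiIso {M N : DGModule A} (g : M ⟶ N) : Prop where
  inj : ∀ i (x : M.X (i + 1)), M.d (i + 1) x = 0 → (∃ y, N.d i y = g.f (i + 1) x) →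
    ∃ z, M.d i z = x
  surj : ∀ i (y : N.X (i + 1)), N.d (i + 1) y = 0 →
    ∃ x, M.d (i + 1) x = 0 ∧ ∃ z, g.f (i + 1) x = y + N.d i z

/-- The suspension `Σ M`: `(Σ M)ⁱ = Mⁱ⁺¹`, with differential `-d` and `a • Σ x = (-1)^|a| Σ (a x)`. -/
def shift (M : DGModule A) : DGModule A where
  X i := M.X (i + 1)
  d i := -M.d (i + 1)
  act i j l h := i.negOnePow • M.act i (j + 1) (l + 1) (by omega)
  one_act j x := by simp [M.one_act]
  mul_act i j l ij jl m h₁ h₂ h₃ h₄ a b x := by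
    subst h₁
    simp only [LinearMap.smul_apply, units_smul_map, Int.negOnePow_add, mul_smul]
    rw [M.mul_act i j (l + 1) (i + j) (jl + 1) (m + 1) rfl (by omega) (by omega) (by omega)]
  d_d i x := by simp [M.d_d]
  leibniz i j l h a x := by
    simp only [LinearMap.smul_apply, LinearMap.neg_apply, units_smul_map]
    rw [M.leibniz i (j + 1) (l + 1) (by omega)]
    simp [Int.negOnePow_succ, smul_add, smul_smul, add_comm]

/-- The mapping cone of `g : M ⟶ N`: in degree `i` it is `Mⁱ⁺¹ × Nⁱ` with differential
`(x, y) ↦ (-dx, g x + dy)`. -/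
def cone {M N : DGModule A} (g : M ⟶ N) : DGModule A where
  X i := M.X (i + 1) × N.X i
  d i := ((-M.d (i + 1)).comp (LinearMap.fst k _ _)).prod
    ((g.f (i + 1)).comp (LinearMap.fst k _ _) + (N.d i).comp (LinearMap.snd k _ _))
  act i j l h := LinearMap.mk₂ k (fun a x =>
      (i.negOnePow • M.act i (j + 1) (l + 1) (by omega) a x.1, N.act i j l h a x.2))
    (by simp) (fun c a x => by simp [smul_comm _ c]) (by simp)
    (fun c a x => by simp [smul_comm _ c])
  one_act j x := by simp [M.one_act, N.one_act]
  mul_act i j l ij jl m h₁ h₂ h₃ h₄ a b x := by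
    subst h₁
    simp only [LinearMap.mk₂_apply, units_smul_map, Int.negOnePow_add, mul_smul]
    rw [M.mul_act i j (l + 1) (i + j) (jl + 1) (m + 1) rfl (by omega) (by omega) (by omega),
      N.mul_act i j l (i + j) jl m rfl h₂ h₃ h₄]
  d_d i x := by simp [M.d_d, N.d_d, g.comm_d]
  leibniz i j l h a x := by
    apply Prod.ext
    · simp [M.leibniz i (j + 1) (l + 1) (by omega), Int.negOnePow_succ, smul_add,
        smul_smul, add_comm]
    · simp [N.leibniz i j l h, g.comm_act, smul_add]
      abel

/-- The inclusion `N ⟶ cone g`. -/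
def coneInr {M N : DGModule A} (g : M ⟶ N) : N ⟶ cone g where
  f i := LinearMap.inr k (M.X (i + 1)) (N.X i)
  comm_d i x := by
    change ((0, N.d i x) : M.X (i + 1 + 1) × N.X (i + 1)) =
      (-M.d (i + 1) 0, g.f (i + 1) 0 + N.d i x)
    simp
  comm_act i j l h a x := by
    change ((0, N.act i j l h a x) : M.X (l + 1) × N.X l) =
      (i.negOnePow • M.act i (j + 1) (l + 1) _ a 0, N.act i j l h a x)
    simp

theorem comp_coneInr {M N : DGModule A} (g : M ⟶ N) : homotopic A (g ≫ coneInr g) 0 := by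
  refine ⟨⟨fun i => LinearMap.inl k (M.X (i + 1)) (N.X i), fun i j l e a x => ?_, fun i x => ?_⟩⟩
  · change ((M.act i (j + 1) (l + 1) _ a x, 0) : M.X (l + 1) × N.X l) =
      i.negOnePow • (i.negOnePow • M.act i (j + 1) (l + 1) _ a x, N.act i j l e a 0)
    simp [smul_smul]
  · refine Prod.ext ?_ ?_
    · change (0 : M.X (i + 1 + 1)) - 0 = -M.d (i + 1) x + M.d (i + 1) x
      simp
    · change g.f (i + 1) x - 0 = (g.f (i + 1) x + N.d i 0) + 0
      simp

/-- The product of two DG modules. -/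
def prod (M N : DGModule A) : DGModule A where
  X i := M.X i × N.X i
  d i := (M.d i).prodMap (N.d i)
  act i j l h := LinearMap.mk₂ k (fun a x => (M.act i j l h a x.1, N.act i j l h a x.2))
    (by simp) (by simp) (by simp) (by simp)
  one_act j x := by simp [M.one_act, N.one_act]
  mul_act i j l ij jl m h₁ h₂ h₃ h₄ a b x := by
    simp [M.mul_act i j l ij jl m h₁ h₂ h₃ h₄, N.mul_act i j l ij jl m h₁ h₂ h₃ h₄]
  d_d i x := by simp [M.d_d, N.d_d]
  leibniz i j l h a x := by simp [M.leibniz i j l h, N.leibniz i j l h]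

theorem isQuasiIso_id (M : DGModule A) : IsQuasiIso (𝟙 M) where
  inj _ _ _ h := h
  surj _ y hy := ⟨y, hy, 0, by simp⟩

theorem isQuasiIso_comp {M N P : DGModule A} {g : M ⟶ N} {h : N ⟶ P} (hg : IsQuasiIso g)
    (hh : IsQuasiIso h) : IsQuasiIso (g ≫ h) where
  inj i x hx e := hg.inj i x hx (hh.inj i _ (by rw [← g.comm_d, hx, map_zero]) e)
  surj i y hy := by
    obtain ⟨x, hx, z, e⟩ := hh.surj i y hy
    obtain ⟨x', hx', z', e'⟩ := hg.surj i x hx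
    refine ⟨x', hx', z + h.f i z', ?_⟩
    rw [comp_f, e', map_add, e, h.comm_d, map_add, add_assoc]

/-- Homotopy pushouts of quasi-isomorphisms are quasi-isomorphisms. -/
theorem exists_pushout {L M N : DGModule A} (s : L ⟶ M) (hs : IsQuasiIso s) (g : L ⟶ N) :
    ∃ (P : DGModule A) (t : N ⟶ P) (h : M ⟶ P), IsQuasiIso t ∧
      homotopic A (g ≫ t) (s ≫ h) := by
  let q : L ⟶ prod M N :=
    { f := fun i => (-s.f i).prod (g.f i)
      comm_d := fun i x => by
        change ((-s.f (i + 1) (L.d i x), g.f (i + 1) (L.d i x)) : M.X (i + 1) × N.X (i + 1)) =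
          (M.d i (-s.f i x), N.d i (g.f i x))
        simp [s.comm_d, g.comm_d]
      comm_act := fun i j l h a x => by
        change ((-s.f l (L.act i j l h a x), g.f l (L.act i j l h a x)) : M.X l × N.X l) =
          (M.act i j l h a (-s.f j x), N.act i j l h a (g.f j x))
        simp [s.comm_act, g.comm_act] }
  let iM : M ⟶ prod M N :=
    { f := fun i => LinearMap.inl k _ _
      comm_d := fun i x => by
        change ((M.d i x, 0) : M.X (i + 1) × N.X (i + 1)) = (M.d i x, N.d i 0)
        simp
      comm_act := fun i j l h a x => by
        change ((M.act i j l h a x, 0) : M.X l × N.X l) = (M.act i j l h a x, N.act i j l h a 0)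
        simp }
  let iN : N ⟶ prod M N :=
    { f := fun i => LinearMap.inr k _ _
      comm_d := fun i x => by
        change ((0, N.d i x) : M.X (i + 1) × N.X (i + 1)) = (M.d i 0, N.d i x)
        simp
      comm_act := fun i j l h a x => by
        change ((0, N.act i j l h a x) : M.X l × N.X l) = (M.act i j l h a 0, N.act i j l h a x)
        simp }
  refine ⟨cone q, iN ≫ coneInr q, iM ≫ coneInr q, ⟨?_, ?_⟩, ?_⟩
  · rintro i y hy ⟨⟨x', x, y₀⟩, e⟩
    have e₁ : -L.d (i + 1) x' = 0 := congrArg Prod.fst e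
    have e₂ : -s.f (i + 1) x' + M.d i x = 0 := congrArg (fun p => p.2.1) e
    have e₃ : g.f (i + 1) x' + N.d i y₀ = y := congrArg (fun p => p.2.2) e
    obtain ⟨w, rfl⟩ := hs.inj i x' (neg_eq_zero.1 e₁) ⟨x, by rw [← sub_eq_zero, ← e₂]; abel⟩
    exact ⟨g.f i w + y₀, by rw [map_add, ← g.comm_d, e₃]⟩
  · rintro i ⟨x', x, y⟩ e
    have e₁ : -L.d (i + 1 + 1) x' = 0 := congrArg Prod.fst e
    have e₂ : -s.f (i + 1 + 1) x' + M.d (i + 1) x = 0 := congrArg (fun p => p.2.1) e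
    have e₃ : g.f (i + 1 + 1) x' + N.d (i + 1) y = 0 := congrArg (fun p => p.2.2) e
    obtain ⟨w, rfl⟩ := hs.inj (i + 1) x' (neg_eq_zero.1 e₁)
      ⟨x, by rw [← sub_eq_zero, ← e₂]; abel⟩
    obtain ⟨v, hv, u, e₄⟩ := hs.surj i (x - s.f (i + 1) w) (by
      rw [map_sub, ← s.comm_d, ← e₂]; abel)
    have e₅ : x = s.f (i + 1) v - M.d i u + s.f (i + 1) w := by rw [e₄]; abel
    subst e₅
    refine ⟨y + g.f (i + 1) (w + v), ?_, ((w + v, u, 0) : L.X (i + 1) × M.X i × N.X i), ?_⟩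
    · rw [map_add, ← g.comm_d, map_add, hv, add_zero, ← e₃]; abel
    · refine Prod.ext ?_ (Prod.ext ?_ ?_)
      · change (0 : L.X (i + 1 + 1)) = L.d (i + 1) w + -L.d (i + 1) (w + v)
        simp [hv]
      · change (0 : M.X (i + 1)) = (s.f (i + 1) v - M.d i u + s.f (i + 1) w) +
          (-s.f (i + 1) (w + v) + M.d i u)
        rw [map_add]; abel
      · change y + g.f (i + 1) (w + v) = y + (g.f (i + 1) (w + v) + N.d i 0)
        simp
  · refine ⟨⟨fun i => LinearMap.inl k (L.X (i + 1)) ((prod M N).X i), fun i j l e a x => ?_,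
      fun i x => ?_⟩⟩
    · change ((L.act i (j + 1) (l + 1) _ a x, 0) : L.X (l + 1) × (prod M N).X l) =
        i.negOnePow • (i.negOnePow • L.act i (j + 1) (l + 1) _ a x, (prod M N).act i j l e a 0)
      simp [smul_smul]
    · refine Prod.ext ?_ (Prod.ext ?_ ?_)
      · change (0 : L.X (i + 1 + 1)) - 0 = -L.d (i + 1) x + L.d (i + 1) x
        simp
      · change (0 : M.X (i + 1)) - s.f (i + 1) x = (-s.f (i + 1) x + M.d i 0) + 0
        simp
      · change g.f (i + 1) x - 0 = (g.f (i + 1) x + N.d i 0) + 0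
        simp

theorem exists_coequalizing {L M N : DGModule A} (s : L ⟶ M) (hs : IsQuasiIso s) (g : M ⟶ N)
    (hg : homotopic A (s ≫ g) 0) :
    ∃ (P : DGModule A) (t : N ⟶ P), IsQuasiIso t ∧ homotopic A (g ≫ t) 0 := by
  obtain ⟨H⟩ := hg
  have hc : ∀ i (x : L.X (i + 1)), g.f (i + 1) (s.f (i + 1) x) =
      N.d i (H.s i x) + H.s (i + 1) (L.d (i + 1) x) := fun i x => by
    simpa using H.comm i x
  let q : cone s ⟶ N :=
    { f := fun i => (H.s i).coprod (g.f i)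
      comm_d := by
        rintro i ⟨x', x⟩
        change H.s (i + 1) (-L.d (i + 1) x') + g.f (i + 1) (s.f (i + 1) x' + M.d i x) =
          N.d i (H.s i x' + g.f i x)
        rw [map_neg, map_add, map_add, hc, g.comm_d]; abel
      comm_act := by
        rintro i j l h a ⟨x', x⟩
        change H.s l (i.negOnePow • L.act i (j + 1) (l + 1) _ a x') + g.f l (M.act i j l h a x) =
          N.act i j l h a (H.s j x' + g.f j x)
        rw [units_smul_map, H.s_act i j l h, smul_smul, map_add, g.comm_act]
        simp }
  have hq : coneInr s ≫ q = g := hom_ext fun i x => by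
    change H.s i 0 + g.f i x = g.f i x
    simp
  have hac : ∀ i (x : (cone s).X (i + 1)), (cone s).d (i + 1) x = 0 →
      ∃ z, (cone s).d i z = x := by
    rintro i ⟨x', x⟩ e
    have e₁ : -L.d (i + 1 + 1) x' = 0 := congrArg Prod.fst e
    have e₂ : s.f (i + 1 + 1) x' + M.d (i + 1) x = 0 := congrArg Prod.snd e
    obtain ⟨w, rfl⟩ := hs.inj (i + 1) x' (neg_eq_zero.1 e₁)
      ⟨-x, by rw [map_neg, ← sub_eq_zero, ← neg_eq_zero, ← e₂]; abel⟩
    obtain ⟨v, hv, u, e₄⟩ := hs.surj i (x + s.f (i + 1) w) (by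
      rw [map_add, ← s.comm_d, ← e₂]; abel)
    refine ⟨((v - w, -u) : L.X (i + 1) × M.X i), Prod.ext ?_ ?_⟩
    · change -L.d (i + 1) (v - w) = L.d (i + 1) w
      simp [hv]
    · change s.f (i + 1) (v - w) + M.d i (-u) = x
      rw [map_sub, e₄, map_neg]; abel
  refine ⟨cone q, coneInr q, ⟨?_, ?_⟩, ?_⟩
  · rintro i y hy ⟨⟨c, y₀⟩, e⟩
    have e₁ : -(cone s).d (i + 1) c = 0 := congrArg Prod.fst e
    have e₂ : q.f (i + 1) c + N.d i y₀ = y := congrArg Prod.snd e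
    obtain ⟨b, rfl⟩ := hac i c (neg_eq_zero.1 e₁)
    exact ⟨q.f i b + y₀, by rw [map_add, ← q.comm_d, e₂]⟩
  · rintro i ⟨c, y⟩ e
    have e₁ : -(cone s).d (i + 1 + 1) c = 0 := congrArg Prod.fst e
    have e₂ : q.f (i + 1 + 1) c + N.d (i + 1) y = 0 := congrArg Prod.snd e
    obtain ⟨b, rfl⟩ := hac (i + 1) c (neg_eq_zero.1 e₁)
    refine ⟨y + q.f (i + 1) b, ?_, ((b, 0) : (cone s).X (i + 1) × N.X i), Prod.ext ?_ ?_⟩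
    · rw [map_add, ← q.comm_d, ← e₂]; abel
    · change (0 : (cone s).X (i + 1 + 1)) = (cone s).d (i + 1) b + -(cone s).d (i + 1) b
      simp
    · change y + q.f (i + 1) b = y + (q.f (i + 1) b + N.d i 0)
      simp
  · have := homotopic_comp_left (coneInr s) (comp_coneInr q)
    rw [← Category.assoc, hq, comp_zero] at this
    exact this

/-! ## The derived category -/

variable (A) in
/-- The class of quasi-isomorphisms in the homotopy category `K(A)`. -/
def quasiIso : MorphismProperty (HomotopyCat A) := fun M N g =>
  ∃ g₀ : M.as ⟶ N.as, IsQuasiIso g₀ ∧ (toK A).map g₀ = g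

theorem toK_map_eq_iff {M N : DGModule A} (g h : M ⟶ N) :
    (toK A).map g = (toK A).map h ↔ homotopic A g h :=
  CategoryTheory.Quotient.functor_map_eq_iff _ g h

instance : (quasiIso A).HasLeftCalculusOfFractions where
  id_mem M := ⟨𝟙 M.as, isQuasiIso_id _, (toK A).map_id _⟩
  comp_mem := by
    rintro L M N _ _ ⟨g, hg, rfl⟩ ⟨h, hh, rfl⟩
    exact ⟨g ≫ h, isQuasiIso_comp hg hh, (toK A).map_comp _ _⟩
  exists_leftFraction := by
    rintro ⟨M⟩ ⟨N⟩ ⟨s, ⟨s, hs, rfl⟩, f⟩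
    obtain ⟨f, rfl⟩ := (toK A).map_surjective f
    obtain ⟨P, t, h, ht, e⟩ := exists_pushout s hs f
    refine ⟨⟨(toK A).map h, (toK A).map t, ⟨t, ht, rfl⟩⟩, ?_⟩
    have e' := (toK_map_eq_iff _ _).2 e
    rw [Functor.map_comp, Functor.map_comp] at e'
    exact e'
  ext := by
    rintro ⟨L⟩ ⟨M⟩ ⟨N⟩ f₁ f₂ _ ⟨s, hs, rfl⟩ e
    obtain ⟨f₁, rfl⟩ := (toK A).map_surjective f₁
    obtain ⟨f₂, rfl⟩ := (toK A).map_surjective f₂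
    have e₁ : (toK A).map (s ≫ (f₁ - f₂)) = (toK A).map 0 := by
      rw [Functor.map_comp, Functor.map_sub, Preadditive.comp_sub, Functor.map_zero]
      exact sub_eq_zero.2 e
    obtain ⟨P, t, ht, e₂⟩ := exists_coequalizing s hs _ ((toK_map_eq_iff _ _).1 e₁)
    refine ⟨(toK A).obj P, (toK A).map t, ⟨t, ht, rfl⟩, ?_⟩
    have e₃ := (toK_map_eq_iff _ _).2 e₂
    rw [Functor.map_comp, Functor.map_sub, Preadditive.sub_comp, Functor.map_zero] at e₃
    exact sub_eq_zero.1 e₃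

variable (A) in
/-- The derived category `D(A)` of DG left `A`-modules: the localization of the homotopy category at
the quasi-isomorphisms, with the `k`-linear structure for which the localization functor is
`k`-linear. -/
abbrev D := (quasiIso A).Localization

variable (A) in
/-- The functor from DG modules to the derived category; it is bijective on objects. -/
noncomputable abbrev toD : DGModule A ⥤ D A := toK A ⋙ (quasiIso A).Q

/-! ## Thick subcategories -/

/-- A full subcategory of `D(A)` is thick (a triangulated subcategory closed under direct summands,
hence also under isomorphisms) if it is closed under `Σ` and `Σ⁻¹`, under retracts, and if it contains
all three objects of a distinguished triangle as soon as it contains two of them. The distinguished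
triangles of `D(A)` are those isomorphic to `M ⟶ N ⟶ cone g ⟶ Σ M` for a morphism `g : M ⟶ N` of DG
modules. -/
structure IsThick (P : ObjectProperty (D A)) : Prop where
  of_retract : ∀ X Y : D A, Retract X Y → P Y → P X
  shift_iff : ∀ M : DGModule A, P ((toD A).obj (shift M)) ↔ P ((toD A).obj M)
  of_cone₁ : ∀ (M N : DGModule A) (g : M ⟶ N), P ((toD A).obj N) → P ((toD A).obj (cone g)) →
    P ((toD A).obj M)
  of_cone₂ : ∀ (M N : DGModule A) (g : M ⟶ N), P ((toD A).obj M) → P ((toD A).obj (cone g)) →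
    P ((toD A).obj N)
  of_cone₃ : ∀ (M N : DGModule A) (g : M ⟶ N), P ((toD A).obj M) → P ((toD A).obj N) →
    P ((toD A).obj (cone g))

/-- The thick subcategory `⟨S⟩` of `D(A)` generated by a DG module `S`: the smallest one that
contains `S`. -/
def thickGeneratedBy (S : DGModule A) : ObjectProperty (D A) := fun X =>
  ∀ P : ObjectProperty (D A), IsThick P → P ((toD A).obj S) → P X

end Modules

/-! ## The polynomial DG algebra and the category `T` -/

section Polynomial

variable (k : Type u) [Field k]

open Polynomial

/-- The homogeneous piece of degree `i` of `k[X]` when the variable has degree `e`. -/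
def polyPart (e i : ℤ) : Submodule k k[X] where
  carrier := {p | ∀ n : ℕ, p.coeff n ≠ 0 → n * e = i}
  add_mem' {p q} hp hq n hn := by
    by_cases h : p.coeff n = 0
    · exact hq n (by simpa [h] using hn)
    · exact hp n h
  zero_mem' n hn := by simp at hn
  smul_mem' c p hp n hn := hp n (by
    rw [coeff_smul, smul_eq_mul] at hn
    exact right_ne_zero_of_mul hn)

variable {k} in
theorem mul_mem_polyPart {e i j l : ℤ} (h : i + j = l) {p q : k[X]} (hp : p ∈ polyPart k e i)
    (hq : q ∈ polyPart k e j) : p * q ∈ polyPart k e l := by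
  intro n hn
  rw [coeff_mul] at hn
  obtain ⟨x, hx, hne⟩ := Finset.exists_ne_zero_of_sum_ne_zero hn
  have h₁ := hp x.1 (left_ne_zero_of_mul hne)
  have h₂ := hq x.2 (right_ne_zero_of_mul hne)
  have h₃ := Finset.HasAntidiagonal.mem_antidiagonal.1 hx
  rw [← h, ← h₁, ← h₂, ← h₃]
  push_cast
  ring

/-- The polynomial algebra `k[T]` with `T` in cohomological degree `e` and zero differential, as a
DG algebra. -/
noncomputable def polyDGA (e : ℤ) : DGAlgebra k where
  X i := polyPart k e i
  d _ := 0
  mul i j l h := LinearMap.mk₂ k (fun p q => ⟨p.1 * q.1, mul_mem_polyPart h p.2 q.2⟩)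
    (fun _ _ _ => Subtype.ext (add_mul _ _ _)) (fun _ _ _ => Subtype.ext (smul_mul_assoc _ _ _))
    (fun _ _ _ => Subtype.ext (mul_add _ _ _)) (fun _ _ _ => Subtype.ext (mul_smul_comm _ _ _))
  one := ⟨1, fun n hn => by
    rcases Nat.eq_zero_or_pos n with rfl | h
    · simp
    · rw [coeff_one, if_neg (by omega)] at hn
      exact absurd rfl hn⟩
  one_mul _ _ := Subtype.ext (one_mul _)
  mul_one _ _ := Subtype.ext (mul_one _)
  mul_assoc _ _ _ _ _ _ _ _ _ _ _ _ _ := Subtype.ext (mul_assoc _ _ _)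
  d_d _ _ := rfl
  leibniz i j l h p q := Subtype.ext (by
    change (0 : k[X]) = 0 * q.1 + ((i.negOnePow • (⟨p.1 * 0, _⟩ : polyPart k e (l + 1))).1)
    rcases Int.units_eq_one_or i.negOnePow with h | h <;> rw [h] <;> simp)

/-- The piece of degree `i` of the field `k` placed in degree `0`. -/
def trivialPart (i : ℤ) : Submodule k k where
  carrier := {c | i ≠ 0 → c = 0}
  add_mem' ha hb h := by rw [ha h, hb h, add_zero]
  zero_mem' _ := rfl
  smul_mem' c x hx h := by rw [hx h, smul_zero]

/-- The trivial DG module `k = k[T] / (T)`, concentrated in degree `0`: a polynomial acts through its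
constant coefficient. -/
noncomputable def trivialModule (e : ℤ) : DGModule (polyDGA k e) where
  X i := trivialPart k i
  d _ := 0
  act i j l h := LinearMap.mk₂ k (fun p c => ⟨p.1.coeff 0 * c.1, fun hl => by
      by_contra hne
      have hi := p.2 0 (left_ne_zero_of_mul hne)
      have hj : j = 0 := by
        by_contra hj
        exact right_ne_zero_of_mul hne (c.2 hj)
      simp at hi
      omega⟩)
    (fun p q c => Subtype.ext (by
      change (p.1 + q.1).coeff 0 * c.1 = p.1.coeff 0 * c.1 + q.1.coeff 0 * c.1
      rw [coeff_add, add_mul]))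
    (fun a p c => Subtype.ext (by
      change (a • p.1).coeff 0 * c.1 = a * (p.1.coeff 0 * c.1)
      rw [coeff_smul, smul_eq_mul, mul_assoc]))
    (fun _ _ _ => Subtype.ext (mul_add _ _ _))
    (fun _ _ _ => Subtype.ext (mul_left_comm _ _ _))
  one_act j c := Subtype.ext (by
    change (1 : k[X]).coeff 0 * c.1 = c.1
    simp)
  mul_act _ _ _ _ _ _ _ _ _ _ p q c := Subtype.ext (by
    change (p.1 * q.1).coeff 0 * c.1 = p.1.coeff 0 * (q.1.coeff 0 * c.1)
    rw [mul_coeff_zero, mul_assoc])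
  d_d _ _ := rfl
  leibniz i j l h p c := Subtype.ext (by
    change (0 : k) = (0 : k[X]).coeff 0 * c.1 +
      ((i.negOnePow • (⟨p.1.coeff 0 * 0, _⟩ : trivialPart k (l + 1))).1)
    rcases Int.units_eq_one_or i.negOnePow with h | h <;> rw [h] <;> simp)

/-- The DG algebra `A = k[T]` with `T` in homological degree `d = w - 1`. -/
noncomputable abbrev algA (w : ℤ) : DGAlgebra k := polyDGA k (-(w - 1))

/-- The category `T = ⟨k⟩`, the thick subcategory of `D(A)` generated by the trivial DG module
`k`. -/
abbrev TCat (w : ℤ) :=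
  (thickGeneratedBy (A := algA k w) (trivialModule k (-(w - 1)))).FullSubcategory

end Polynomial

/-! ## Auslander-Reiten quivers and the regions `F⁺` and `F⁻` -/

section AuslanderReiten

universe v' u'

variable {C : Type u'} [Category.{v'} C] [Preadditive C]

/-- An object is indecomposable if it is non-zero and in every decomposition of it as a direct sum of
two objects, one of them is zero. -/
def IsIndecomposable (X : C) : Prop :=
  ¬ IsZero X ∧ ∀ (Y Z : C) (b : BinaryBicone Y Z), Nonempty b.IsBilimit → Nonempty (b.pt ≅ X) →
    IsZero Y ∨ IsZero Z

/-- An irreducible morphism: neither a split monomorphism nor a split epimorphism, and in every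
factorization of it the first factor is a split monomorphism or the second is a split epimorphism. -/
structure IsIrreducible {X Y : C} (f : X ⟶ Y) : Prop where
  not_splitMono : ¬ IsSplitMono f
  not_splitEpi : ¬ IsSplitEpi f
  factor : ∀ (Z : C) (g : X ⟶ Z) (h : Z ⟶ Y), g ≫ h = f → IsSplitMono g ∨ IsSplitEpi h

/-- There is an arrow from (the isomorphism class of) `X` to that of `Y` in the Auslander-Reiten
quiver of `C`: both objects are indecomposable and there is an irreducible morphism `X ⟶ Y`. -/
def ARArrow (X Y : C) : Prop :=
  IsIndecomposable X ∧ IsIndecomposable Y ∧ ∃ f : X ⟶ Y, IsIrreducible f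

/-- The arrows of the quiver `ℤA∞` with vertices `(n, r)`, `n : ℤ`, `r : ℕ`: an arrow `(n, r) ⟶ (n, r + 1)`
(drawn going up and right) and an arrow `(n, r + 1) ⟶ (n + 1, r)` (drawn going down and right). The
vertex `(n, r)` has height `r` above the base line and horizontal position `2 n + r`. -/
def ZAArrow (n : ℤ) (r : ℕ) (m : ℤ) (s : ℕ) : Prop :=
  (m = n ∧ s = r + 1) ∨ (m = n + 1 ∧ r = s + 1)

/-- `φ` identifies the quiver `ℤA∞` with a component of the Auslander-Reiten quiver of `C`. -/
structure IsZAComponent (φ : ℤ → ℕ → C) : Prop where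
  indecomposable : ∀ n r, IsIndecomposable (φ n r)
  injective : ∀ n r m s, Nonempty (φ n r ≅ φ m s) → n = m ∧ r = s
  arrow_iff : ∀ n r m s, ARArrow (φ n r) (φ m s) ↔ ZAArrow n r m s
  arrow_from : ∀ n r (X : C), ARArrow (φ n r) X → ∃ m s, Nonempty (X ≅ φ m s)
  arrow_to : ∀ n r (X : C), ARArrow X (φ n r) → ∃ m s, Nonempty (X ≅ φ m s)

/-- The region `F⁺(t)`. If `t` is the vertex `(n, r)` of a component `ℤA∞` of the Auslander-Reiten quiver,
it consists of the vertices of the component in the half-infinite rectangle, boundaries included, that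
is bounded by the upward right-going ray from `t` (`m = n`), the downward right-going segment from `t`
to the base line (`m + s = n + r`), and the upward right-going ray from the end of that
segment (`m = n + r`). -/
def FPlus (t : C) : Set C :=
  {u | ∃ φ : ℤ → ℕ → C, IsZAComponent φ ∧ ∃ (n : ℤ) (r : ℕ) (m : ℤ) (s : ℕ),
    Nonempty (t ≅ φ n r) ∧ Nonempty (u ≅ φ m s) ∧ n ≤ m ∧ m ≤ n + r ∧ n + r ≤ m + s}

/-- The region `F⁻(t)`, the mirror image of `F⁺(t)`. If `t` is the vertex `(n, r)`, it is the
half-infinite rectangle bounded by the upward left-going ray from `t` (`m + s = n + r`), the downward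
left-going segment from `t` to the base line (`m = n`), and the upward left-going ray from the
end of that segment (`m + s = n`). -/
def FMinus (t : C) : Set C :=
  {u | ∃ φ : ℤ → ℕ → C, IsZAComponent φ ∧ ∃ (n : ℤ) (r : ℕ) (m : ℤ) (s : ℕ),
    Nonempty (t ≅ φ n r) ∧ Nonempty (u ≅ φ m s) ∧ m ≤ n ∧ n ≤ m + s ∧ m + s ≤ n + r}

end AuslanderReiten

end DGCat

/-! With `T` in cohomological degree 1, the building blocks are the interval modules: `k` in the
degrees `[a, b]`, joined by `T`. Such a module is resolved by the module free on a cycle `e` of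
degree `a` and on `f` of degree `b` with `d f = T ^ (b + 1 - a) e`. Morphisms in the derived
category from it to any `M` are therefore the pairs `(x, y)` with `d x = 0` and `d y = T ^ (b + 1 -
a) x`, modulo the pairs `(d z, d w ± T ^ (b + 1 - a) z)` (`pairHom_surjective`,
`pairHom_eq_zero_iff`). If `M` is the interval module of `[c, d]`, the coordinate `x` contributes a
line iff `c ≤ a ≤ d ≤ b`, and `y` contributes one iff `a ≤ c ≤ b ≤ d`. When `(n, r)` stands for `[-n
- r, -n]`, these are exactly the conditions defining `F⁺` and `F⁻`, and both hold only on the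
diagonal.

It remains to identify the indecomposable objects and the Auslander-Reiten quiver. Both rest on the
endomorphism `ε : (e, f) ↦ (0, T ^ (b - a) e)` of an interval object, whose endomorphism ring is
`k[ε]` with `ε² = 0`. A graded-cofree coresolution of the same interval module represents the dual
of the functor of pairs, so every non-zero morphism out of an interval object `S` composes to
something non-zero with a morphism back to `S` (`exists_comp_ne_zero`). Applied to `ε ≫ g`, this
shows that `g` splits as soon as `ε ≫ g ≠ 0` (`exists_retraction`). If `ε ≫ g = 0`, an explicit
manipulation of pairs factors `g` through the neighbours `[a - 1, b]` and `[a, b - 1]`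
(`exists_eq_stdUp_add_stdDown`). This is the almost split triangle in elementary form.

On every object of `⟨k⟩` a power of `T` annihilates the cohomology. Taking the least such power on a
non-zero object produces a morphism from an interval object that is not killed by `ε`, hence an
interval summand; so the indecomposables are the interval objects (`exists_iso_vertex`). The
factorization property and the bound on dimensions show that the irreducible maps between them are
those to the two neighbours. Hence there is a single component `ℤA∞`. Its identification with the
quiver is unique up to translation, so the regions `F⁺` and `F⁻` do not depend on the identification
used to define them. -/

namespace DGCat

open CategoryTheory CategoryTheory.Limits

/-! ### Boundaries, quasi-isomorphisms and acyclicity. -/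

section Boundaries

variable {k : Type u} [Field k] {A : DGAlgebra k}

/-- The differential `Mⁱ ⟶ Mʲ` for `j = i + 1`. -/
def DGModule.dl (M : DGModule A) (i j : ℤ) (h : i + 1 = j) : M.X i →ₗ[k] M.X j := by
  subst h; exact M.d i

theorem comm_dl {M N : DGModule A} (g : M ⟶ N) {i j : ℤ} (h : i + 1 = j) (x : M.X i) :
    g.f j (M.dl i j h x) = N.dl i j h (g.f i x) := by
  subst h; exact g.comm_d i x

/-- The boundaries of degree `j`. -/
def DGModule.bdry (M : DGModule A) (j : ℤ) : Submodule k (M.X j) :=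
  LinearMap.range (M.dl (j - 1) j (sub_add_cancel j 1))

theorem dl_mem_bdry (M : DGModule A) {i j : ℤ} (h : i + 1 = j) (x : M.X i) :
    M.dl i j h x ∈ M.bdry j := by
  obtain rfl : i = j - 1 := by omega
  exact ⟨x, rfl⟩

theorem d_mem_bdry (M : DGModule A) {i : ℤ} (x : M.X i) : M.d i x ∈ M.bdry (i + 1) :=
  dl_mem_bdry M rfl x

theorem exists_of_mem_bdry {M : DGModule A} {i j : ℤ} (h : i + 1 = j) {x : M.X j}
    (hx : x ∈ M.bdry j) : ∃ z, M.dl i j h z = x := by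
  obtain rfl : i = j - 1 := by omega
  exact hx

theorem map_mem_bdry {M N : DGModule A} (g : M ⟶ N) {j : ℤ} {x : M.X j} (hx : x ∈ M.bdry j) :
    g.f j x ∈ N.bdry j := by
  obtain ⟨z, rfl⟩ := hx
  rw [comm_dl]
  exact dl_mem_bdry _ _ _

theorem isQuasiIso_of {M N : DGModule A} {g : M ⟶ N}
    (h₁ : ∀ j (x : M.X j), M.d j x = 0 → g.f j x ∈ N.bdry j → x ∈ M.bdry j)
    (h₂ : ∀ j (y : N.X j), N.d j y = 0 → ∃ x, M.d j x = 0 ∧ g.f j x - y ∈ N.bdry j) :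
    IsQuasiIso g where
  inj i x hx hy := by
    obtain ⟨y, hy⟩ := hy
    exact exists_of_mem_bdry (i := i) rfl (h₁ (i + 1) x hx (hy ▸ d_mem_bdry N y))
  surj i y hy := by
    obtain ⟨x, hx, h⟩ := h₂ (i + 1) y hy
    obtain ⟨z, hz⟩ := exists_of_mem_bdry (i := i) rfl h
    exact ⟨x, hx, z, by rw [← sub_eq_iff_eq_add']; exact hz.symm⟩

theorem IsQuasiIso.mem_bdry {M N : DGModule A} {g : M ⟶ N} (hg : IsQuasiIso g) {j : ℤ} {x : M.X j}
    (hx : M.d j x = 0) (h : g.f j x ∈ N.bdry j) : x ∈ M.bdry j := by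
  obtain ⟨i, rfl⟩ : ∃ i, j = i + 1 := ⟨j - 1, by omega⟩
  obtain ⟨z, rfl⟩ := hg.inj i x hx (exists_of_mem_bdry (i := i) rfl h)
  exact d_mem_bdry M z

theorem IsQuasiIso.exists_cycle {M N : DGModule A} {g : M ⟶ N} (hg : IsQuasiIso g) {j : ℤ}
    {y : N.X j} (hy : N.d j y = 0) : ∃ x, M.d j x = 0 ∧ g.f j x - y ∈ N.bdry j := by
  obtain ⟨i, rfl⟩ : ∃ i, j = i + 1 := ⟨j - 1, by omega⟩
  obtain ⟨x, hx, z, hz⟩ := hg.surj i y hy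
  exact ⟨x, hx, by rw [hz, add_sub_cancel_left]; exact d_mem_bdry N z⟩

theorem homotopic_sub_mem_bdry {M N : DGModule A} {g h : M ⟶ N} (H : homotopic A g h) {j : ℤ}
    {x : M.X j} (hx : M.d j x = 0) : g.f j x - h.f j x ∈ N.bdry j := by
  obtain ⟨H⟩ := H
  obtain ⟨i, rfl⟩ : ∃ i, j = i + 1 := ⟨j - 1, by omega⟩
  rw [H.comm, hx, map_zero, add_zero]
  exact d_mem_bdry N _

theorem IsQuasiIso.of_homotopic {M N : DGModule A} {g h : M ⟶ N} (hg : IsQuasiIso g)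
    (H : homotopic A g h) : IsQuasiIso h := by
  refine isQuasiIso_of (fun j x hx hb => hg.mem_bdry hx ?_) fun j y hy => ?_
  · have := add_mem (homotopic_sub_mem_bdry H hx) hb
    rwa [sub_add_cancel] at this
  · obtain ⟨x, hx, hb⟩ := hg.exists_cycle hy
    refine ⟨x, hx, ?_⟩
    have := sub_mem hb (homotopic_sub_mem_bdry H hx)
    convert this using 1
    abel

/-- The complex underlying `M` is exact. -/
def IsAcyclic (M : DGModule A) : Prop := ∀ j (x : M.X j), M.d j x = 0 → x ∈ M.bdry j

end Boundaries

/-! ### Calculus of fractions in the derived category. -/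

section DerivedCategory

variable {k : Type u} [Field k] {A : DGAlgebra k}

instance : (toK A).Linear k :=
  CategoryTheory.Quotient.linear_functor k _ fun c _ _ _ _ H => homotopic_smul c H

theorem isIso_toD_map {M N : DGModule A} {g : M ⟶ N} (hg : IsQuasiIso g) :
    IsIso ((toD A).map g) :=
  Localization.inverts (quasiIso A).Q (quasiIso A) _ ⟨g, hg, rfl⟩

theorem toD_map_eq_iff {M N : DGModule A} (g h : M ⟶ N) :
    (toD A).map g = (toD A).map h ↔
      ∃ (N' : DGModule A) (s : N ⟶ N'), IsQuasiIso s ∧ homotopic A (g ≫ s) (h ≫ s) := by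
  change (quasiIso A).Q.map ((toK A).map g) = (quasiIso A).Q.map ((toK A).map h) ↔ _
  rw [MorphismProperty.map_eq_iff_postcomp (quasiIso A).Q (quasiIso A)]
  constructor
  · rintro ⟨N', _, ⟨s, hs, rfl⟩, e⟩
    refine ⟨N'.as, s, hs, ?_⟩
    rw [← toK_map_eq_iff, Functor.map_comp, Functor.map_comp]
    exact e
  · rintro ⟨N', s, hs, e⟩
    refine ⟨(toK A).obj N', (toK A).map s, ⟨s, hs, rfl⟩, ?_⟩
    rw [← toK_map_eq_iff, Functor.map_comp, Functor.map_comp] at e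
    exact e

theorem toD_map_eq_of_homotopic {M N : DGModule A} {g h : M ⟶ N} (H : homotopic A g h) :
    (toD A).map g = (toD A).map h :=
  (toD_map_eq_iff g h).2 ⟨N, 𝟙 N, isQuasiIso_id N, homotopic_comp_right H _⟩

theorem exists_fraction {M N : DGModule A} (φ : (toD A).obj M ⟶ (toD A).obj N) :
    ∃ (N' : DGModule A) (g : M ⟶ N') (s : N ⟶ N'), IsQuasiIso s ∧
      φ ≫ (toD A).map s = (toD A).map g := by
  obtain ⟨⟨g, s, hs⟩, rfl⟩ := Localization.exists_leftFraction (quasiIso A).Q (quasiIso A)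
    (X := (toK A).obj M) (Y := (toK A).obj N) φ
  obtain ⟨s, hs', rfl⟩ := hs
  obtain ⟨g, rfl⟩ := (toK A).map_surjective g
  exact ⟨_, g, s, hs', MorphismProperty.LeftFraction.map_comp_map_s _ _ _⟩

theorem exists_toD_obj (X : D A) : ∃ M : DGModule A, Nonempty ((toD A).obj M ≅ X) := by
  obtain ⟨M, ⟨e⟩⟩ := (Localization.essSurj (quasiIso A).Q (quasiIso A)).mem_essImage X
  exact ⟨M.as, ⟨e⟩⟩

/-- Turns a one-sided inverse in the derived category into an honest morphism `h` of DG modules for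
which `g ≫ h` is a quasi-isomorphism, so that splittings can be handled on elements. -/
theorem exists_quasiIso_comp {M N L : DGModule A} (g : M ⟶ N) {φ : (toD A).obj N ⟶ (toD A).obj L}
    {s : M ⟶ L} (hs : IsQuasiIso s) (h : (toD A).map g ≫ φ = (toD A).map s) :
    ∃ (N' : DGModule A) (h : N ⟶ N') (t : L ⟶ N'), IsQuasiIso (g ≫ h) ∧ IsQuasiIso t ∧
      φ ≫ (toD A).map t = (toD A).map h := by
  obtain ⟨N', f, t, ht, e⟩ := exists_fraction φ
  have : (toD A).map (s ≫ t) = (toD A).map (g ≫ f) := by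
    rw [Functor.map_comp, Functor.map_comp, ← h, Category.assoc, e]
  obtain ⟨N'', v, hv, H⟩ := (toD_map_eq_iff _ _).1 this
  refine ⟨N'', f ≫ v, t ≫ v, ?_, isQuasiIso_comp ht hv, ?_⟩
  · rw [← Category.assoc]
    exact (isQuasiIso_comp (isQuasiIso_comp hs ht) hv).of_homotopic H
  · rw [Functor.map_comp, ← Category.assoc, e, Functor.map_comp]

theorem IsQuasiIso.mem_bdry_of_comp {M N L : DGModule A} {g : M ⟶ N} {h : N ⟶ L}
    (H : IsQuasiIso (g ≫ h)) {j : ℤ} {x : M.X j} (hx : M.d j x = 0) (hb : g.f j x ∈ N.bdry j) :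
    x ∈ M.bdry j :=
  H.mem_bdry hx (map_mem_bdry h hb)

theorem isZero_toD_obj_iff (M : DGModule A) : IsZero ((toD A).obj M) ↔ IsAcyclic M := by
  constructor
  · intro hM j x hx
    obtain ⟨N, s, hs, H⟩ := (toD_map_eq_iff (𝟙 M) 0).1 (hM.eq_of_src _ _)
    refine hs.mem_bdry hx ?_
    simpa using homotopic_sub_mem_bdry H hx
  · intro hM
    -- On an acyclic module the zero endomorphism is a quasi-isomorphism; it becomes invertible,
    -- which forces the object to vanish.
    have h : IsQuasiIso (0 : M ⟶ M) :=
      isQuasiIso_of (fun j x hx _ => hM j x hx) fun j y hy => ⟨0, by simp, by simpa using hM j y hy⟩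
    have := isIso_toD_map h
    rw [IsZero.iff_id_eq_zero, ← cancel_mono ((toD A).map (0 : M ⟶ M))]
    simp

end DerivedCategory

/-! ### Mapping cones, products and splittings. -/

section Cones

variable {k : Type u} [Field k] {A : DGAlgebra k}

/-- The morphism `cone g ⟶ L` induced by `q : N ⟶ L` with `g ≫ q = 0`. -/
def coneDesc {M N L : DGModule A} (g : M ⟶ N) (q : N ⟶ L) (h : g ≫ q = 0) : cone g ⟶ L where
  f i := (q.f i).comp (LinearMap.snd k _ _)
  comm_d i x := by
    have : q.f (i + 1) (g.f (i + 1) x.1) = 0 := by rw [← comp_f, h, zero_f]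
    change q.f (i + 1) (g.f (i + 1) x.1 + N.d i x.2) = L.d i (q.f i x.2)
    rw [map_add, this, zero_add, q.comm_d]
  comm_act i j l e a x := q.comm_act i j l e a x.2

theorem cone_d {M N : DGModule A} (g : M ⟶ N) (i : ℤ) (x : M.X (i + 1)) (y : N.X i) :
    (cone g).d i (x, y) = (-M.d (i + 1) x, g.f (i + 1) x + N.d i y) := rfl

/-- The cone of the first morphism of a short exact sequence is quasi-isomorphic to its cokernel. -/
theorem isQuasiIso_coneDesc {M N L : DGModule A} (g : M ⟶ N) (q : N ⟶ L) (h : g ≫ q = 0)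
    (hg : ∀ j, Function.Injective (g.f j)) (hq : ∀ j, Function.Surjective (q.f j))
    (he : ∀ j x, q.f j x = 0 → ∃ y, g.f j y = x) : IsQuasiIso (coneDesc g q h) where
  inj := by
    rintro i ⟨x, y⟩ hx ⟨w, hw⟩
    have e₂ : g.f (i + 1 + 1) x + N.d (i + 1) y = 0 := congrArg Prod.snd hx
    change L.d i w = q.f (i + 1) y at hw
    obtain ⟨w, rfl⟩ := hq i w
    obtain ⟨z, hz⟩ := he (i + 1) (y - N.d i w) (by rw [map_sub, ← hw, q.comm_d, sub_self])
    refine ⟨(z, w), Prod.ext (hg _ ?_) ?_⟩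
    · change g.f (i + 1 + 1) (-M.d (i + 1) z) = g.f (i + 1 + 1) x
      rw [map_neg, g.comm_d, hz, map_sub, N.d_d, sub_zero, eq_comm, ← sub_eq_zero, ← e₂]
      abel
    · change g.f (i + 1) z + N.d i w = y
      rw [hz, sub_add_cancel]
  surj := by
    intro i y hy
    obtain ⟨y, rfl⟩ := hq (i + 1) y
    obtain ⟨z, hz⟩ := he (i + 1 + 1) (N.d (i + 1) y) (by rw [q.comm_d, hy])
    refine ⟨(-z, y), Prod.ext (hg _ ?_) ?_, 0, ?_⟩
    · change g.f _ (-M.d (i + 1 + 1) (-z)) = g.f _ 0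
      rw [(M.d _).map_neg, neg_neg, g.comm_d, hz, N.d_d, map_zero]
    · change g.f (i + 1 + 1) (-z) + N.d (i + 1) y = 0
      rw [map_neg, hz, neg_add_cancel]
    · rw [map_zero, add_zero]
      rfl

theorem isQuasiIso_of_isAcyclic_cone {M N : DGModule A} {g : M ⟶ N} (h : IsAcyclic (cone g)) :
    IsQuasiIso g := by
  refine ⟨fun i x hx ⟨y, hy⟩ => ?_, fun i y hy => ?_⟩
  · obtain ⟨j, rfl⟩ : ∃ j, i = j + 1 := ⟨i - 1, by omega⟩
    obtain ⟨⟨z, w⟩, hz⟩ := exists_of_mem_bdry (i := j) rfl (h (j + 1) (x, -y) (by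
      rw [cone_d, hx, map_neg, hy, neg_zero, add_neg_cancel]; rfl))
    have : -M.d (j + 1) z = x := congrArg Prod.fst hz
    exact ⟨-z, by rw [map_neg, this]⟩
  · obtain ⟨⟨z, w⟩, hz⟩ := exists_of_mem_bdry (i := i) rfl (h (i + 1) (0, y) (by
      rw [cone_d, hy, map_zero, map_zero, neg_zero, add_zero]; rfl))
    have e₁ : -M.d (i + 1) z = 0 := congrArg Prod.fst hz
    have e₂ : g.f (i + 1) z + N.d i w = y := congrArg Prod.snd hz
    exact ⟨z, neg_eq_zero.1 e₁, -w, by rw [← e₂, map_neg]; abel⟩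

/-- The morphism into a product given by its components. -/
def prodLift {L M N : DGModule A} (f : L ⟶ M) (g : L ⟶ N) : L ⟶ prod M N where
  f i := (f.f i).prod (g.f i)
  comm_d i x := Prod.ext (f.comm_d i x) (g.comm_d i x)
  comm_act i j l h a x := Prod.ext (f.comm_act i j l h a x) (g.comm_act i j l h a x)

/-- The first projection of a product. -/
def prodFst (M N : DGModule A) : prod M N ⟶ M where
  f _ := LinearMap.fst k _ _
  comm_d _ _ := rfl
  comm_act _ _ _ _ _ _ := rfl

/-- The second projection of a product. -/
def prodSnd (M N : DGModule A) : prod M N ⟶ N where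
  f _ := LinearMap.snd k _ _
  comm_d _ _ := rfl
  comm_act _ _ _ _ _ _ := rfl

theorem prod_total (M N : DGModule A) :
    prodFst M N ≫ prodLift (𝟙 M) 0 + prodSnd M N ≫ prodLift 0 (𝟙 N) = 𝟙 (prod M N) :=
  hom_ext fun _ x => Prod.ext (add_zero x.1) (zero_add x.2)

/-- If `p ≫ q` is a quasi-isomorphism, then `M` is the direct sum of the target of `q` and
the cone of `p`. -/
theorem isQuasiIso_prodLift_coneInr {L M N : DGModule A} (p : L ⟶ M) (q : M ⟶ N)
    (h : IsQuasiIso (p ≫ q)) : IsQuasiIso (prodLift q (coneInr p)) where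
  inj := by
    rintro i x hx ⟨⟨v, z, w⟩, e⟩
    have e₁ : N.d i v = q.f (i + 1) x := congrArg Prod.fst e
    have e₂ : -L.d (i + 1) z = 0 := congrArg (fun p => p.2.1) e
    have e₃ : p.f (i + 1) z + M.d i w = x := congrArg (fun p => p.2.2) e
    obtain ⟨y, rfl⟩ := h.inj i z (neg_eq_zero.1 e₂) ⟨v - q.f i w, by
      rw [map_sub, e₁, ← q.comm_d, ← map_sub, ← e₃, add_sub_cancel_right, comp_f]⟩
    exact ⟨p.f i y + w, by rw [map_add, ← p.comm_d, e₃]⟩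
  surj := by
    rintro i ⟨v, z, w⟩ e
    have e₁ : N.d (i + 1) v = 0 := congrArg Prod.fst e
    have e₂ : -L.d (i + 1 + 1) z = 0 := congrArg (fun p => p.2.1) e
    have e₃ : p.f (i + 1 + 1) z + M.d (i + 1) w = 0 := congrArg (fun p => p.2.2) e
    obtain ⟨y, rfl⟩ := h.inj (i + 1) z (neg_eq_zero.1 e₂) ⟨-q.f (i + 1) w, by
      rw [map_neg, ← q.comm_d, ← map_neg, ← eq_neg_of_add_eq_zero_left e₃, comp_f]⟩
    have hc : M.d (i + 1) (w + p.f (i + 1) y) = 0 := by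
      rw [map_add, ← p.comm_d, ← e₃]; abel
    -- The cycle `w + p y` already has the right class in the cone. Its error in `N` is corrected by
    -- adding `p x`, which is a boundary in the cone because `x` is a cycle.
    obtain ⟨x, hx, u, hu⟩ := h.surj i (v - q.f (i + 1) (w + p.f (i + 1) y)) (by
      rw [map_sub, e₁, ← q.comm_d, hc, map_zero, sub_zero])
    refine ⟨w + p.f (i + 1) y + p.f (i + 1) x, by rw [map_add, hc, ← p.comm_d, hx, map_zero,
      add_zero], ((u, y + x, 0) : N.X i × L.X (i + 1) × M.X i), Prod.ext ?_ (Prod.ext ?_ ?_)⟩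
    · change q.f (i + 1) (w + p.f (i + 1) y + p.f (i + 1) x) = v + N.d i u
      rw [comp_f] at hu
      rw [map_add, hu]; abel
    · change (0 : L.X (i + 1 + 1)) = L.d (i + 1) y + -L.d (i + 1) (y + x)
      rw [map_add, hx, add_zero, add_neg_cancel]
    · change w + p.f (i + 1) y + p.f (i + 1) x = w + (p.f (i + 1) (y + x) + M.d i 0)
      rw [map_add, map_zero, add_zero, add_assoc]

end Cones

/-! ### Reduction of the action of `k[T]` to powers of `T`. -/

section MonomialAction

open Polynomial

variable {k : Type u} [Field k]

theorem coe_eq_monomial {a : ℤ} (p : polyPart k 1 a) :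
    p.1 = monomial a.toNat (p.1.coeff a.toNat) := by
  ext n
  rw [coeff_monomial]
  split_ifs with h
  · rw [h]
  · by_contra hn
    have := p.2 n hn
    omega

/-- The coefficient of a homogeneous polynomial. -/
noncomputable def leadCoeff (a : ℤ) : (polyDGA k 1).X a →ₗ[k] k :=
  (lcoeff k a.toNat).comp (polyPart k 1 a).subtype

theorem leadCoeff_eq_zero {a : ℤ} (ha : a < 0) (p : (polyDGA k 1).X a) : leadCoeff a p = 0 := by
  by_contra hn
  have := p.2 _ hn
  omega

/-- The monomial of degree `a`, which is zero for `a < 0`. -/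
noncomputable def mono (a : ℤ) : (polyDGA k 1).X a :=
  ⟨if 0 ≤ a then X ^ a.toNat else 0, fun n hn => by
    split_ifs at hn with h
    · rw [coeff_X_pow] at hn
      have : n = a.toNat := by
        by_contra h
        exact hn (if_neg h)
      omega
    · exact absurd rfl hn⟩

theorem leadCoeff_mono {a : ℤ} (ha : 0 ≤ a) : leadCoeff a (mono (k := k) a) = 1 := by
  change (if 0 ≤ a then (X ^ a.toNat : k[X]) else 0).coeff a.toNat = 1
  rw [if_pos ha, coeff_X_pow_self]

theorem leadCoeff_one : leadCoeff 0 (polyDGA k 1).one = 1 := by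
  change (1 : k[X]).coeff 0 = 1
  simp

theorem eq_leadCoeff_smul_mono {a : ℤ} (p : (polyDGA k 1).X a) :
    p = leadCoeff a p • mono a := by
  by_cases ha : 0 ≤ a
  · refine Subtype.ext ?_
    change p.1 = p.1.coeff a.toNat • (if 0 ≤ a then (X ^ a.toNat : k[X]) else 0)
    rw [if_pos ha, smul_X_eq_monomial]
    exact coe_eq_monomial p
  · rw [leadCoeff_eq_zero (not_le.1 ha), zero_smul]
    refine Subtype.ext ((coe_eq_monomial p).trans ?_)
    have : p.1.coeff a.toNat = 0 := leadCoeff_eq_zero (not_le.1 ha) p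
    rw [this, monomial_zero_right]
    rfl

theorem leadCoeff_mul {i j l : ℤ} (h : i + j = l) (p : (polyDGA k 1).X i)
    (q : (polyDGA k 1).X j) :
    leadCoeff l ((polyDGA k 1).mul i j l h p q) = leadCoeff i p * leadCoeff j q := by
  by_cases hi : 0 ≤ i
  · by_cases hj : 0 ≤ j
    · change (p.1 * q.1).coeff l.toNat = p.1.coeff i.toNat * q.1.coeff j.toNat
      have : l.toNat = i.toNat + j.toNat := by omega
      rw [coe_eq_monomial p, coe_eq_monomial q, monomial_mul_monomial, this]
      simp
    · have : q = 0 := by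
        rw [eq_leadCoeff_smul_mono q, leadCoeff_eq_zero (not_le.1 hj), zero_smul]
      rw [this]; simp
  · have : p = 0 := by
      rw [eq_leadCoeff_smul_mono p, leadCoeff_eq_zero (not_le.1 hi), zero_smul]
    rw [this]; simp

/-- The action of the monomial of degree `l - j`, as a map `Mʲ ⟶ Mˡ`. -/
noncomputable def DGModule.T (M : DGModule (polyDGA k 1)) (j l : ℤ) : M.X j →ₗ[k] M.X l :=
  M.act (l - j) j l (by omega) (mono (l - j))

/-- Each graded piece of `k[T]` is spanned by a single monomial, so linearity over `k[T]` need only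
be checked on the powers of `T`. -/
theorem act_eq (M : DGModule (polyDGA k 1)) {a j l : ℤ} (h : a + j = l) (p : (polyDGA k 1).X a)
    (x : M.X j) : M.act a j l h p x = leadCoeff a p • M.T j l x := by
  obtain rfl : a = l - j := by omega
  conv_lhs => rw [eq_leadCoeff_smul_mono p]
  rw [map_smul, LinearMap.smul_apply]
  rfl

theorem T_of_lt (M : DGModule (polyDGA k 1)) {j l : ℤ} (h : l < j) (x : M.X j) :
    M.T j l x = 0 := by
  have : mono (k := k) (l - j) = 0 := by
    rw [eq_leadCoeff_smul_mono (mono (l - j)), leadCoeff_eq_zero (by omega), zero_smul]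
  rw [DGModule.T, this, map_zero, LinearMap.zero_apply]

@[simp] theorem T_self (M : DGModule (polyDGA k 1)) (j : ℤ) (x : M.X j) : M.T j j x = x := by
  conv_rhs => rw [← M.one_act j x, act_eq, leadCoeff_one, one_smul]

theorem T_T (M : DGModule (polyDGA k 1)) {j l m : ℤ} (h : j ≤ l) (h' : l ≤ m) (x : M.X j) :
    M.T l m (M.T j l x) = M.T j m x := by
  have := M.mul_act (m - l) (l - j) j (m - j) l m (by omega) (by omega) (by omega) (by omega)
    (mono _) (mono _) x
  rw [act_eq, leadCoeff_mul, leadCoeff_mono (by omega), leadCoeff_mono (by omega), one_mul,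
    one_smul] at this
  exact this.symm

/-- This is the Leibniz rule for `T ^ (l - j)`: as `T` is a cycle of odd degree, `d T = -T d`. Most
of the signs below have this origin. -/
theorem d_T (M : DGModule (polyDGA k 1)) (j l : ℤ) (x : M.X j) :
    M.d l (M.T j l x) = (l - j).negOnePow • M.T (j + 1) (l + 1) (M.d j x) := by
  by_cases h : j ≤ l
  · rw [DGModule.T, M.leibniz]
    change M.act _ _ _ _ 0 x + _ = _
    rw [map_zero, LinearMap.zero_apply, zero_add, act_eq, leadCoeff_mono (by omega), one_smul]
  · rw [T_of_lt M (by omega), T_of_lt M (by omega), map_zero, smul_zero]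

theorem dl_T (M : DGModule (polyDGA k 1)) {j j' l l' : ℤ} (hj : j + 1 = j') (hl : l + 1 = l')
    (x : M.X j) :
    M.dl l l' hl (M.T j l x) = (l - j).negOnePow • M.T j' l' (M.dl j j' hj x) := by
  subst hj hl
  exact d_T M j l x

theorem T_mem_bdry (M : DGModule (polyDGA k 1)) (j l : ℤ) {x : M.X j} (hx : x ∈ M.bdry j) :
    M.T j l x ∈ M.bdry l := by
  obtain ⟨z, rfl⟩ := hx
  have := dl_T M (sub_add_cancel j 1) (sub_add_cancel l 1) z
  rw [← inv_smul_eq_iff] at this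
  rw [← this]
  rcases Int.units_eq_one_or (l - 1 - (j - 1)).negOnePow⁻¹ with h | h <;> rw [h]
  · rw [one_smul]; exact dl_mem_bdry _ _ _
  · rw [Units.neg_smul, one_smul]; exact neg_mem (dl_mem_bdry _ _ _)

theorem map_T {M N : DGModule (polyDGA k 1)} (g : M ⟶ N) (j l : ℤ) (x : M.X j) :
    g.f l (M.T j l x) = N.T j l (g.f j x) :=
  g.comm_act _ _ _ _ _ _

theorem homotopy_T {M N : DGModule (polyDGA k 1)} {g h : M ⟶ N} (H : Homotopy g h) (j l : ℤ)
    (x : M.X (j + 1)) :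
    H.s l (M.T (j + 1) (l + 1) x) = (l - j).negOnePow • N.T j l (H.s j x) := by
  by_cases hl : j ≤ l
  · have := H.s_act (l - j) j l (by omega) (mono _) x
    rwa [act_eq, act_eq, leadCoeff_mono (by omega), one_smul, one_smul] at this
  · rw [T_of_lt M (by omega), T_of_lt N (by omega), map_zero, smul_zero]

/-- A morphism of DG modules over `k[T]`, from maps that commute with the powers of `T`. -/
def homMk {M N : DGModule (polyDGA k 1)} (f : ∀ i, M.X i →ₗ[k] N.X i)
    (hd : ∀ i x, f (i + 1) (M.d i x) = N.d i (f i x))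
    (hT : ∀ j l, j ≤ l → ∀ x, f l (M.T j l x) = N.T j l (f j x)) : M ⟶ N where
  f := f
  comm_d := hd
  comm_act i j l h a x := by
    by_cases hl : j ≤ l
    · rw [act_eq, act_eq, map_smul, hT j l hl]
    · rw [act_eq, act_eq, leadCoeff_eq_zero (by omega), zero_smul, zero_smul, map_zero]

/-- A homotopy of DG modules over `k[T]`, from maps that commute with the powers of `T`
up to sign. -/
def homotopyMk {M N : DGModule (polyDGA k 1)} {g h : M ⟶ N} (s : ∀ i, M.X (i + 1) →ₗ[k] N.X i)
    (hT : ∀ j l, j ≤ l → ∀ x, s l (M.T (j + 1) (l + 1) x) = (l - j).negOnePow • N.T j l (s j x))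
    (comm : ∀ i (x : M.X (i + 1)),
      g.f (i + 1) x - h.f (i + 1) x = N.d i (s i x) + s (i + 1) (M.d (i + 1) x)) :
    Homotopy g h where
  s := s
  s_act i j l e a x := by
    by_cases hl : j ≤ l
    · rw [act_eq, act_eq, map_smul, hT j l hl, smul_comm]
      congr 3
      omega
    · rw [act_eq, act_eq, leadCoeff_eq_zero (by omega), zero_smul, zero_smul, map_zero, smul_zero]
  comm := comm

/-- The element of a mapping cone with given components. -/
def coneMk {M N : DGModule (polyDGA k 1)} (g : M ⟶ N) {j : ℤ} (x : M.X (j + 1)) (y : N.X j) :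
    (cone g).X j := (x, y)

/-- The first component of an element of a mapping cone. -/
def coneFst {M N : DGModule (polyDGA k 1)} (g : M ⟶ N) (j : ℤ) :
    (cone g).X j →ₗ[k] M.X (j + 1) := LinearMap.fst k _ _

/-- The second component of an element of a mapping cone. -/
def coneSnd {M N : DGModule (polyDGA k 1)} (g : M ⟶ N) (j : ℤ) :
    (cone g).X j →ₗ[k] N.X j := LinearMap.snd k _ _

section

variable {M N : DGModule (polyDGA k 1)} (g : M ⟶ N)

theorem coneMk_ext {j : ℤ} {x y : (cone g).X j} (h₁ : coneFst g j x = coneFst g j y)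
    (h₂ : coneSnd g j x = coneSnd g j y) : x = y := Prod.ext h₁ h₂

@[simp] theorem coneFst_mk {j : ℤ} (x : M.X (j + 1)) (y : N.X j) :
    coneFst g j (coneMk g x y) = x := rfl

@[simp] theorem coneSnd_mk {j : ℤ} (x : M.X (j + 1)) (y : N.X j) :
    coneSnd g j (coneMk g x y) = y := rfl

@[simp] theorem coneFst_d (j : ℤ) (x : (cone g).X j) :
    coneFst g (j + 1) ((cone g).d j x) = -M.d (j + 1) (coneFst g j x) := rfl

@[simp] theorem coneSnd_d (j : ℤ) (x : (cone g).X j) :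
    coneSnd g (j + 1) ((cone g).d j x) = g.f (j + 1) (coneFst g j x) + N.d j (coneSnd g j x) := rfl

@[simp] theorem coneFst_T (j l : ℤ) (x : (cone g).X j) : coneFst g l ((cone g).T j l x) =
    (l - j).negOnePow • M.T (j + 1) (l + 1) (coneFst g j x) := by
  by_cases hl : j ≤ l
  · change (l - j).negOnePow • M.act (l - j) (j + 1) (l + 1) _ (mono (l - j)) _ = _
    rw [act_eq, leadCoeff_mono (by omega), one_smul]
    rfl
  · rw [T_of_lt _ (by omega), T_of_lt M (by omega), smul_zero, map_zero]

@[simp] theorem coneSnd_T (j l : ℤ) (x : (cone g).X j) : coneSnd g l ((cone g).T j l x) =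
    N.T j l (coneSnd g j x) := rfl

/-- A linear map into a mapping cone, from its components. -/
def coneLift {V : Type u} [AddCommGroup V] [Module k V] {j : ℤ} (f : V →ₗ[k] M.X (j + 1))
    (f' : V →ₗ[k] N.X j) : V →ₗ[k] (cone g).X j := f.prod f'

@[simp] theorem coneFst_lift {V : Type u} [AddCommGroup V] [Module k V] {j : ℤ}
    (f : V →ₗ[k] M.X (j + 1)) (f' : V →ₗ[k] N.X j) (x : V) :
    coneFst g j (coneLift g f f' x) = f x := rfl

@[simp] theorem coneSnd_lift {V : Type u} [AddCommGroup V] [Module k V] {j : ℤ}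
    (f : V →ₗ[k] M.X (j + 1)) (f' : V →ₗ[k] N.X j) (x : V) :
    coneSnd g j (coneLift g f f' x) = f' x := rfl

end

end MonomialAction

/-! ### Interval modules and the morphisms between them. -/

section IntervalModules

open Polynomial

variable (k : Type u) [Field k]

open Classical in
/-- The DG module with zero differential that is `k` in the degrees in the interval `s` and zero in the
other degrees, on which `T` acts as the identity wherever it can. -/
noncomputable def intervalModule (s : Set ℤ) [hs : s.OrdConnected] : DGModule (polyDGA k 1) where
  X j := ({ carrier := {c | j ∉ s → c = 0}
            add_mem' := fun ha hb h => by rw [ha h, hb h, add_zero]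
            zero_mem' := fun _ => rfl
            smul_mem' := fun c x hx h => by rw [hx h, smul_zero] } : Submodule k k)
  d _ := 0
  act i j l h := LinearMap.mk₂ k
    (fun p c => ⟨if l ∈ s then leadCoeff i p * c.1 else 0, fun h => if_neg h⟩)
    (fun p q c => Subtype.ext (by
      change ite _ _ _ = ite _ _ _ + ite _ _ _
      split_ifs <;> simp [add_mul]))
    (fun a p c => Subtype.ext (by
      change ite _ _ _ = a * ite _ _ _
      split_ifs <;> simp [mul_assoc]))
    (fun p c c' => Subtype.ext (by
      change ite _ (_ * (c.1 + c'.1)) _ = ite _ _ _ + ite _ _ _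
      split_ifs <;> simp [mul_add]))
    (fun a p c => Subtype.ext (by
      change ite _ (_ * (a * c.1)) _ = a * ite _ _ _
      split_ifs <;> simp [mul_left_comm]))
  one_act j c := Subtype.ext (by
    change ite _ (_ * c.1) _ = c.1
    rw [leadCoeff_one, one_mul, ite_eq_left_iff]
    exact fun h => (c.2 h).symm)
  mul_act i j l ij jl m h₁ h₂ h₃ h₄ p q c := Subtype.ext (by
    change ite _ (_ * c.1) _ = ite _ (_ * ite _ (_ * c.1) _) _
    rw [leadCoeff_mul]
    split_ifs with hm hjl
    · rw [mul_assoc]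
    -- Here the target degree lies in `s` and the intermediate degree does not. Unless one
    -- polynomial has negative degree, and so vanishes, convexity keeps the source degree out of `s`
    -- as well.
    · by_cases hi : i < 0
      · rw [leadCoeff_eq_zero hi]; simp
      by_cases hj : j < 0
      · rw [leadCoeff_eq_zero hj]; simp
      by_cases hl : l ∈ s
      · exact absurd (hs.out hl hm ⟨by omega, by omega⟩) hjl
      · rw [c.2 hl]; simp
    · rfl)
  d_d _ _ := rfl
  leibniz i j l h p c := by
    change 0 = LinearMap.mk₂ k _ _ _ _ _ 0 c + _ • LinearMap.mk₂ k _ _ _ _ _ p 0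
    simp
    rfl

variable {k}

section

variable (s : Set ℤ) [s.OrdConnected] (t : Set ℤ) [t.OrdConnected]

theorem intervalModule_d (j : ℤ) (x : (intervalModule k s).X j) :
    (intervalModule k s).d j x = 0 := rfl

theorem intervalModule_dl {i j : ℤ} (h : i + 1 = j) (x : (intervalModule k s).X i) :
    (intervalModule k s).dl i j h x = 0 := by
  subst h; rfl

/-- The value of an element of an interval module. -/
def ivVal (j : ℤ) : (intervalModule k s).X j →ₗ[k] k := Submodule.subtype _

open Classical in
/-- The element of degree `j` of an interval module with a given value. -/
noncomputable def ivMk (j : ℤ) : k →ₗ[k] (intervalModule k s).X j where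
  toFun c := ⟨if j ∈ s then c else 0, fun h => if_neg h⟩
  map_add' a b := Subtype.ext (by
    change ite _ _ _ = ite _ _ _ + ite _ _ _
    split_ifs <;> simp)
  map_smul' a b := Subtype.ext (by
    change ite _ _ _ = a * ite _ _ _
    split_ifs <;> simp)

variable {s t}

theorem iv_ext {j : ℤ} {x y : (intervalModule k s).X j} (h : ivVal s j x = ivVal s j y) : x = y :=
  Subtype.ext h

theorem ivVal_eq_zero {j : ℤ} (h : j ∉ s) (x : (intervalModule k s).X j) : ivVal s j x = 0 :=
  x.2 h

theorem ivVal_ivMk {j : ℤ} (h : j ∈ s) (c : k) : ivVal s j (ivMk s j c) = c := if_pos h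

theorem ivMk_eq_zero {j : ℤ} (h : j ∉ s) (c : k) : ivMk s j c = 0 := iv_ext (if_neg h)

theorem ivVal_T {j l : ℤ} (h : l ∈ s) (hl : j ≤ l) (x : (intervalModule k s).X j) :
    ivVal s l ((intervalModule k s).T j l x) = ivVal s j x := by
  classical
  change ite _ (_ * x.1) _ = x.1
  rw [if_pos h, leadCoeff_mono (by omega), one_mul]

variable (s t) in
/-- The morphism of interval modules that is the identity in the common degrees. -/
noncomputable def ivHom (h : ∀ j l, j ≤ l → j ∈ s → l ∈ t → (l ∈ s ↔ j ∈ t)) :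
    intervalModule k s ⟶ intervalModule k t :=
  homMk (fun j => (ivMk t j).comp (ivVal s j)) (fun _ _ => map_zero _) fun j l hl x => by
    refine iv_ext ?_
    simp only [LinearMap.comp_apply]
    -- On a class of degree `j`, one way around the square is non-zero when `l ∈ s` and the other
    -- when `j ∈ t`; the hypothesis equates the two conditions.
    by_cases ht : l ∈ t
    · rw [ivVal_ivMk ht, ivVal_T ht hl]
      by_cases hj : j ∈ s
      · by_cases hs : l ∈ s
        · rw [ivVal_T hs hl, ivVal_ivMk ((h j l hl hj ht).1 hs)]
        · rw [ivVal_eq_zero hs, ivMk_eq_zero ((h j l hl hj ht).not.1 hs), map_zero]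
      · have : x = 0 := iv_ext (by rw [ivVal_eq_zero hj, map_zero])
        rw [this]; simp
    · rw [ivVal_eq_zero ht, ivVal_eq_zero ht]

theorem ivHom_f (h : ∀ j l, j ≤ l → j ∈ s → l ∈ t → (l ∈ s ↔ j ∈ t)) (j : ℤ)
    (x : (intervalModule k s).X j) :
    (ivHom s t h).f j x = ivMk t j (ivVal s j x) := rfl

end

end IntervalModules

/-! ### The two-generator free model and its morphisms up to homotopy. -/

section Koszul

variable {k : Type u} [Field k]

theorem ivVal_T_Ici {a j l : ℤ} (hl : j ≤ l) (x : (intervalModule k (Set.Ici a)).X j) :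
    ivVal _ l ((intervalModule k (Set.Ici a)).T j l x) = ivVal _ j x := by
  by_cases h : a ≤ l
  · exact ivVal_T (Set.mem_Ici.2 h) hl x
  · rw [ivVal_eq_zero (by simpa using h), ivVal_eq_zero (by simp; omega)]

theorem units_smul_smul {V : Type u} [AddCommGroup V] [Module k V] (c : ℤˣ) (r : k) (x : V) :
    c • r • x = r • c • x := by
  rcases Int.units_eq_one_or c with h | h <;> subst h <;> simp

theorem negOnePow_mul_eq {a b c : ℤ} (h : (a + b - c) % 2 = 0) :
    a.negOnePow * b.negOnePow = c.negOnePow := by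
  rw [← Int.negOnePow_add]
  exact (Int.negOnePow_eq_iff _ _).2 (Int.even_iff.2 h)

variable (k) in
/-- The inclusion whose cone resolves the interval module of `[a, b]`. -/
noncomputable def freeMap (a b : ℤ) :
    intervalModule k (Set.Ici (max a (b + 1))) ⟶ intervalModule k (Set.Ici a) :=
  ivHom _ _ fun j l h h₁ h₂ => by simp only [Set.mem_Ici] at *; omega

theorem freeMap_f (a b j : ℤ) (x : (intervalModule k (Set.Ici (max a (b + 1)))).X j) :
    (freeMap k a b).f j x = ivMk _ j (ivVal _ j x) := rfl

variable (k) in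
/-- A DG module that is free as a graded module, on a cycle `e` of degree `a` and an element `f` of
degree `b` with `d f = T ^ (b + 1 - a) e`. -/
noncomputable abbrev freeCone (a b : ℤ) : DGModule (polyDGA k 1) := cone (freeMap k a b)

variable (k) in
/-- The generator of degree `a`. -/
noncomputable def genE (a b : ℤ) : (freeCone k a b).X a :=
  coneMk (freeMap k a b) 0 (ivMk _ a 1)

variable (k) in
/-- The generator of degree `b`. -/
noncomputable def genF (a b : ℤ) : (freeCone k a b).X b :=
  coneMk (freeMap k a b) (ivMk _ (b + 1) 1) 0

/-- The coefficients of `f` and `e`. -/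
noncomputable def coeffF (a b j : ℤ) : (freeCone k a b).X j →ₗ[k] k :=
  (ivVal _ (j + 1)).comp (coneFst (freeMap k a b) j)

/-- The coefficient of `e`. -/
noncomputable def coeffE (a b j : ℤ) : (freeCone k a b).X j →ₗ[k] k :=
  (ivVal _ j).comp (coneSnd (freeMap k a b) j)

section

variable {a b : ℤ}

theorem freeCone_ext {j : ℤ} {x y : (freeCone k a b).X j} (h₁ : coeffF a b j x = coeffF a b j y)
    (h₂ : coeffE a b j x = coeffE a b j y) : x = y := coneMk_ext _ (iv_ext h₁) (iv_ext h₂)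

theorem coeffF_eq_zero {j : ℤ} (h : j < a - 1 ∨ j < b) (x : (freeCone k a b).X j) :
    coeffF a b j x = 0 := ivVal_eq_zero (by simp; omega) _

theorem coeffE_eq_zero {j : ℤ} (h : j < a) (x : (freeCone k a b).X j) :
    coeffE a b j x = 0 := ivVal_eq_zero (by simp; omega) _

theorem coeffF_d (j : ℤ) (x : (freeCone k a b).X j) :
    coeffF a b (j + 1) ((freeCone k a b).d j x) = 0 := by
  simp [coeffF, intervalModule_d]

theorem coeffE_d (j : ℤ) (x : (freeCone k a b).X j) :
    coeffE a b (j + 1) ((freeCone k a b).d j x) = coeffF a b j x := by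
  simp only [coeffE, coeffF, LinearMap.comp_apply, coneSnd_d, intervalModule_d, add_zero]
  rw [freeMap_f]
  by_cases h : a ≤ j + 1
  · rw [ivVal_ivMk (by simpa using h)]
  · rw [ivMk_eq_zero (by simpa using h), map_zero, ivVal_eq_zero (by simp; omega)]

theorem coeffF_T {j l : ℤ} (h : j ≤ l) (x : (freeCone k a b).X j) :
    coeffF a b l ((freeCone k a b).T j l x) = (l - j).negOnePow • coeffF a b j x := by
  simp only [coeffF, LinearMap.comp_apply, coneFst_T, units_smul_map]
  rw [ivVal_T_Ici (by omega)]

theorem coeffE_T {j l : ℤ} (h : j ≤ l) (x : (freeCone k a b).X j) :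
    coeffE a b l ((freeCone k a b).T j l x) = coeffE a b j x := by
  simp only [coeffE, LinearMap.comp_apply, coneSnd_T]
  rw [ivVal_T_Ici (by omega)]

theorem coeffF_genE : coeffF a b a (genE k a b) = 0 := by
  simp [coeffF, genE]

theorem coeffE_genE : coeffE a b a (genE k a b) = 1 := ivVal_ivMk (Set.mem_Ici.2 le_rfl) _

theorem coeffF_genF (h : a ≤ b + 1) : coeffF a b b (genF k a b) = 1 :=
  ivVal_ivMk (Set.mem_Ici.2 (by omega)) _

theorem coeffE_genF : coeffE a b b (genF k a b) = 0 := by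
  simp [coeffE, genF]

theorem d_genE : (freeCone k a b).d a (genE k a b) = 0 :=
  freeCone_ext (by rw [coeffF_d, map_zero]) (by rw [coeffE_d, coeffF_genE, map_zero])

theorem d_genF (h : a ≤ b + 1) :
    (freeCone k a b).d b (genF k a b) = (freeCone k a b).T a (b + 1) (genE k a b) :=
  freeCone_ext (by rw [coeffF_d, coeffF_T h, coeffF_genE, smul_zero])
    (by rw [coeffE_d, coeffE_T h, coeffF_genF h, coeffE_genE])

/-- Freeness on `e` and `f` as a graded module. The sign undoes the one in `coeffF_T`, which comes
from the twisted action on the suspended half of the cone. The boundary case `a = b + 1`, the empty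
interval, is allowed throughout. -/
theorem freeCone_eq (h : a ≤ b + 1) {j : ℤ} (x : (freeCone k a b).X j) :
    x = (j - b).negOnePow • coeffF a b j x • (freeCone k a b).T b j (genF k a b) +
      coeffE a b j x • (freeCone k a b).T a j (genE k a b) := by
  apply freeCone_ext
  · rw [map_add, units_smul_map, map_smul, map_smul]
    by_cases hj : b ≤ j
    · rw [coeffF_T hj, coeffF_genF h]
      by_cases hj' : a ≤ j
      · rw [coeffF_T hj', coeffF_genE, units_smul_smul, smul_smul]
        simp
      · rw [coeffE_eq_zero (by omega), units_smul_smul, smul_smul]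
        simp
    · rw [coeffF_eq_zero (by omega)]
      by_cases hj' : a ≤ j
      · rw [coeffF_T hj', coeffF_genE]
        simp
      · rw [coeffE_eq_zero (by omega)]
        simp
  · rw [map_add, units_smul_map, map_smul, map_smul]
    by_cases hj' : a ≤ j
    · rw [coeffE_T hj', coeffE_genE]
      by_cases hj : b ≤ j
      · rw [coeffE_T hj, coeffE_genF]
        simp
      · rw [coeffF_eq_zero (by omega)]
        simp
    · rw [coeffE_eq_zero (by omega)]
      by_cases hj : b ≤ j
      · rw [coeffE_T hj, coeffE_genF]
        simp
      · rw [coeffF_eq_zero (by omega)]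
        simp

end

/-- The pairs `(x, y)` to which `(e, f)` can be sent by a morphism of DG modules. -/
def cyclePairs (a b : ℤ) (M : DGModule (polyDGA k 1)) : Submodule k (M.X a × M.X b) where
  carrier := {p | M.d a p.1 = 0 ∧ M.d b p.2 = M.T a (b + 1) p.1}
  add_mem' hp hq := ⟨by simp [hp.1, hq.1], by simp [hp.2, hq.2]⟩
  zero_mem' := by simp
  smul_mem' c p hp := ⟨by simp [hp.1], by simp [hp.2]⟩

/-- The morphism of DG modules sending `(e, f)` to a given pair. -/
noncomputable def freeDesc {a b : ℤ} (h : a ≤ b + 1) (M : DGModule (polyDGA k 1)) :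
    cyclePairs a b M →ₗ[k] (freeCone k a b ⟶ M) where
  toFun p := homMk
    (fun j => (j - b).negOnePow • (coeffF a b j).smulRight (M.T b j p.1.2) +
      (coeffE a b j).smulRight (M.T a j p.1.1))
    (by
      intro j x
      simp only [LinearMap.add_apply, LinearMap.smul_apply, LinearMap.smulRight_apply, coeffF_d,
        coeffE_d, zero_smul, smul_zero, zero_add, map_add, units_smul_map, map_smul, d_T, p.2.1,
        p.2.2, add_zero, map_zero]
      -- Powers of `T` compose only in non-negative exponents; below degree `b` the coefficient of
      -- `f` is zero, so nothing is lost.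
      by_cases hj : b ≤ j
      · rw [← units_smul_smul, smul_smul (_ : ℤˣ), negOnePow_mul_eq (c := 0) (by omega),
          T_T M h (by omega)]
        simp
      · rw [coeffF_eq_zero (by omega) x]; simp)
    (by
      intro j l hl x
      simp only [LinearMap.add_apply, LinearMap.smul_apply, LinearMap.smulRight_apply, coeffF_T hl,
        coeffE_T hl, map_add, units_smul_map, map_smul]
      congr 1
      · by_cases hj : b ≤ j
        · rw [T_T M hj hl, smul_assoc, smul_smul (_ : ℤˣ),
            negOnePow_mul_eq (c := j - b) (by omega)]
        · rw [coeffF_eq_zero (by omega) x]; simp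
      · by_cases hj : a ≤ j
        · rw [T_T M hj hl]
        · rw [coeffE_eq_zero (by omega) x]; simp)
  map_add' p q := hom_ext fun i x => by
    simp only [add_f]
    simp only [homMk, LinearMap.add_apply, LinearMap.smul_apply, LinearMap.smulRight_apply,
      Submodule.coe_add, Prod.fst_add, Prod.snd_add, map_add, smul_add]
    abel
  map_smul' c p := hom_ext fun i x => by
    simp only [smul_f]
    simp only [homMk, LinearMap.add_apply, LinearMap.smul_apply, LinearMap.smulRight_apply,
      Submodule.coe_smul, Prod.smul_fst, Prod.smul_snd, map_smul, smul_add, RingHom.id_apply]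
    rw [smul_comm c, smul_comm (_ : k) c, units_smul_smul, smul_comm (_ : k) c]

section

variable {a b : ℤ} (h : a ≤ b + 1) {M N : DGModule (polyDGA k 1)}

theorem freeDesc_f (p : cyclePairs a b M) (j : ℤ) (x : (freeCone k a b).X j) :
    (freeDesc h M p).f j x = (j - b).negOnePow • coeffF a b j x • M.T b j p.1.2 +
      coeffE a b j x • M.T a j p.1.1 := rfl

@[simp] theorem freeDesc_genE (p : cyclePairs a b M) :
    (freeDesc h M p).f a (genE k a b) = p.1.1 := by
  simp [freeDesc_f, coeffF_genE, coeffE_genE]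

@[simp] theorem freeDesc_genF (p : cyclePairs a b M) :
    (freeDesc h M p).f b (genF k a b) = p.1.2 := by
  simp [freeDesc_f, coeffF_genF h, coeffE_genF]

include h in
theorem freeCone_hom_ext {g g' : freeCone k a b ⟶ M}
    (he : g.f a (genE k a b) = g'.f a (genE k a b))
    (hf : g.f b (genF k a b) = g'.f b (genF k a b)) : g = g' := by
  refine hom_ext fun j x => ?_
  rw [freeCone_eq h x]
  simp only [map_add, units_smul_map, map_smul, map_T, he, hf]

/-- Morphisms of DG modules act on pairs. -/
noncomputable def mapPair (g : M ⟶ N) : cyclePairs a b M →ₗ[k] cyclePairs a b N :=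
  ((g.f a).prodMap (g.f b)).restrict fun p hp => ⟨by
    rw [LinearMap.prodMap_apply, ← g.comm_d, hp.1, map_zero], by
    rw [LinearMap.prodMap_apply, ← g.comm_d, hp.2, map_T]⟩

@[simp] theorem mapPair_fst (g : M ⟶ N) (p : cyclePairs a b M) :
    (mapPair g p).1.1 = g.f a p.1.1 := rfl

@[simp] theorem mapPair_snd (g : M ⟶ N) (p : cyclePairs a b M) :
    (mapPair g p).1.2 = g.f b p.1.2 := rfl

theorem freeDesc_comp (p : cyclePairs a b M) (g : M ⟶ N) :
    freeDesc h M p ≫ g = freeDesc h N (mapPair g p) :=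
  freeCone_hom_ext h (by simp) (by simp)

variable (k) in
/-- The pair `(e, f)`. -/
noncomputable def genPair : cyclePairs a b (freeCone k a b) :=
  ⟨(genE k a b, genF k a b), d_genE, d_genF h⟩

theorem freeDesc_genPair : freeDesc h _ (genPair k h) = 𝟙 (freeCone k a b) :=
  freeCone_hom_ext h (by simp [genPair]) (by simp [genPair])

theorem freeDesc_surjective : Function.Surjective (freeDesc (k := k) h M) := fun g =>
  ⟨mapPair g (genPair k h), by rw [← freeDesc_comp, freeDesc_genPair, Category.id_comp]⟩

variable (a b M) in
/-- The pairs that come from null-homotopic morphisms. -/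
noncomputable def boundaryPairs : Submodule k (M.X a × M.X b) :=
  LinearMap.range (((M.dl (a - 1) a (by omega)).comp (LinearMap.fst k _ _)).prod
    ((M.dl (b - 1) b (by omega)).comp (LinearMap.snd k _ _) +
      (b + 1 - a).negOnePow • (M.T (a - 1) b).comp (LinearMap.fst k (M.X (a - 1)) (M.X (b - 1)))))

theorem mem_boundaryPairs {p : M.X a × M.X b} : p ∈ boundaryPairs a b M ↔
    ∃ z w, M.dl (a - 1) a (by omega) z = p.1 ∧
      M.dl (b - 1) b (by omega) w + (b + 1 - a).negOnePow • M.T (a - 1) b z = p.2 := by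
  constructor
  · rintro ⟨⟨z, w⟩, rfl⟩
    exact ⟨z, w, rfl, rfl⟩
  · rintro ⟨z, w, h₁, h₂⟩
    exact ⟨(z, w), Prod.ext h₁ h₂⟩

theorem mem_boundaryPairs_of {p : M.X a × M.X b} {i : ℤ} (hi : i + 1 = a) (z : M.X i)
    (hz : M.dl i a hi z = p.1)
    (hw : p.2 - (b + 1 - a).negOnePow • M.T i b z ∈ M.bdry b) : p ∈ boundaryPairs a b M := by
  obtain rfl : i = a - 1 := by omega
  obtain ⟨w, hw⟩ := hw
  exact mem_boundaryPairs.2 ⟨z, w, hz, by rw [hw, sub_add_cancel]⟩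

/-- A homotopy commutes with `T` up to sign, so it is determined by `z = s e` and `w = s f`.
Evaluating `d s + s d` on `e` and `f`, with `d f = T ^ (b + 1 - a) e`, gives exactly the formula for
boundary pairs. -/
theorem homotopic_freeDesc_zero_iff (p : cyclePairs a b M) :
    homotopic _ (freeDesc h M p) 0 ↔ p.1 ∈ boundaryPairs a b M := by
  constructor
  · rintro ⟨H⟩
    obtain ⟨i, rfl⟩ : ∃ i, a = i + 1 := ⟨a - 1, by omega⟩
    obtain ⟨j, rfl⟩ : ∃ j, b = j + 1 := ⟨b - 1, by omega⟩
    have h₁ := H.comm i (genE k (i + 1) (j + 1))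
    have h₂ := H.comm j (genF k (i + 1) (j + 1))
    rw [d_genE, map_zero, add_zero, zero_f, sub_zero, freeDesc_genE] at h₁
    rw [d_genF h, homotopy_T, zero_f, sub_zero, freeDesc_genF] at h₂
    refine mem_boundaryPairs_of rfl _ h₁.symm ?_
    rw [h₂, show j + 1 + 1 - (i + 1) = j + 1 - i by omega, add_sub_cancel_right]
    exact d_mem_bdry _ _
  · intro hp
    obtain ⟨z, w, h₁, h₂⟩ := mem_boundaryPairs.1 hp
    refine ⟨homotopyMk (fun j => (j + 1 - a).negOnePow •
      (coeffE a b (j + 1)).smulRight (M.T (a - 1) j z) +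
        (coeffF a b (j + 1)).smulRight (M.T (b - 1) j w)) (fun j l hl x => ?_) fun i x => ?_⟩
    · simp only [LinearMap.add_apply, LinearMap.smul_apply, LinearMap.smulRight_apply,
        coeffF_T (add_le_add_left hl 1), coeffE_T (add_le_add_left hl 1), map_add, units_smul_map,
        map_smul, smul_add]
      congr 1
      · by_cases hj : a - 1 ≤ j
        · rw [T_T M hj hl, smul_smul (_ : ℤˣ), negOnePow_mul_eq (c := l + 1 - a) (by omega)]
        · rw [coeffE_eq_zero (by omega) x]; simp
      · by_cases hj : b - 1 ≤ j
        · rw [T_T M hj hl, smul_assoc, add_sub_add_right_eq_sub]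
        · rw [coeffF_eq_zero (by omega) x]; simp
    · have e₁ := dl_T M (sub_add_cancel a 1) (rfl : i + 1 = i + 1) z
      have e₂ := dl_T M (sub_add_cancel b 1) (rfl : i + 1 = i + 1) w
      change M.d i _ = _ at e₁ e₂
      simp only [freeDesc_f, LinearMap.add_apply, LinearMap.smul_apply, LinearMap.smulRight_apply,
        map_add, units_smul_map, map_smul, zero_f, sub_zero, coeffF_d, coeffE_d, zero_smul,
        add_zero, e₁, e₂, ← h₁, ← h₂, smul_add]
      have e₃ : ∀ v : M.X (i + 1),
          (i + 1 - a).negOnePow • (i - (a - 1)).negOnePow • v = v := fun v => by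
        rw [smul_smul, negOnePow_mul_eq (c := 0) (by omega)]; simp
      rw [← units_smul_smul (i - (a - 1)).negOnePow, e₃]
      by_cases hj : b ≤ i + 1
      · rw [T_T M (by omega) hj, ← units_smul_smul (b + 1 - a).negOnePow, smul_smul (_ : ℤˣ),
          negOnePow_mul_eq (c := i + 1 + 1 - a) (by omega),
          ← units_smul_smul (i - (b - 1)).negOnePow, show i - (b - 1) = i + 1 - b by omega]
        abel
      · rw [coeffF_eq_zero (by omega) x]
        simp

end

end Koszul

/-! ### Morphisms in the derived category as pairs modulo boundaries. -/

section Resolution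

variable {k : Type u} [Field k] {a b : ℤ} (h : a ≤ b + 1) {M N : DGModule (polyDGA k 1)}

theorem units_smul_mem {V : Type u} [AddCommGroup V] [Module k V] (W : Submodule k V) (c : ℤˣ)
    {x : V} (hx : x ∈ W) : c • x ∈ W := by
  rcases Int.units_eq_one_or c with h | h <;> subst h
  · simpa using hx
  · simpa using hx

theorem d_T_pred (z : M.X (a - 1)) :
    M.d b ((b + 1 - a).negOnePow • M.T (a - 1) b z) =
      M.T a (b + 1) (M.dl (a - 1) a (by omega) z) := by
  have e := dl_T M (sub_add_cancel a 1) (rfl : b + 1 = b + 1) z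
  change M.d b _ = _ at e
  rw [units_smul_map, e, smul_smul, negOnePow_mul_eq (c := 0) (by omega)]
  simp

/-- Pairs can be lifted through quasi-isomorphisms, up to boundaries. -/
theorem exists_lift_pair {s : M ⟶ N} (hs : IsQuasiIso s) (p : cyclePairs a b N) :
    ∃ q : cyclePairs a b M, (mapPair s q - p).1 ∈ boundaryPairs a b N := by
  obtain ⟨x, hx, hb⟩ := hs.exists_cycle p.2.1
  obtain ⟨z, hz⟩ := hb
  -- The second coordinate of `p` bounds `T ^ (b + 1 - a)` times the first one in `N`;
  -- quasi-isomorphisms reflect boundaries, so `x` can be completed to a pair in `M`.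
  have hTx : M.T a (b + 1) x ∈ M.bdry (b + 1) := by
    refine hs.mem_bdry (by rw [d_T, hx, map_zero, smul_zero]) ?_
    rw [map_T, ← sub_add_cancel (s.f a x) p.1.1, map_add, ← p.2.2]
    exact add_mem (T_mem_bdry N _ _ (hz ▸ dl_mem_bdry _ _ _)) (d_mem_bdry _ _)
  obtain ⟨y, hy⟩ := exists_of_mem_bdry (i := b) rfl hTx
  -- The completion `y` matters only up to a cycle. The defect between its image and the prescribed
  -- coordinate, corrected by the `z` used for `x`, is a cycle; its lift `c` is subtracted from `y`.
  obtain ⟨c, hc, hb⟩ := hs.exists_cycle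
    (y := s.f b y - p.1.2 - (b + 1 - a).negOnePow • N.T (a - 1) b z) (by
      change M.d b y = _ at hy
      rw [map_sub, map_sub, d_T_pred, ← s.comm_d, hy, p.2.2, map_T s a (b + 1), hz, map_sub, sub_self])
  refine ⟨⟨(x, y - c), hx, by rw [map_sub, hc, sub_zero]; exact hy⟩,
    mem_boundaryPairs_of (sub_add_cancel a 1) z hz ?_⟩
  rw [← neg_mem_iff]
  convert hb using 1
  simp only [Submodule.coe_sub, Prod.snd_sub, mapPair_snd, map_sub]
  abel

/-- Quasi-isomorphisms reflect boundary pairs. -/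
theorem IsQuasiIso.mem_boundaryPairs_of_map {s : M ⟶ N} (hs : IsQuasiIso s) (p : cyclePairs a b M)
    (hp : (mapPair s p).1 ∈ boundaryPairs a b N) : p.1 ∈ boundaryPairs a b M := by
  obtain ⟨z, w, hz, hw⟩ := mem_boundaryPairs.1 hp
  rw [mapPair_fst] at hz
  rw [mapPair_snd] at hw
  obtain ⟨z₀, hz₀⟩ := hs.mem_bdry p.2.1 (hz ▸ dl_mem_bdry _ _ _)
  have hz' : ∀ (j : ℤ) (hj : a - 1 + 1 = j) (v : N.X (a - 1)), N.d (a - 1) v = 0 ↔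
      N.dl (a - 1) j hj v = 0 := by
    rintro j rfl v
    rfl
  have hz'' : ∀ (j : ℤ) (hj : a - 1 + 1 = j) (v : M.X (a - 1)), M.d (a - 1) v = 0 ↔
      M.dl (a - 1) j hj v = 0 := by
    rintro j rfl v
    rfl
  -- The primitive `z₀` in `M` and the given `z` in `N` differ by a cycle, which is lifted so that
  -- `z₀ - c` maps to `z` up to a boundary.
  obtain ⟨c, hc, hb⟩ := hs.exists_cycle (y := s.f _ z₀ - z) (by
    rw [hz' a (by omega), map_sub, ← comm_dl, hz₀, hz, sub_self])
  have hc' : M.dl (a - 1) a (by omega) (z₀ - c) = p.1.1 := by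
    rw [map_sub, hz₀, (hz'' a _ _).1 hc, sub_zero]
  refine mem_boundaryPairs_of (sub_add_cancel a 1) (z₀ - c) hc' (hs.mem_bdry ?_ ?_)
  · rw [map_sub, d_T_pred, hc', p.2.2, sub_self]
  · rw [map_sub, ← hw, units_smul_map, map_T, add_sub_assoc, ← smul_sub, ← map_sub]
    refine add_mem (dl_mem_bdry _ _ _) (units_smul_mem _ _ (T_mem_bdry _ _ _ ?_))
    convert hb using 1
    rw [map_sub]
    abel

/-- Pairs define morphisms in the derived category. -/
noncomputable def pairHom (M : DGModule (polyDGA k 1)) : cyclePairs a b M →ₗ[k]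
    ((toD _).obj (freeCone k a b) ⟶ (toD _).obj M) :=
  ((toD _).mapLinearMap k).comp (freeDesc h M)

theorem pairHom_apply (p : cyclePairs a b M) :
    pairHom h M p = (toD _).map (freeDesc h M p) := rfl

theorem pairHom_comp (p : cyclePairs a b M) (g : M ⟶ N) :
    pairHom h M p ≫ (toD _).map g = pairHom h N (mapPair g p) := by
  rw [pairHom_apply, ← Functor.map_comp, freeDesc_comp, pairHom_apply]

/-- Vanishing in the derived category means being null-homotopic after some quasi-isomorphism; since
quasi-isomorphisms reflect boundary pairs, the morphism was already null-homotopic. In effect the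
free model is K-projective. -/
theorem pairHom_eq_zero_iff (p : cyclePairs a b M) :
    pairHom h M p = 0 ↔ p.1 ∈ boundaryPairs a b M := by
  constructor
  · intro hp
    rw [pairHom_apply, ← (toD _).map_zero, toD_map_eq_iff] at hp
    obtain ⟨N, s, hs, H⟩ := hp
    rw [freeDesc_comp, zero_comp, homotopic_freeDesc_zero_iff] at H
    exact hs.mem_boundaryPairs_of_map p H
  · intro hp
    rw [pairHom_apply, ← (toD _).map_zero]
    exact toD_map_eq_of_homotopic ((homotopic_freeDesc_zero_iff h p).2 hp)

/-- The numerator of a fraction is a pair in `N`, and lifting this pair through the denominator, up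
to boundaries, removes the fraction. -/
theorem pairHom_surjective : Function.Surjective (pairHom (k := k) h M) := by
  intro φ
  obtain ⟨N, g, s, hs, e⟩ := exists_fraction φ
  obtain ⟨p, rfl⟩ := freeDesc_surjective h g
  obtain ⟨q, hq⟩ := exists_lift_pair hs p
  have := isIso_toD_map hs
  refine ⟨q, ?_⟩
  rw [← cancel_mono ((toD _).map s), pairHom_comp, e, ← pairHom_apply, ← sub_eq_zero, ← map_sub,
    pairHom_eq_zero_iff]
  exact hq

theorem pairHom_genPair : pairHom h _ (genPair k h) = 𝟙 _ := by
  rw [pairHom_apply, freeDesc_genPair, CategoryTheory.Functor.map_id]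

end Resolution

/-! ### The cofree model and duality. -/

section Cofree

variable {k : Type u} [Field k] {a b : ℤ}

variable (k) in
/-- The surjection whose cone is a coresolution of the interval module of `[a, b]`. -/
noncomputable def cofreeMap (a b : ℤ) :
    intervalModule k (Set.Iic (b + 1)) ⟶ intervalModule k (Set.Iic (min a (b + 1))) :=
  ivHom _ _ fun j l h h₁ h₂ => by simp only [Set.mem_Iic] at *; omega

theorem cofreeMap_f (a b j : ℤ) (x : (intervalModule k (Set.Iic (b + 1))).X j) :
    (cofreeMap k a b).f j x = ivMk _ j (ivVal _ j x) := rfl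

variable (k) in
/-- A DG module that is cofree as a graded module, and that receives morphisms given by
linear functionals in the degrees `a` and `b`. -/
noncomputable abbrev cofreeCone (a b : ℤ) : DGModule (polyDGA k 1) := cone (cofreeMap k a b)

/-- The values of the first component. -/
noncomputable def valFst (a b j : ℤ) : (cofreeCone k a b).X j →ₗ[k] k :=
  (ivVal _ (j + 1)).comp (coneFst (cofreeMap k a b) j)

/-- The values of the second component. -/
noncomputable def valSnd (a b j : ℤ) : (cofreeCone k a b).X j →ₗ[k] k :=
  (ivVal _ j).comp (coneSnd (cofreeMap k a b) j)

theorem cofreeCone_ext {j : ℤ} {x y : (cofreeCone k a b).X j} (h₁ : valFst a b j x = valFst a b j y)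
    (h₂ : valSnd a b j x = valSnd a b j y) : x = y := coneMk_ext _ (iv_ext h₁) (iv_ext h₂)

theorem valFst_eq_zero {j : ℤ} (h : b < j) (x : (cofreeCone k a b).X j) :
    valFst a b j x = 0 := ivVal_eq_zero (by simp; omega) _

theorem valSnd_eq_zero {j : ℤ} (h : a < j ∨ b + 1 < j) (x : (cofreeCone k a b).X j) :
    valSnd a b j x = 0 := ivVal_eq_zero (by simp; omega) _

theorem valFst_d (j : ℤ) (x : (cofreeCone k a b).X j) :
    valFst a b (j + 1) ((cofreeCone k a b).d j x) = 0 := by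
  simp [valFst, intervalModule_d]

theorem valSnd_d {j : ℤ} (h : a ≤ b + 1) (hj : j < a) (x : (cofreeCone k a b).X j) :
    valSnd a b (j + 1) ((cofreeCone k a b).d j x) = valFst a b j x := by
  simp only [valSnd, valFst, LinearMap.comp_apply, coneSnd_d, intervalModule_d, add_zero]
  rw [cofreeMap_f, ivVal_ivMk (by simp; omega)]

theorem valFst_T {j l : ℤ} (h : j ≤ l) (hl : l ≤ b) (x : (cofreeCone k a b).X j) :
    valFst a b l ((cofreeCone k a b).T j l x) = (l - j).negOnePow • valFst a b j x := by
  simp only [valFst, LinearMap.comp_apply, coneFst_T, units_smul_map]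
  rw [ivVal_T (Set.mem_Iic.2 (by omega)) (by omega)]

theorem valSnd_T {j l : ℤ} (hab : a ≤ b + 1) (h : j ≤ l) (hl : l ≤ a) (x : (cofreeCone k a b).X j) :
    valSnd a b l ((cofreeCone k a b).T j l x) = valSnd a b j x := by
  simp only [valSnd, LinearMap.comp_apply, coneSnd_T]
  rw [ivVal_T (Set.mem_Iic.2 (by omega)) (by omega)]

/-- The linear map to a cofree cone with prescribed values. -/
noncomputable def cofreeMk {V : Type u} [AddCommGroup V] [Module k V] (a b j : ℤ) (f g : V →ₗ[k] k) :
    V →ₗ[k] (cofreeCone k a b).X j :=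
  coneLift (cofreeMap k a b) ((ivMk _ (j + 1)).comp f) ((ivMk _ j).comp g)

theorem valFst_mk {V : Type u} [AddCommGroup V] [Module k V] {j : ℤ} (hj : j ≤ b) (f g : V →ₗ[k] k)
    (x : V) : valFst a b j (cofreeMk a b j f g x) = f x := by
  simp only [valFst, cofreeMk, LinearMap.comp_apply, coneFst_lift]
  rw [ivVal_ivMk (Set.mem_Iic.2 (by omega))]

theorem valSnd_mk {V : Type u} [AddCommGroup V] [Module k V] {j : ℤ} (h : a ≤ b + 1) (hj : j ≤ a)
    (f g : V →ₗ[k] k) (x : V) : valSnd a b j (cofreeMk a b j f g x) = g x := by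
  simp only [valSnd, cofreeMk, LinearMap.comp_apply, coneSnd_lift]
  rw [ivVal_ivMk (Set.mem_Iic.2 (by omega))]

/-- A linear functional on pairs that vanishes on boundaries extends to a morphism of
DG modules. -/
noncomputable def cofreeLift (h : a ≤ b + 1) {M : DGModule (polyDGA k 1)} (φ : M.X a →ₗ[k] k)
    (ψ : M.X b →ₗ[k] k) (H : ∀ p ∈ boundaryPairs a b M, φ p.1 + ψ p.2 = 0) :
    M ⟶ cofreeCone k a b :=
  homMk (fun j => cofreeMk a b j (-(b - j).negOnePow • ψ.comp (M.T j b)) (φ.comp (M.T j a)))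
    (by
      -- Vanishing on boundary pairs splits into two statements: `ψ` kills boundaries, and `φ ∘ d`
      -- equals `ψ ∘ T ^ (b + 1 - a)` up to sign. They give compatibility with the differential in
      -- the two components of the cone.
      have hψ : ∀ y ∈ M.bdry b, ψ y = 0 := by
        rintro _ ⟨w, rfl⟩
        simpa using H (_, _) (mem_boundaryPairs.2 ⟨0, w, rfl, rfl⟩)
      have hφ : ∀ z, φ (M.dl (a - 1) a (by omega) z) =
          -(b + 1 - a).negOnePow • ψ (M.T (a - 1) b z) := fun z => by
        have := H (_, _) (mem_boundaryPairs.2 ⟨z, 0, rfl, rfl⟩)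
        rw [eq_neg_of_add_eq_zero_left this]
        simp
      intro j x
      apply cofreeCone_ext
      · rw [valFst_d]
        by_cases hj : j + 1 ≤ b
        · rw [valFst_mk hj]
          simp only [LinearMap.smul_apply, LinearMap.comp_apply]
          rw [hψ _ (T_mem_bdry M _ _ (d_mem_bdry M x)), smul_zero]
        · rw [valFst_eq_zero (by omega)]
      · by_cases hj : j + 1 ≤ a
        · rw [valSnd_d h (by omega), valSnd_mk h hj, valFst_mk (by omega)]
          have e := dl_T M (rfl : j + 1 = j + 1) (sub_add_cancel a 1) x
          rw [eq_comm, ← eq_inv_smul_iff] at e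
          change M.T (j + 1) a (M.d j x) = _ at e
          simp only [LinearMap.smul_apply, LinearMap.comp_apply]
          rw [e, units_smul_map, hφ, T_T M (by omega) (by omega), smul_smul, Int.units_inv_eq_self, mul_neg,
            negOnePow_mul_eq (c := b - j) (by omega)]
        · rw [valSnd_eq_zero (by omega), valSnd_eq_zero (by omega)])
    (by
      intro j l hl x
      apply cofreeCone_ext
      · by_cases hb : l ≤ b
        · rw [valFst_T hl hb, valFst_mk hb, valFst_mk (by omega)]
          simp only [LinearMap.smul_apply, LinearMap.comp_apply]
          rw [T_T M hl hb, smul_smul, mul_neg, negOnePow_mul_eq (c := b - l) (by omega)]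
        · rw [valFst_eq_zero (by omega), valFst_eq_zero (by omega)]
      · by_cases ha : l ≤ a
        · rw [valSnd_T h hl ha, valSnd_mk h ha, valSnd_mk h (by omega)]
          simp only [LinearMap.comp_apply]
          rw [T_T M hl ha]
        · rw [valSnd_eq_zero (by omega), valSnd_eq_zero (by omega)])

/-- The universal functional on pairs: pulling it back along `cofreeLift` recovers `φ + ψ`. Since it
vanishes on boundaries, a pair on which `φ + ψ` is non-zero cannot become a boundary in the cofree
cone. -/
theorem cofreeCone_trace (h : a ≤ b + 1) {p : (cofreeCone k a b).X a × (cofreeCone k a b).X b}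
    (hp : p ∈ boundaryPairs a b (cofreeCone k a b)) :
    valSnd a b a p.1 - valFst a b b p.2 = 0 := by
  obtain ⟨z, w, h₁, h₂⟩ := mem_boundaryPairs.1 hp
  have e₁ : ∀ (i j : ℤ) (hj : i + 1 = j) (v : (cofreeCone k a b).X i), i < a →
      valSnd a b j ((cofreeCone k a b).dl i j hj v) = valFst a b i v := by
    rintro i _ rfl v hi
    exact valSnd_d h hi v
  have e₂ : ∀ (i j : ℤ) (hj : i + 1 = j) (v : (cofreeCone k a b).X i),
      valFst a b j ((cofreeCone k a b).dl i j hj v) = 0 := by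
    rintro i _ rfl v
    exact valFst_d i v
  rw [← h₁, ← h₂, map_add, e₁ _ _ _ _ (by omega), e₂, units_smul_map, valFst_T (by omega) le_rfl,
    smul_smul, negOnePow_mul_eq (c := 0) (by omega)]
  simp

/-- Cofree cones detect non-zero morphisms. -/
theorem exists_cofree_of_notMem (h : a ≤ b + 1) {M : DGModule (polyDGA k 1)}
    (p : cyclePairs a b M) (hp : p.1 ∉ boundaryPairs a b M) :
    ∃ g : M ⟶ cofreeCone k a b, (mapPair g p).1 ∉ boundaryPairs a b (cofreeCone k a b) := by
  obtain ⟨f, hf, hf'⟩ := Submodule.exists_le_ker_of_notMem hp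
  refine ⟨cofreeLift h (f.comp (LinearMap.inl k _ _)) (f.comp (LinearMap.inr k _ _)) ?_, ?_⟩
  · intro q hq
    have := LinearMap.mem_ker.1 (hf' hq)
    rw [LinearMap.comp_apply, LinearMap.comp_apply, ← map_add]
    simpa using this
  · intro hg
    have e := cofreeCone_trace h hg
    rw [mapPair_fst, mapPair_snd] at e
    change valSnd a b a (cofreeMk a b a _ _ _) - valFst a b b (cofreeMk a b b _ _ _) = 0 at e
    rw [valSnd_mk h le_rfl, valFst_mk le_rfl] at e
    apply hf
    simpa [← map_add] using e

variable (k) in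
/-- The coresolution of an interval module. -/
noncomputable def coresolution (h : a ≤ b + 1) :
    intervalModule k (Set.Icc a b) ⟶ cofreeCone k a b :=
  homMk (fun j => cofreeMk a b j (j.negOnePow • ivVal _ j) 0)
    (fun j x => by
      rw [intervalModule_d, map_zero, eq_comm]
      apply cofreeCone_ext
      · rw [valFst_d, map_zero]
      · rw [map_zero]
        by_cases hj : j < a
        · rw [valSnd_d h hj, valFst_mk (by omega), LinearMap.smul_apply,
            ivVal_eq_zero (by simp; omega), smul_zero]
        · rw [valSnd_eq_zero (by omega)])
    (fun j l hl x => by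
      apply cofreeCone_ext
      · by_cases hb : l ≤ b
        · rw [valFst_T hl hb, valFst_mk hb, valFst_mk (by omega), LinearMap.smul_apply,
            LinearMap.smul_apply]
          by_cases ha : a ≤ j
          · rw [ivVal_T (by simp; omega) hl, smul_smul, negOnePow_mul_eq (c := l) (by omega)]
          · have : x = 0 := iv_ext (by rw [ivVal_eq_zero (by simp; omega), map_zero])
            rw [this]; simp
        · rw [valFst_eq_zero (by omega), valFst_eq_zero (by omega)]
      · by_cases ha : l ≤ a
        · rw [valSnd_T h hl ha, valSnd_mk h ha, valSnd_mk h (by omega)]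
          rfl
        · rw [valSnd_eq_zero (by omega), valSnd_eq_zero (by omega)])

/-- The map `cofreeMap` is onto, with kernel in the degrees `a + 1` to `b + 1`; in the cone this
kernel is shifted to `[a, b]`. Hence the free and the cofree models represent the same object. -/
theorem isQuasiIso_coresolution (h : a ≤ b + 1) : IsQuasiIso (coresolution k h) := by
  refine ⟨fun i x hx ⟨y, hy⟩ => ⟨0, ?_⟩, fun i y hy => ?_⟩
  · by_cases hi : i + 1 ≤ b
    · have e : valFst a b (i + 1) ((coresolution k h).f (i + 1) x) = 0 := by rw [← hy, valFst_d]
      change valFst a b (i + 1) (cofreeMk a b (i + 1) _ _ x) = 0 at e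
      rw [valFst_mk hi, LinearMap.smul_apply, smul_eq_zero_iff_eq] at e
      exact iv_ext (by rw [map_zero, map_zero, e])
    · exact iv_ext (by rw [map_zero, map_zero, ivVal_eq_zero (by simp; omega)])
  · refine ⟨ivMk _ (i + 1) ((i + 1).negOnePow • valFst a b (i + 1) y), rfl,
      cofreeMk a b i (-LinearMap.id) 0 (valSnd a b (i + 1) y), ?_⟩
    change cofreeMk a b (i + 1) _ _ _ = _
    apply cofreeCone_ext
    · rw [map_add, valFst_d, add_zero]
      by_cases hi : i + 1 ≤ b
      · rw [valFst_mk hi, LinearMap.smul_apply]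
        by_cases ha : a ≤ i + 1
        · rw [ivVal_ivMk (by simp; omega), smul_smul, negOnePow_mul_eq (c := 0) (by omega)]
          simp
        · rw [ivMk_eq_zero (by simp; omega), map_zero, smul_zero, ← valSnd_d h (by omega), hy,
            map_zero]
      · rw [valFst_eq_zero (by omega), valFst_eq_zero (by omega)]
    · by_cases hi : i + 1 ≤ a
      · rw [map_add, valSnd_mk h hi, valSnd_d h (by omega), valFst_mk (by omega)]
        simp
      · rw [valSnd_eq_zero (by omega), valSnd_eq_zero (by omega)]

end Cofree

/-! ### Objects whose endomorphism ring is the dual numbers. -/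

section Dual

universe v' u'

variable {k : Type u} [Field k] {C : Type u'} [Category.{v'} C] [Preadditive C] [Linear k C]

variable (k) in
/-- The endomorphism algebra of `X` is the algebra of dual numbers `k[ε]`. -/
structure IsDual {X : C} (ε : X ⟶ X) : Prop where
  ne_zero : ε ≠ 0
  sq_zero : ε ≫ ε = 0
  exists_eq : ∀ φ : X ⟶ X, ∃ r s : k, φ = r • 𝟙 X + s • ε

namespace IsDual

variable {X Y : C} {ε : X ⟶ X} (h : IsDual k ε)

include h

theorem isIso_or (φ : X ⟶ X) : IsIso φ ∨ ∃ s : k, φ = s • ε := by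
  obtain ⟨r, s, rfl⟩ := h.exists_eq φ
  by_cases hr : r = 0
  · exact Or.inr ⟨s, by rw [hr, zero_smul, zero_add]⟩
  -- The inverse of `r + s ε` is `r⁻¹ - r⁻² s ε`, because `ε² = 0`.
  · refine Or.inl ⟨r⁻¹ • 𝟙 X - (r⁻¹ * r⁻¹ * s) • ε, ?_, ?_⟩
    all_goals
      simp only [Preadditive.comp_sub, Preadditive.add_comp, Preadditive.sub_comp,
        Preadditive.comp_add, Linear.comp_smul, Linear.smul_comp, Category.comp_id,
        Category.id_comp, h.sq_zero, smul_zero, add_zero, smul_smul]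
      match_scalars <;> field_simp
      try ring

theorem not_isZero : ¬ IsZero X := fun hX => h.ne_zero (hX.eq_of_src _ _)

theorem eq_zero_or_eq_id {φ : X ⟶ X} (hφ : φ ≫ φ = φ) : φ = 0 ∨ φ = 𝟙 X := by
  rcases h.isIso_or φ with H | ⟨s, rfl⟩
  · exact Or.inr (by rw [← cancel_mono φ, hφ, Category.id_comp])
  · left
    rw [← hφ]
    simp [h.sq_zero]

theorem isIso_of_comp_eq_id (hY : ¬ IsZero Y) {f : X ⟶ Y} {s : Y ⟶ X} (hs : s ≫ f = 𝟙 Y) :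
    IsIso f := by
  rcases h.eq_zero_or_eq_id (φ := f ≫ s) (by
    rw [Category.assoc, ← Category.assoc s, hs, Category.id_comp]) with H | H
  · exact absurd ((IsZero.iff_id_eq_zero Y).2 (by
      rw [← Category.id_comp (𝟙 Y), ← hs, Category.assoc, ← Category.assoc f, H, zero_comp,
        comp_zero])) hY
  · exact ⟨s, H, hs⟩

/-- The only idempotents are `0` and the identity, so the projection onto one summand is trivial and
one of the two summands vanishes. -/
theorem isIndecomposable : IsIndecomposable X := by
  refine ⟨h.not_isZero, fun Y Z b ⟨hb⟩ ⟨e⟩ => ?_⟩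
  have key : ∀ (W : C) (i : W ⟶ b.pt) (p : b.pt ⟶ W), i ≫ p = 𝟙 W → p ≫ i = 0 ∨ p ≫ i = 𝟙 _ := by
    intro W i p hip
    have := h.eq_zero_or_eq_id (φ := e.inv ≫ p ≫ i ≫ e.hom) (by
      simp only [Category.assoc, e.hom_inv_id_assoc]
      rw [← Category.assoc i p, hip, Category.id_comp])
    refine this.imp (fun H => ?_) fun H => ?_
    · rw [← cancel_epi e.inv, ← cancel_mono e.hom]
      simpa using H
    · rw [← cancel_epi e.inv, ← cancel_mono e.hom]
      simpa using H
  rcases key _ _ _ b.inl_fst with H | H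
  · left
    rw [IsZero.iff_id_eq_zero, ← Category.comp_id (𝟙 Y), ← b.inl_fst, Category.assoc,
      ← Category.assoc b.fst, H, zero_comp, comp_zero]
  · right
    rw [IsZero.iff_id_eq_zero, ← b.inr_snd, ← Category.comp_id b.inr, ← H, ← Category.assoc b.inr,
      b.inr_fst, zero_comp, zero_comp]

end IsDual

end Dual

/-! ### Dimensions of morphism spaces between interval objects. -/

section HomRank

variable {k : Type u} [Field k] {a b c d : ℤ}

theorem freeMap_comp (a b : ℤ) : freeMap k a b ≫ ivHom (Set.Ici a) (Set.Icc a b)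
    (fun j l _ h₁ h₂ => by simp at *; omega) = 0 := by
  refine hom_ext fun j x => iv_ext ?_
  rw [comp_f, ivHom_f, freeMap_f, zero_f, map_zero]
  by_cases hj : j ∈ Set.Icc a b
  · rw [ivVal_eq_zero (by simp at *; omega) x]
    simp
  · rw [ivVal_eq_zero hj]

variable (k) in
/-- The resolution of an interval module. -/
noncomputable def resolution (a b : ℤ) : freeCone k a b ⟶ intervalModule k (Set.Icc a b) :=
  coneDesc _ _ (freeMap_comp a b)

theorem isQuasiIso_resolution (a b : ℤ) : IsQuasiIso (resolution k a b) := by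
  refine isQuasiIso_coneDesc _ _ _ (fun j => ?_) (fun j x => ?_) fun j x hx => ?_
  · rw [injective_iff_map_eq_zero]
    intro x hx
    refine iv_ext ?_
    rw [map_zero]
    by_cases hj : max a (b + 1) ≤ j
    · have := congrArg (ivVal _ j) hx
      rwa [freeMap_f, map_zero, ivVal_ivMk (by simp at *; omega)] at this
    · exact ivVal_eq_zero (by simpa using hj) x
  · refine ⟨ivMk _ j (ivVal _ j x), iv_ext ?_⟩
    rw [ivHom_f]
    by_cases hj : j ∈ Set.Icc a b
    · rw [ivVal_ivMk hj, ivVal_ivMk (Set.mem_Ici.2 hj.1)]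
    · rw [ivVal_eq_zero hj, ivVal_eq_zero hj]
  · refine ⟨ivMk _ j (ivVal _ j x), iv_ext ?_⟩
    rw [freeMap_f]
    by_cases hj : j ∈ Set.Icc a b
    · have := congrArg (ivVal _ j) hx
      rw [ivHom_f, map_zero, ivVal_ivMk hj] at this
      rw [this]
      simp
    · by_cases ha : a ≤ j
      · rw [ivVal_ivMk (Set.mem_Ici.2 ha), ivVal_ivMk (by simp at *; omega)]
      · rw [ivVal_eq_zero (by simpa using ha), ivVal_eq_zero (by simpa using ha)]

theorem rank_eq_of_surjective {Z V : Type u} {H : Type*} [AddCommGroup Z] [Module k Z]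
    [AddCommGroup V] [Module k V] [AddCommGroup H] [Module k H] {f : Z →ₗ[k] H} {g : Z →ₗ[k] V}
    (hf : Function.Surjective f) (hg : Function.Surjective g)
    (hfg : ∀ z, f z = 0 ↔ g z = 0) : Nonempty (H ≃ₗ[k] V) := by
  have : LinearMap.ker f = LinearMap.ker g := by
    ext z
    exact hfg z
  exact ⟨(f.quotKerEquivOfSurjective hf).symm.trans
    ((Submodule.quotEquivOfEq _ _ this).trans (g.quotKerEquivOfSurjective hg))⟩

/-- The differential vanishes, so the pair condition reads `T ^ (b + 1 - a) x = 0`. For `a` in `[c,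
d]` this kills `x` unless `b + 1` lies beyond `d`. -/
theorem interval_fst_eq_zero (h : a ≤ b + 1) (hF : ¬ (c ≤ a ∧ a ≤ d ∧ d ≤ b))
    (p : cyclePairs a b (intervalModule k (Set.Icc c d))) : p.1.1 = 0 := by
  refine iv_ext ?_
  rw [map_zero]
  by_cases ha : a ∈ Set.Icc c d
  · have := congrArg (ivVal _ (b + 1)) p.2.2
    rwa [intervalModule_d, map_zero, ivVal_T (by simp at *; omega) h, eq_comm] at this
  · exact ivVal_eq_zero ha _

/-- Boundary pairs are `(0, ± T ^ (b + 1 - a) z)` with `z` of degree `a - 1`. Every `y` of degree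
`b` has this form unless `b` lies in `[c, d]` and `a - 1` lies below `c`; in that case only `y = 0`
does. -/
theorem interval_mem_boundaryPairs_iff (h : a ≤ b + 1)
    (p : cyclePairs a b (intervalModule k (Set.Icc c d))) :
    p.1 ∈ boundaryPairs a b (intervalModule k (Set.Icc c d)) ↔
      p.1.1 = 0 ∧ (a ≤ c ∧ c ≤ b ∧ b ≤ d → p.1.2 = 0) := by
  constructor
  · intro hp
    obtain ⟨z, w, h₁, h₂⟩ := mem_boundaryPairs.1 hp
    rw [intervalModule_dl] at h₁ h₂
    refine ⟨h₁.symm, fun hF => ?_⟩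
    have : z = 0 := iv_ext (by rw [ivVal_eq_zero (by simp; omega), map_zero])
    rw [← h₂, this]
    simp
  · rintro ⟨h₁, h₂⟩
    by_cases hF : a ≤ c ∧ c ≤ b ∧ b ≤ d
    · have : p.1 = 0 := Prod.ext h₁ (h₂ hF)
      rw [this]
      exact zero_mem _
    · refine mem_boundaryPairs.2
        ⟨ivMk _ (a - 1) ((b + 1 - a).negOnePow • ivVal _ b p.1.2), 0, ?_, iv_ext ?_⟩
      · rw [intervalModule_dl, h₁]
      · rw [map_zero, zero_add, units_smul_map]
        by_cases hb : b ∈ Set.Icc c d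
        · rw [ivVal_T hb (by omega), ivVal_ivMk (by simp at *; omega), smul_smul,
            negOnePow_mul_eq (c := 0) (by omega)]
          simp
        · rw [ivVal_eq_zero hb, ivVal_eq_zero hb, smul_zero]

/-- The morphisms in the derived category from a resolved interval module to an interval module. -/
theorem nonempty_homEquiv_prod (h : a ≤ b) :
    Nonempty (((toD _).obj (freeCone k a b) ⟶ (toD _).obj (intervalModule k (Set.Icc a b))) ≃ₗ[k]
      k × k) := by
  refine rank_eq_of_surjective (pairHom_surjective (by omega : a ≤ b + 1))
    (g := ((ivVal _ a).prodMap (ivVal _ b)).comp (cyclePairs a b _).subtype) ?_ fun p => ?_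
  · rintro ⟨x, y⟩
    refine ⟨⟨(ivMk _ a x, ivMk _ b y), rfl, ?_⟩, ?_⟩
    · exact iv_ext (by rw [ivVal_eq_zero (by simp), ivVal_eq_zero (by simp)])
    · exact Prod.ext (ivVal_ivMk (by simpa using h) _) (ivVal_ivMk (by simpa using h) _)
  · rw [pairHom_eq_zero_iff, interval_mem_boundaryPairs_iff (by omega)]
    constructor
    · rintro ⟨h₁, h₂⟩
      exact Prod.ext (congrArg (ivVal _ a) h₁) (congrArg (ivVal _ b) (h₂ ⟨le_rfl, h, le_rfl⟩))
    · intro hp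
      exact ⟨iv_ext (congrArg Prod.fst hp), fun _ => iv_ext (congrArg Prod.snd hp)⟩

theorem nonempty_homEquiv_of_left (h : a ≤ b + 1) (h₁ : c ≤ a ∧ a ≤ d ∧ d ≤ b)
    (h₂ : ¬ (a ≤ c ∧ c ≤ b ∧ b ≤ d)) :
    Nonempty (((toD _).obj (freeCone k a b) ⟶ (toD _).obj (intervalModule k (Set.Icc c d))) ≃ₗ[k]
      k) := by
  refine rank_eq_of_surjective (pairHom_surjective h)
    (g := ((ivVal _ a).comp (LinearMap.fst k _ _)).comp (cyclePairs a b _).subtype) ?_ fun p => ?_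
  · intro x
    refine ⟨⟨(ivMk _ a x, 0), rfl, ?_⟩, ?_⟩
    · exact iv_ext (by rw [ivVal_eq_zero (by simp; omega), ivVal_eq_zero (by simp; omega)])
    · exact ivVal_ivMk (by simp; omega) _
  · rw [pairHom_eq_zero_iff, interval_mem_boundaryPairs_iff h]
    exact ⟨fun hp => congrArg (ivVal _ a) hp.1, fun hp => ⟨iv_ext hp, fun H => absurd H h₂⟩⟩

theorem nonempty_homEquiv_of_right (h : a ≤ b + 1) (h₁ : ¬ (c ≤ a ∧ a ≤ d ∧ d ≤ b))
    (h₂ : a ≤ c ∧ c ≤ b ∧ b ≤ d) :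
    Nonempty (((toD _).obj (freeCone k a b) ⟶ (toD _).obj (intervalModule k (Set.Icc c d))) ≃ₗ[k]
      k) := by
  refine rank_eq_of_surjective (pairHom_surjective h)
    (g := ((ivVal _ b).comp (LinearMap.snd k _ _)).comp (cyclePairs a b _).subtype) ?_ fun p => ?_
  · intro x
    refine ⟨⟨(0, ivMk _ b x), rfl, ?_⟩, ?_⟩
    · rw [map_zero]; rfl
    · exact ivVal_ivMk (by simp; omega) _
  · rw [pairHom_eq_zero_iff, interval_mem_boundaryPairs_iff h]
    exact ⟨fun hp => congrArg (ivVal _ b) (hp.2 h₂),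
      fun hp => ⟨interval_fst_eq_zero h h₁ p, fun _ => iv_ext hp⟩⟩

theorem hom_eq_zero_of_not (h : a ≤ b + 1) (h₁ : ¬ (c ≤ a ∧ a ≤ d ∧ d ≤ b))
    (h₂ : ¬ (a ≤ c ∧ c ≤ b ∧ b ≤ d))
    (φ : (toD _).obj (freeCone k a b) ⟶ (toD _).obj (intervalModule k (Set.Icc c d))) : φ = 0 := by
  obtain ⟨p, rfl⟩ := pairHom_surjective h φ
  rw [pairHom_eq_zero_iff, interval_mem_boundaryPairs_iff h]
  exact ⟨interval_fst_eq_zero h h₁ p, fun H => absurd H h₂⟩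

variable (k) in
/-- The object of the derived category given by the interval module of `[a, b]`, in its resolved
form. -/
noncomputable abbrev stdObj (a b : ℤ) : D (polyDGA k 1) := (toD _).obj (freeCone k a b)

variable (k) in
/-- The resolution is an isomorphism in the derived category. -/
noncomputable def resolutionIso (a b : ℤ) :
    stdObj k a b ≅ (toD _).obj (intervalModule k (Set.Icc a b)) :=
  have := isIso_toD_map (isQuasiIso_resolution (k := k) a b)
  asIso ((toD _).map (resolution k a b))

variable (k) in
/-- The resolution and the coresolution of an interval module are isomorphic in the derived
category. -/
noncomputable def cofreeIso (h : a ≤ b + 1) : stdObj k a b ≅ (toD _).obj (cofreeCone k a b) :=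
  have := isIso_toD_map (isQuasiIso_coresolution (k := k) h)
  resolutionIso k a b ≪≫ asIso ((toD _).map (coresolution k h))

theorem rank_hom_eq_two (h : a ≤ b) : Module.rank k (stdObj k a b ⟶ stdObj k a b) = 2 := by
  obtain ⟨e⟩ := nonempty_homEquiv_prod (k := k) h
  have := ((Linear.homCongr k (Iso.refl _) (resolutionIso k a b)).trans
    e).lift_rank_eq
  simpa [rank_prod', one_add_one_eq_two] using this

theorem rank_hom_eq_one (h : a ≤ b + 1)
    (H : c ≤ a ∧ a ≤ d ∧ d ≤ b ∨ a ≤ c ∧ c ≤ b ∧ b ≤ d) (hne : ¬ (a = c ∧ b = d)) :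
    Module.rank k (stdObj k a b ⟶ stdObj k c d) = 1 := by
  have : Nonempty (((toD _).obj (freeCone k a b) ⟶
      (toD _).obj (intervalModule k (Set.Icc c d))) ≃ₗ[k] k) := by
    rcases H with H | H
    · exact nonempty_homEquiv_of_left h H (by omega)
    · exact nonempty_homEquiv_of_right h (by omega) H
  obtain ⟨e⟩ := this
  have := ((Linear.homCongr k (Iso.refl _) (resolutionIso k c d)).trans e).lift_rank_eq
  simpa using this

theorem stdObj_hom_eq_zero (h : a ≤ b + 1) (h₁ : ¬ (c ≤ a ∧ a ≤ d ∧ d ≤ b))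
    (h₂ : ¬ (a ≤ c ∧ c ≤ b ∧ b ≤ d)) (φ : stdObj k a b ⟶ stdObj k c d) : φ = 0 := by
  rw [← cancel_mono (resolutionIso k c d).hom, zero_comp]
  exact hom_eq_zero_of_not h h₁ h₂ _

end HomRank

/-! ### The endomorphism `ε`, duality and the almost split property. -/

section StandardObjects

variable {k : Type u} [Field k] {a b c d : ℤ} {M : DGModule (polyDGA k 1)}

theorem resolution_genE (a b : ℤ) : (resolution k a b).f a (genE k a b) =
    ivMk (Set.Icc a b) a (ivVal _ a (ivMk (Set.Ici a) a 1)) := rfl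

theorem ivVal_resolution_genE (h : a ≤ b) :
    ivVal _ a ((resolution k a b).f a (genE k a b)) = 1 := by
  rw [resolution_genE, ivVal_ivMk (by simpa using h), ivVal_ivMk (by simp)]

theorem resolution_genF (a b : ℤ) : (resolution k a b).f b (genF k a b) = 0 := by
  change ivMk (Set.Icc a b) b (ivVal (Set.Ici a) b 0) = 0
  rw [map_zero, map_zero]

theorem pairHom_pairHom (h : a ≤ b + 1) (h' : c ≤ d + 1) (q : cyclePairs a b (freeCone k c d))
    (p : cyclePairs c d M) :
    pairHom h _ q ≫ pairHom h' _ p = pairHom h _ (mapPair (freeDesc h' M p) q) :=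
  pairHom_comp h q _

/-- The pair `(0, T ^ (b - a) x)`. -/
noncomputable def soclePair (p : cyclePairs a b M) : cyclePairs a b M :=
  ⟨(0, M.T a b p.1.1), map_zero _, by rw [d_T, p.2.1, map_zero, smul_zero, map_zero]⟩

/-- The sign of the boundary formula is absorbed into `z`, which is a cycle here, and the free
indices avoid casts between degrees. -/
theorem soclePair_eq_zero_iff {i j : ℤ} (hi : i + 1 = a) (hj : j + 1 = b) (p : cyclePairs a b M) :
    (soclePair p).1 ∈ boundaryPairs a b M ↔ ∃ z w, M.dl i a hi z = 0 ∧
      M.dl j b hj w + M.T i b z = M.T a b p.1.1 := by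
  obtain rfl : i = a - 1 := by omega
  obtain rfl : j = b - 1 := by omega
  rw [mem_boundaryPairs]
  constructor
  · rintro ⟨z, w, h₁, h₂⟩
    refine ⟨(b + 1 - a).negOnePow • z, w, ?_, ?_⟩
    · rw [units_smul_map, h₁]
      exact smul_zero _
    · rw [units_smul_map]
      exact h₂
  · rintro ⟨z, w, h₁, h₂⟩
    refine ⟨(b + 1 - a).negOnePow • z, w, ?_, ?_⟩
    · rw [units_smul_map, h₁, smul_zero]
      rfl
    · rw [units_smul_map, smul_smul, negOnePow_mul_eq (c := 0) (by omega), Int.negOnePow_zero,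
        one_smul]
      exact h₂

variable (k) in
/-- The nilpotent endomorphism of a standard object. -/
noncomputable def stdEps (h : a ≤ b + 1) : stdObj k a b ⟶ stdObj k a b :=
  pairHom h _ (soclePair (genPair k h))

theorem stdEps_comp (h : a ≤ b + 1) (p : cyclePairs a b M) :
    stdEps k h ≫ pairHom h M p = pairHom h M (soclePair p) := by
  rw [stdEps, pairHom_pairHom]
  congr 1
  refine Subtype.ext (Prod.ext ?_ ?_)
  · exact ((freeDesc h M p).f a).map_zero
  · exact (map_T _ _ _ _).trans (congrArg _ (freeDesc_genE h p))

/-- After composition with the resolution, the identity and `ε` become pairs with values `(1, 0)`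
and `(0, 1)`, a basis of the two-dimensional space of pairs. The square of `ε` is zero because the
first coordinate of a socle pair is. -/
theorem isDual_stdEps (h : a ≤ b) : IsDual k (stdEps k (by omega : a ≤ b + 1)) := by
  have h' : a ≤ b + 1 := by omega
  have key : (resolutionIso k a b).hom = pairHom h' _ (mapPair (resolution k a b) (genPair k h')) := by
    rw [← pairHom_comp, pairHom_genPair, Category.id_comp]
    rfl
  refine ⟨fun h₀ => ?_, ?_, fun φ => ?_⟩
  · have := stdEps_comp h' (mapPair (resolution k a b) (genPair k h'))
    rw [h₀, zero_comp, eq_comm, pairHom_eq_zero_iff,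
      interval_mem_boundaryPairs_iff h'] at this
    have := congrArg (ivVal _ b) (this.2 ⟨le_rfl, h, le_rfl⟩)
    change ivVal _ b ((intervalModule k _).T a b ((resolution k a b).f a (genE k a b))) = _ at this
    rw [ivVal_T (by simpa using h) h, ivVal_resolution_genE h, map_zero] at this
    exact one_ne_zero this
  · conv_lhs => rhs; rw [stdEps]
    rw [stdEps_comp, pairHom_eq_zero_iff]
    have : (soclePair (soclePair (genPair k h'))).1 = 0 := Prod.ext rfl ((freeCone k a b).T a b).map_zero
    rw [this]
    exact zero_mem _
  · obtain ⟨p, hp⟩ := pairHom_surjective h' (φ ≫ (resolutionIso k a b).hom)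
    refine ⟨ivVal _ a p.1.1, ivVal _ b p.1.2, ?_⟩
    rw [← cancel_mono (resolutionIso k a b).hom, ← hp, Preadditive.add_comp, Linear.smul_comp,
      Linear.smul_comp, Category.id_comp, key, stdEps_comp, ← (pairHom h' _).map_smul,
      ← (pairHom h' _).map_smul, ← map_add]
    congr 1
    refine Subtype.ext (Prod.ext (iv_ext ?_) (iv_ext ?_))
    · change _ = ivVal _ a (_ • (resolution k a b).f a (genE k a b) + _ • 0)
      rw [smul_zero, add_zero, map_smul, ivVal_resolution_genE h, smul_eq_mul, mul_one]
    · change _ = ivVal _ b (_ • (resolution k a b).f b (genF k a b) +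
        _ • (intervalModule k _).T a b ((resolution k a b).f a (genE k a b)))
      rw [resolution_genF, smul_zero, zero_add, map_smul, ivVal_T (by simpa using h) h,
        ivVal_resolution_genE h, smul_eq_mul, mul_one]

/-- Non-degeneracy of the Serre pairing, the Serre functor being the identity on these objects: a
non-zero class of pairs is detected by a map to the cofree model, which is again the object `[a,
b]`. -/
theorem exists_comp_ne_zero (h : a ≤ b + 1) {X : D (polyDGA k 1)} (g : stdObj k a b ⟶ X)
    (hg : g ≠ 0) : ∃ g' : X ⟶ stdObj k a b, g ≫ g' ≠ 0 := by
  obtain ⟨M, ⟨e⟩⟩ := exists_toD_obj X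
  obtain ⟨p, hp⟩ := pairHom_surjective h (g ≫ e.inv)
  obtain ⟨q, hq⟩ := exists_cofree_of_notMem h p (by
    rw [← pairHom_eq_zero_iff h, hp]
    intro h₀
    exact hg (by rw [← cancel_mono e.inv, h₀, zero_comp]))
  refine ⟨e.inv ≫ (toD _).map q ≫ (cofreeIso k h).inv, fun h₀ => hq ?_⟩
  rw [← pairHom_eq_zero_iff h, ← pairHom_comp, hp, ← cancel_mono (cofreeIso k h).inv, zero_comp,
    ← h₀]
  simp only [Category.assoc]

/-- Choose `g'` with `ε ≫ g ≫ g' ≠ 0`. Then `g ≫ g'` is not a multiple of `ε`, whose square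
vanishes, so it is invertible. -/
theorem exists_retraction (h : a ≤ b) {X : D (polyDGA k 1)} (g : stdObj k a b ⟶ X)
    (hg : stdEps k (by omega) ≫ g ≠ 0) : ∃ g' : X ⟶ stdObj k a b, g ≫ g' = 𝟙 _ := by
  obtain ⟨g', h'⟩ := exists_comp_ne_zero (by omega) _ hg
  rcases (isDual_stdEps h).isIso_or (g ≫ g') with H | ⟨s, hs⟩
  · exact ⟨g' ≫ inv (g ≫ g'), by rw [← Category.assoc, IsIso.hom_inv_id]⟩
  · refine absurd ?_ h'
    rw [Category.assoc, hs, Linear.comp_smul, (isDual_stdEps h).sq_zero, smul_zero]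

variable (k) in
/-- The inclusion of an interval into the interval that is longer by one at the left end. -/
noncomputable def stdUp (i b : ℤ) (h : i ≤ b) : stdObj k (i + 1) b ⟶ stdObj k i b :=
  pairHom (by omega) _ ⟨((freeCone k i b).T i (i + 1) (genE k i b), genF k i b), by
    rw [d_T, d_genE, map_zero, smul_zero], by
    rw [d_genF (by omega), T_T _ (by omega) (by omega)]⟩

variable (k) in
/-- The projection of an interval onto the interval that is shorter by one at the right end. -/
noncomputable def stdDown (a j : ℤ) (h : a ≤ j + 1) : stdObj k a (j + 1) ⟶ stdObj k a j :=
  -- The minus sign compensates `d T = -T d`.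
  pairHom (by omega) _ ⟨(genE k a j, -(freeCone k a j).T j (j + 1) (genF k a j)), d_genE, by
    rw [map_neg, d_T, d_genF h, T_T _ h (by omega)]
    simp⟩

theorem stdUp_comp {i : ℤ} (h : i ≤ b) (p : cyclePairs i b M) (q : cyclePairs (i + 1) b M)
    (h₁ : q.1.1 = M.T i (i + 1) p.1.1) (h₂ : q.1.2 = p.1.2) :
    stdUp k i b h ≫ pairHom (by omega) M p = pairHom (by omega) M q := by
  rw [stdUp, pairHom_pairHom]
  congr 1
  refine Subtype.ext (Prod.ext ?_ ?_)
  · rw [h₁, mapPair_fst, map_T, freeDesc_genE]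
  · rw [h₂, mapPair_snd, freeDesc_genF]

theorem stdDown_comp {j : ℤ} (h : a ≤ j + 1) (p : cyclePairs a j M) (q : cyclePairs a (j + 1) M)
    (h₁ : q.1.1 = p.1.1) (h₂ : q.1.2 = -M.T j (j + 1) p.1.2) :
    stdDown k a j h ≫ pairHom h M p = pairHom (by omega) M q := by
  rw [stdDown, pairHom_pairHom]
  congr 1
  refine Subtype.ext (Prod.ext ?_ ?_)
  · rw [h₁, mapPair_fst, freeDesc_genE]
  · rw [h₂, mapPair_snd, map_neg, map_T, freeDesc_genF]

theorem stdUp_ne_zero {i : ℤ} (h : i + 1 ≤ b) : stdUp k i b (by omega) ≠ 0 := by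
  intro h₀
  have := congrArg (· ≫ (toD _).map (resolution k i b)) h₀
  simp only [stdUp, pairHom_comp, zero_comp] at this
  rw [pairHom_eq_zero_iff, interval_mem_boundaryPairs_iff (by omega)] at this
  have := congrArg (ivVal _ (i + 1)) this.1
  rw [mapPair_fst, map_T, ivVal_T (by simp; omega) (by omega), ivVal_resolution_genE (by omega),
    map_zero] at this
  exact one_ne_zero this

theorem stdDown_ne_zero {j : ℤ} (h : a ≤ j) : stdDown k a j (by omega) ≠ 0 := by
  intro h₀
  have := congrArg (· ≫ (toD _).map (resolution k a j)) h₀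
  simp only [stdDown, pairHom_comp, zero_comp] at this
  rw [pairHom_eq_zero_iff, interval_mem_boundaryPairs_iff (by omega)] at this
  have := congrArg (ivVal _ a) this.1
  rw [mapPair_fst, ivVal_resolution_genE h, map_zero] at this
  exact one_ne_zero this

theorem dl_eq_zero {i j : ℤ} (h : i + 1 = j) {x : M.X i} (hx : M.d i x = 0) :
    M.dl i j h x = 0 := by
  subst h; exact hx

theorem stdEps_stdUp {i : ℤ} (h : i + 1 ≤ b) :
    stdEps k (by omega : i + 1 ≤ b + 1) ≫ stdUp k i b (by omega) = 0 := by
  rw [stdUp, stdEps_comp, pairHom_eq_zero_iff, soclePair_eq_zero_iff rfl (sub_add_cancel b 1)]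
  -- The image of the socle is `T ^ (b - i) e` in the longer interval, and there `e` itself, of
  -- degree `i`, serves as `z`.
  refine ⟨genE k i b, 0, dl_eq_zero _ d_genE, ?_⟩
  rw [map_zero, zero_add, T_T _ (by omega) h]

theorem stdEps_stdDown {j : ℤ} (h : a ≤ j + 1) :
    stdEps k (by omega : a ≤ j + 1 + 1) ≫ stdDown k a j h = 0 := by
  rw [stdDown, stdEps_comp, pairHom_eq_zero_iff, soclePair_eq_zero_iff (sub_add_cancel a 1) rfl]
  -- In the shorter interval the socle element `T ^ (j + 1 - a) e` is the boundary of `f`.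
  exact ⟨0, genF k a j, map_zero _, by rw [map_zero, add_zero]; exact d_genF h⟩

/-- Morphisms that kill `ε` factor through the two neighbours. -/
theorem exists_eq_stdUp_add_stdDown {i j : ℤ} (h : i + 1 ≤ j + 1) {X : D (polyDGA k 1)}
    (g : stdObj k (i + 1) (j + 1) ⟶ X)
    (hg : stdEps k (by omega : i + 1 ≤ j + 1 + 1) ≫ g = 0) :
    ∃ (g₁ : stdObj k i (j + 1) ⟶ X) (g₂ : stdObj k (i + 1) j ⟶ X),
      g = stdUp k i (j + 1) (by omega) ≫ g₁ + stdDown k (i + 1) j h ≫ g₂ := by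
  obtain ⟨M, ⟨e⟩⟩ := exists_toD_obj X
  suffices H : ∀ p : cyclePairs (i + 1) (j + 1) M,
      stdEps k (by omega : i + 1 ≤ j + 1 + 1) ≫ pairHom (by omega) M p = 0 →
      ∃ (g₁ : stdObj k i (j + 1) ⟶ (toD _).obj M) (g₂ : stdObj k (i + 1) j ⟶ (toD _).obj M),
        pairHom (by omega) M p =
          stdUp k i (j + 1) (by omega) ≫ g₁ + stdDown k (i + 1) j h ≫ g₂ by
    obtain ⟨p, hp⟩ := pairHom_surjective (by omega) (g ≫ e.inv)
    obtain ⟨g₁, g₂, h₁⟩ := H p (by rw [hp, ← Category.assoc, hg, zero_comp])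
    refine ⟨g₁ ≫ e.hom, g₂ ≫ e.hom, ?_⟩
    rw [← Category.assoc, ← Category.assoc, ← Preadditive.add_comp, ← h₁, hp, Category.assoc,
      e.inv_hom_id, Category.comp_id]
  intro p hp
  rw [stdEps_comp, pairHom_eq_zero_iff, soclePair_eq_zero_iff rfl rfl] at hp
  obtain ⟨z, w, hz, hw⟩ := hp
  change M.d i z = 0 at hz
  change M.d j w + _ = _ at hw
  obtain ⟨⟨x, y⟩, hx, hy⟩ := p
  change M.d (i + 1) x = 0 at hx
  change M.d (j + 1) y = M.T (i + 1) (j + 1 + 1) x at hy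
  change _ = M.T (i + 1) (j + 1) x at hw
  have hTz : M.d (i + 1) (M.T i (i + 1) z) = 0 := by rw [d_T, hz, map_zero, smul_zero]
  have hTw : M.d (j + 1) (M.T j (j + 1) w) = -M.T (j + 1) (j + 1 + 1) (M.d j w) := by
    rw [d_T]; simp
  -- The condition `T ^ (j - i) x = d w + T ^ (j + 1 - i) z` suggests the splitting `(x, y) = (T z,
  -- y + T w) + (x - T z, -T w)`. The first summand comes from the pair `(z, y + T w)` on `[i, j +
  -- 1]`, the second from `(x - T z, w)` on `[i + 1, j]`.
  let p₁ : cyclePairs i (j + 1) M := ⟨(z, y + M.T j (j + 1) w), hz, by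
    rw [map_add, hy, hTw, eq_sub_of_add_eq hw, map_sub, T_T M h (by omega),
      T_T M (by omega) (by omega)]
    abel⟩
  let p₂ : cyclePairs (i + 1) j M := ⟨(x - M.T i (i + 1) z, w), by rw [map_sub, hx, hTz, sub_zero],
    by rw [map_sub, T_T M (by omega) h, ← hw, add_sub_cancel_right]⟩
  let q₁ : cyclePairs (i + 1) (j + 1) M := ⟨(M.T i (i + 1) z, y + M.T j (j + 1) w), hTz, by
    rw [p₁.2.2, T_T M (by omega) (by omega)]⟩
  let q₂ : cyclePairs (i + 1) (j + 1) M := ⟨(x - M.T i (i + 1) z, -M.T j (j + 1) w), p₂.2.1, by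
    rw [map_neg, hTw, neg_neg, eq_sub_of_add_eq hw, map_sub, map_sub, T_T M h (by omega),
      T_T M (by omega) (by omega), T_T M (by omega) (by omega)]⟩
  refine ⟨pairHom (by omega) M p₁, pairHom (by omega) M p₂, ?_⟩
  rw [stdUp_comp (by omega) p₁ q₁ rfl rfl, stdDown_comp h p₂ q₂ rfl rfl, ← map_add]
  congr 1
  refine Subtype.ext (Prod.ext ?_ ?_)
  · exact (add_sub_cancel _ _).symm
  · exact (add_neg_cancel_right _ _).symm

end StandardObjects

/-! ### Objects of `⟨k⟩` have cohomology killed by a power of `T`. -/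

section Torsion

variable {k : Type u} [Field k]

/-- Some power of `T` annihilates the cohomology of `M`. -/
def IsTorsion (M : DGModule (polyDGA k 1)) : Prop :=
  ∃ n : ℕ, ∀ a b : ℤ, a + n ≤ b → ∀ x : M.X a, M.d a x = 0 → M.T a b x ∈ M.bdry b

theorem d_T_eq_zero {M : DGModule (polyDGA k 1)} {a : ℤ} (b : ℤ) {x : M.X a} (hx : M.d a x = 0) :
    M.d b (M.T a b x) = 0 := by
  rw [d_T, hx, map_zero, smul_zero]

/-- Torsion passes to the middle term of a sequence that is exact in cohomology. -/
theorem IsTorsion.of_exact {M N L : DGModule (polyDGA k 1)} (hM : IsTorsion M) (hL : IsTorsion L)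
    (f : M ⟶ N) (g : N ⟶ L) (H : ∀ j (y : N.X j), N.d j y = 0 → g.f j y ∈ L.bdry j →
      ∃ x, M.d j x = 0 ∧ y - f.f j x ∈ N.bdry j) : IsTorsion N := by
  obtain ⟨m, hm⟩ := hM
  obtain ⟨n, hn⟩ := hL
  refine ⟨m + n, fun a b hab y hy => ?_⟩
  push_cast at hab
  obtain ⟨x, hx, hb⟩ := H (b - m) (N.T a (b - m) y) (d_T_eq_zero _ hy) (by
    rw [map_T]
    exact hn a _ (by omega) _ (by rw [← g.comm_d, hy, map_zero]))
  have h₁ := T_mem_bdry N _ b hb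
  rw [map_sub, T_T N (by omega) (by omega), ← map_T] at h₁
  have := add_mem h₁ (map_mem_bdry f (hm _ b (by omega) x hx))
  rwa [sub_add_cancel] at this

theorem IsTorsion.of_quasiIso {M N : DGModule (polyDGA k 1)} {s : M ⟶ N} (hs : IsQuasiIso s)
    (hM : IsTorsion M) : IsTorsion N := by
  obtain ⟨n, hn⟩ := hM
  refine ⟨n, fun a b hab y hy => ?_⟩
  obtain ⟨x, hx, hb⟩ := hs.exists_cycle hy
  have := sub_mem (map_mem_bdry s (hn a b hab x hx)) (T_mem_bdry N a b hb)
  rwa [map_T, ← map_sub, sub_sub_cancel] at this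

/-- A section in the derived category is represented by a map `f` to a module quasi-isomorphic to
`N` such that some `f ≫ g` is a quasi-isomorphism. Hence `f` is injective on cohomology and the
exponent for `N` also works for `M`. -/
theorem IsTorsion.of_retract {M N : DGModule (polyDGA k 1)}
    (r : Retract ((toD _).obj M) ((toD _).obj N)) (hN : IsTorsion N) : IsTorsion M := by
  obtain ⟨N', f, s, hs, e⟩ := exists_fraction r.i
  have := isIso_toD_map hs
  obtain ⟨M', g, t, hg, -, -⟩ := exists_quasiIso_comp f (φ := inv ((toD _).map s) ≫ r.r)
    (isQuasiIso_id M) (by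
      rw [← e, Category.assoc, IsIso.hom_inv_id_assoc, r.retract, CategoryTheory.Functor.map_id])
  obtain ⟨n, hn⟩ := hN.of_quasiIso hs
  refine ⟨n, fun a b hab x hx => hg.mem_bdry_of_comp (d_T_eq_zero _ hx) ?_⟩
  rw [map_T]
  exact hn a _ hab _ (by rw [← f.comm_d, hx, map_zero])

theorem shift_T (M : DGModule (polyDGA k 1)) (j l : ℤ) (x : M.X (j + 1)) :
    (shift M).T j l x = (l - j).negOnePow • M.T (j + 1) (l + 1) x := by
  by_cases hl : j ≤ l
  · change (l - j).negOnePow • M.act (l - j) (j + 1) (l + 1) _ (mono (l - j)) x = _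
    rw [act_eq, leadCoeff_mono (by omega), one_smul]
  · rw [T_of_lt M (by omega), smul_zero]
    exact T_of_lt (shift M) (by omega) x

theorem mem_bdry_shift {M : DGModule (polyDGA k 1)} {j : ℤ} {x : M.X (j + 1)} :
    (show (shift M).X j from x) ∈ (shift M).bdry j ↔ x ∈ M.bdry (j + 1) := by
  obtain ⟨i, rfl⟩ : ∃ i, j = i + 1 := ⟨j - 1, by omega⟩
  constructor
  · intro hx
    obtain ⟨z, hz⟩ := exists_of_mem_bdry (i := i) rfl hx
    change -M.d (i + 1) z = x at hz
    rw [← hz]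
    exact neg_mem (d_mem_bdry M z)
  · intro hx
    obtain ⟨z, hz⟩ := exists_of_mem_bdry (i := i + 1) rfl hx
    change M.d (i + 1) z = x at hz
    have := neg_mem (d_mem_bdry (shift M) (i := i) z)
    convert this using 1
    change x = - -M.d (i + 1) z
    rw [neg_neg, hz]

theorem isTorsion_shift_iff (M : DGModule (polyDGA k 1)) : IsTorsion (shift M) ↔ IsTorsion M := by
  constructor
  · rintro ⟨n, hn⟩
    refine ⟨n, fun a b hab x hx => ?_⟩
    obtain ⟨a, rfl⟩ : ∃ i, a = i + 1 := ⟨a - 1, by omega⟩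
    obtain ⟨b, rfl⟩ : ∃ i, b = i + 1 := ⟨b - 1, by omega⟩
    have := hn a b (by omega) x (by
      change -M.d (a + 1) x = 0
      rw [hx, neg_zero])
    rw [shift_T] at this
    have := units_smul_mem _ (b - a).negOnePow (mem_bdry_shift.1 this)
    rwa [smul_smul, negOnePow_mul_eq (c := 0) (by omega), Int.negOnePow_zero, one_smul] at this
  · rintro ⟨n, hn⟩
    refine ⟨n, fun a b hab x hx => ?_⟩
    refine (congrArg (· ∈ (shift M).bdry b) (shift_T M a b x)).mpr ?_
    exact mem_bdry_shift.2 (units_smul_mem _ _ (hn (a + 1) (b + 1) (by omega) x (neg_eq_zero.1 hx)))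

/-- The projection of a mapping cone onto the suspension. -/
def coneToShift {M N : DGModule (polyDGA k 1)} (g : M ⟶ N) : cone g ⟶ shift M where
  f j := coneFst g j
  comm_d _ _ := rfl
  comm_act _ _ _ _ _ _ := rfl

theorem isTorsion_cone {M N : DGModule (polyDGA k 1)} (g : M ⟶ N) (hM : IsTorsion M)
    (hN : IsTorsion N) : IsTorsion (cone g) := by
  refine hN.of_exact ((isTorsion_shift_iff M).2 hM) (coneInr g) (coneToShift g) ?_
  rintro j ⟨x, y⟩ hxy hb
  obtain ⟨i, rfl⟩ : ∃ i, j = i + 1 := ⟨j - 1, by omega⟩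
  obtain ⟨z, hz⟩ : ∃ z : M.X (i + 1), -M.d (i + 1) z = x := exists_of_mem_bdry (i := i) rfl hb
  have e₂ : g.f (i + 1 + 1) x + N.d (i + 1) y = 0 := congrArg Prod.snd hxy
  refine ⟨y - g.f (i + 1) z, ?_, ?_⟩
  · rw [map_sub, ← g.comm_d, ← e₂, ← hz, map_neg]
    abel
  · have := d_mem_bdry (cone g) (i := i) (z, 0)
    convert this using 1
    refine Prod.ext ?_ ?_
    · change x - 0 = -M.d (i + 1) z
      rw [hz, sub_zero]
    · change y - (y - g.f (i + 1) z) = g.f (i + 1) z + N.d i 0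
      rw [map_zero, add_zero, sub_sub_cancel]

theorem isTorsion_of_cone₂ {M N : DGModule (polyDGA k 1)} (g : M ⟶ N) (hM : IsTorsion M)
    (hC : IsTorsion (cone g)) : IsTorsion N := by
  refine hM.of_exact hC g (coneInr g) fun j y hy hb => ?_
  obtain ⟨i, rfl⟩ : ∃ i, j = i + 1 := ⟨j - 1, by omega⟩
  obtain ⟨⟨z, w⟩, hz⟩ := exists_of_mem_bdry (i := i) rfl hb
  have e₁ : -M.d (i + 1) z = 0 := congrArg Prod.fst hz
  have e₂ : g.f (i + 1) z + N.d i w = y := congrArg Prod.snd hz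
  exact ⟨z, neg_eq_zero.1 e₁, by rw [← e₂, add_sub_cancel_left]; exact d_mem_bdry _ _⟩

theorem isTorsion_of_cone₁ {M N : DGModule (polyDGA k 1)} (g : M ⟶ N) (hN : IsTorsion N)
    (hC : IsTorsion (cone g)) : IsTorsion M := by
  obtain ⟨m, hm⟩ := hN
  obtain ⟨n, hn⟩ := hC
  refine ⟨m + n, fun a b hab x hx => ?_⟩
  push_cast at hab
  obtain ⟨b, rfl⟩ : ∃ i, b = i + 1 := ⟨b - 1, by omega⟩
  -- After `m` steps `g x` is bounded by some `y`, so `(T ^ _ x, -y)` is a cycle of the cone. A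
  -- further `n` steps make it a boundary, and its first component is then a boundary in `M`.
  obtain ⟨y, hy⟩ := exists_of_mem_bdry (i := b - n) rfl
    (hm a (b - n + 1) (by omega) (g.f a x) (by rw [← g.comm_d, hx, map_zero]))
  change N.d (b - n) y = _ at hy
  have hb := hn (b - n) b (by omega) (coneMk g (M.T a (b - n + 1) x) (-y)) (Prod.ext (by
    change -M.d _ (M.T a (b - n + 1) x) = 0
    rw [d_T_eq_zero _ hx, neg_zero]) (by
    change g.f _ (M.T a (b - n + 1) x) + N.d _ (-y) = 0
    rw [map_neg, hy, map_T, add_neg_cancel]))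
  obtain ⟨i, rfl⟩ : ∃ i, b = i + 1 := ⟨b - 1, by omega⟩
  obtain ⟨z, hz⟩ := exists_of_mem_bdry (i := i) rfl hb
  have e := congrArg (coneFst g (i + 1)) hz
  change -M.d (i + 1) (coneFst g i z) = _ at e
  rw [coneFst_T, coneFst_mk, T_T M (by omega) (by omega), eq_comm, ← eq_inv_smul_iff] at e
  rw [e]
  exact units_smul_mem _ _ (neg_mem (d_mem_bdry M _))

/-- Quantifying over all models makes torsion a property of objects of the derived category;
invariance under retracts shows that a single model suffices. -/
theorem isThick_isTorsion : IsThick fun X : D (polyDGA k 1) =>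
    ∀ M, Nonempty ((toD _).obj M ≅ X) → IsTorsion M := by
  have key : ∀ M : DGModule (polyDGA k 1),
      (∀ N, Nonempty ((toD _).obj N ≅ (toD _).obj M) → IsTorsion N) ↔ IsTorsion M := fun M =>
    ⟨fun h => h M ⟨Iso.refl _⟩, fun hM N ⟨e⟩ => hM.of_retract e.retract⟩
  refine ⟨fun X Y r hY M ⟨e⟩ => ?_, fun M => ?_, fun M N g h₁ h₂ => ?_, fun M N g h₁ h₂ => ?_,
    fun M N g h₁ h₂ => ?_⟩
  · obtain ⟨N, ⟨e'⟩⟩ := exists_toD_obj Y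
    exact (hY N ⟨e'⟩).of_retract ((e.retract.trans r).trans e'.symm.retract)
  · rw [key, key, isTorsion_shift_iff]
  · rw [key] at *
    exact isTorsion_of_cone₁ g h₁ h₂
  · rw [key] at *
    exact isTorsion_of_cone₂ g h₁ h₂
  · rw [key] at *
    exact isTorsion_cone g h₁ h₂

theorem trivialModule_T {a b : ℤ} (h : a < b) (x : (trivialModule k 1).X a) :
    (trivialModule k 1).T a b x = 0 := by
  refine Subtype.ext ?_
  change (mono (k := k) (b - a)).1.coeff 0 * x.1 = 0
  have : (mono (k := k) (b - a)).1.coeff 0 = 0 := by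
    by_contra hn
    have := (mono (k := k) (b - a)).2 0 hn
    simp at this
    omega
  rw [this, zero_mul]

theorem isTorsion_trivialModule : IsTorsion (trivialModule k 1) := by
  refine ⟨1, fun a b hab x _ => ?_⟩
  rw [trivialModule_T (by omega)]
  exact zero_mem _

theorem isTorsion_of_thickGeneratedBy {M : DGModule (polyDGA k 1)}
    (hM : thickGeneratedBy (trivialModule k 1) ((toD _).obj M)) : IsTorsion M :=
  hM _ isThick_isTorsion (fun _ ⟨e⟩ => isTorsion_trivialModule.of_retract e.retract) M
    ⟨Iso.refl _⟩

end Torsion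

/-! ### Interval objects lie in `⟨k⟩`. -/

section Generation

variable {k : Type u} [Field k]

theorem isThick_thickGeneratedBy {A : DGAlgebra k} (S : DGModule A) :
    IsThick (thickGeneratedBy S) where
  of_retract X Y r hY P hP hS := hP.of_retract X Y r (hY P hP hS)
  shift_iff M := ⟨fun h P hP hS => (hP.shift_iff M).1 (h P hP hS),
    fun h P hP hS => (hP.shift_iff M).2 (h P hP hS)⟩
  of_cone₁ M N g h₁ h₂ P hP hS := hP.of_cone₁ M N g (h₁ P hP hS) (h₂ P hP hS)
  of_cone₂ M N g h₁ h₂ P hP hS := hP.of_cone₂ M N g (h₁ P hP hS) (h₂ P hP hS)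
  of_cone₃ M N g h₁ h₂ P hP hS := hP.of_cone₃ M N g (h₁ P hP hS) (h₂ P hP hS)

theorem IsThick.of_iso {A : DGAlgebra k} {P : ObjectProperty (D A)} (hP : IsThick P) {X Y : D A}
    (e : X ≅ Y) (hY : P Y) : P X := hP.of_retract X Y e.retract hY

theorem IsThick.of_quasiIso {A : DGAlgebra k} {P : ObjectProperty (D A)} (hP : IsThick P)
    {M N : DGModule A} {s : M ⟶ N} (hs : IsQuasiIso s) :
    P ((toD A).obj M) ↔ P ((toD A).obj N) := by
  have := isIso_toD_map hs
  exact ⟨hP.of_iso (asIso ((toD A).map s)).symm, hP.of_iso (asIso ((toD A).map s))⟩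

theorem isQuasiIso_of_bijective {A : DGAlgebra k} {M N : DGModule A} (g : M ⟶ N)
    (hg : ∀ j, Function.Bijective (g.f j)) : IsQuasiIso g where
  inj i x _ := by
    rintro ⟨y, hy⟩
    obtain ⟨z, rfl⟩ := (hg i).2 y
    exact ⟨z, (hg _).1 (by rw [g.comm_d, hy])⟩
  surj i y hy := by
    obtain ⟨x, rfl⟩ := (hg _).2 y
    exact ⟨x, (hg _).1 (by rw [g.comm_d, hy, map_zero]), 0, by rw [map_zero, add_zero]⟩

theorem ivMk_ivVal {s : Set ℤ} [s.OrdConnected] {j : ℤ} (x : (intervalModule k s).X j) :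
    ivMk s j (ivVal s j x) = x := by
  refine iv_ext ?_
  by_cases h : j ∈ s
  · rw [ivVal_ivMk h]
  · rw [ivVal_eq_zero h, ivVal_eq_zero h]

theorem Icc_self_T {a j l : ℤ} (h : j < l) (x : (intervalModule k (Set.Icc a a)).X j) :
    (intervalModule k (Set.Icc a a)).T j l x = 0 := by
  refine iv_ext ?_
  rw [map_zero]
  by_cases hl : l ∈ Set.Icc a a
  · rw [ivVal_T hl h.le, ivVal_eq_zero (by simp at *; omega)]
  · rw [ivVal_eq_zero hl]

variable (k) in
/-- The trivial DG module as an interval module. -/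
noncomputable def trivialToInterval : trivialModule k 1 ⟶ intervalModule k (Set.Icc 0 0) :=
  homMk (fun j => (ivMk _ j).comp (trivialPart k j).subtype)
    (fun j _ => ((ivMk _ (j + 1)).comp (trivialPart k (j + 1)).subtype).map_zero)
    fun j l hl x => by
      rcases hl.eq_or_lt with rfl | hl
      · rw [T_self, T_self]
      · rw [Icc_self_T hl, trivialModule_T hl]
        exact map_zero _

theorem isQuasiIso_trivialToInterval : IsQuasiIso (trivialToInterval k) := by
  refine isQuasiIso_of_bijective _ fun j => ⟨?_, fun y => ?_⟩
  · rw [injective_iff_map_eq_zero]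
    intro x hx
    refine Subtype.ext ?_
    by_cases hj : j = 0
    · have := congrArg (ivVal _ j) hx
      change ivVal _ j (ivMk _ j x.1) = _ at this
      rwa [ivVal_ivMk (by simp [hj]), map_zero] at this
    · exact x.2 hj
  · exact ⟨⟨ivVal _ j y, fun hj => ivVal_eq_zero (by simp; omega) y⟩, ivMk_ivVal y⟩

variable (k) in
/-- The suspension of a one-point interval module. -/
noncomputable def shiftToInterval (a : ℤ) :
    shift (intervalModule k (Set.Icc (a + 1) (a + 1))) ⟶ intervalModule k (Set.Icc a a) :=
  homMk (M := shift (intervalModule k (Set.Icc (a + 1) (a + 1))))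
    (fun j => (ivMk _ j).comp (ivVal (Set.Icc (a + 1) (a + 1)) (j + 1)))
    (fun j x => by
      change ((ivMk _ (j + 1)).comp (ivVal (Set.Icc (a + 1) (a + 1)) (j + 1 + 1))) (-0) = 0
      rw [neg_zero, map_zero])
    fun j l hl x => by
      rcases hl.eq_or_lt with rfl | hl
      · rw [T_self, T_self]
      · rw [Icc_self_T hl]
        refine (congrArg ((ivMk (Set.Icc a a) l).comp (ivVal (Set.Icc (a + 1) (a + 1)) (l + 1)))
          ((shift_T _ j l x).trans ?_)).trans (map_zero _)
        exact (congrArg _ (Icc_self_T (a := a + 1) (by omega) x)).trans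
          (smul_zero (M := ℤˣ) (A := (intervalModule k (Set.Icc (a + 1) (a + 1))).X (l + 1)) _)

theorem isQuasiIso_shiftToInterval (a : ℤ) : IsQuasiIso (shiftToInterval k a) := by
  refine isQuasiIso_of_bijective _ fun j => ⟨?_, fun y => ?_⟩
  · rw [injective_iff_map_eq_zero]
    intro x hx
    change (intervalModule k (Set.Icc (a + 1) (a + 1))).X (j + 1) at x
    refine iv_ext (s := Set.Icc (a + 1) (a + 1)) (j := j + 1) ?_
    change ivVal _ (j + 1) x = ivVal _ (j + 1) 0
    rw [map_zero]
    by_cases hj : j = a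
    · have := congrArg (ivVal _ j) hx
      change ivVal _ j (ivMk _ j (ivVal (Set.Icc (a + 1) (a + 1)) (j + 1) x)) = _ at this
      rwa [ivVal_ivMk (by simp [hj]), map_zero] at this
    · rw [ivVal_eq_zero (by simp; omega)]
  · refine ⟨(ivMk _ (j + 1) (ivVal _ j y) : (intervalModule k (Set.Icc (a + 1) (a + 1))).X (j + 1)),
      iv_ext ?_⟩
    change ivVal _ j (ivMk _ j (ivVal _ (j + 1) (ivMk (Set.Icc (a + 1) (a + 1)) (j + 1) _))) = _
    by_cases hj : j = a
    · rw [ivVal_ivMk (by simp [hj]), ivVal_ivMk (by simp [hj])]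
    · rw [ivVal_eq_zero (by simp; omega), ivVal_eq_zero (by simp; omega)]

theorem intervalModule_point_mem {P : ObjectProperty (D (polyDGA k 1))} (hP : IsThick P)
    (h : P ((toD _).obj (trivialModule k 1))) (a : ℤ) :
    P ((toD _).obj (intervalModule k (Set.Icc a a))) := by
  have key : ∀ b : ℤ, P ((toD _).obj (intervalModule k (Set.Icc (b + 1) (b + 1)))) ↔
      P ((toD _).obj (intervalModule k (Set.Icc b b))) := fun b => by
    rw [← hP.shift_iff, hP.of_quasiIso (isQuasiIso_shiftToInterval b)]
  induction a using Int.induction_on with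
  | zero => exact (hP.of_quasiIso isQuasiIso_trivialToInterval).1 h
  | succ i ih => exact (key _).2 ih
  | pred i ih => exact (key _).1 (by rwa [sub_add_cancel])

/-- Induction on the length: since `T` raises degrees, the upper part `[a + 1, a + 1 + n]` is a
submodule of `[a, a + n + 1]`, with quotient the point `[a, a]`, a suspension or desuspension of
`k`. -/
theorem intervalModule_mem {P : ObjectProperty (D (polyDGA k 1))} (hP : IsThick P)
    (h : P ((toD _).obj (trivialModule k 1))) (n : ℕ) :
    ∀ a : ℤ, P ((toD _).obj (intervalModule k (Set.Icc a (a + n)))) := by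
  induction n with
  | zero =>
    intro a
    simpa using intervalModule_point_mem hP h a
  | succ n ih =>
    intro a
    let f : intervalModule k (Set.Icc (a + 1) (a + 1 + n)) ⟶
        intervalModule k (Set.Icc a (a + (n + 1 : ℕ))) :=
      ivHom _ _ fun j l _ h₁ h₂ => by simp at *; omega
    let g : intervalModule k (Set.Icc a (a + (n + 1 : ℕ))) ⟶ intervalModule k (Set.Icc a a) :=
      ivHom _ _ fun j l _ h₁ h₂ => by simp at *; omega
    have hfg : f ≫ g = 0 := hom_ext fun j x => iv_ext (by
      change ivVal _ j (ivMk _ j (ivVal _ j (ivMk _ j (ivVal _ j x)))) = ivVal _ j 0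
      rw [map_zero]
      by_cases hj : j ∈ Set.Icc a a
      · rw [ivVal_eq_zero (by simp at *; omega) x]
        simp
      · rw [ivVal_eq_zero hj])
    have hq : IsQuasiIso (coneDesc f g hfg) := by
      refine isQuasiIso_coneDesc _ _ _ (fun j => ?_) (fun j x => ?_) fun j x hx => ?_
      · rw [injective_iff_map_eq_zero]
        intro x hx
        refine iv_ext ?_
        rw [map_zero]
        by_cases hj : j ∈ Set.Icc (a + 1) (a + 1 + n)
        · have := congrArg (ivVal _ j) hx
          rwa [ivHom_f, map_zero, ivVal_ivMk (by simp at *; omega)] at this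
        · exact ivVal_eq_zero hj x
      · refine ⟨ivMk _ j (ivVal _ j x), iv_ext ?_⟩
        rw [ivHom_f]
        by_cases hj : j ∈ Set.Icc a a
        · rw [ivVal_ivMk hj, ivVal_ivMk (by simp at *; omega)]
        · rw [ivVal_eq_zero hj, ivVal_eq_zero hj]
      · refine ⟨ivMk _ j (ivVal _ j x), iv_ext ?_⟩
        rw [ivHom_f]
        by_cases hj : j ∈ Set.Icc a (a + (n + 1 : ℕ))
        · rw [ivVal_ivMk hj]
          by_cases ha : j = a
          · have := congrArg (ivVal _ j) hx
            rw [ivHom_f, map_zero, ivVal_ivMk (by simp [ha])] at this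
            rw [this]
            simp
          · rw [ivVal_ivMk (by simp at *; omega)]
        · rw [ivVal_eq_zero hj, ivVal_eq_zero hj]
    exact hP.of_cone₂ _ _ f (ih _) ((hP.of_quasiIso hq).2 (intervalModule_point_mem hP h a))

theorem stdObj_mem {a b : ℤ} (h : a ≤ b) :
    thickGeneratedBy (trivialModule k 1) (stdObj k a b) := by
  have := isThick_thickGeneratedBy (trivialModule k 1)
  refine this.of_iso (resolutionIso k a b) ?_
  obtain ⟨n, rfl⟩ : ∃ n : ℕ, b = a + n := ⟨(b - a).toNat, by omega⟩
  exact intervalModule_mem this (fun _ _ h => h) n a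

end Generation

/-! ### Invariance of arrows and rigidity of the quiver `ℤA∞`. -/

section Irreducible

universe v' u'

variable {C : Type u'} [Category.{v'} C] [Preadditive C]

theorem IsIndecomposable.of_iso {X Y : C} (e : X ≅ Y) (h : IsIndecomposable X) :
    IsIndecomposable Y :=
  ⟨fun hY => h.1 (hY.of_iso e), fun Z W b hb ⟨e'⟩ => h.2 Z W b hb ⟨e' ≪≫ e.symm⟩⟩

omit [Preadditive C] in
theorem IsIrreducible.of_iso {X Y X' Y' : C} {f : X ⟶ Y} (h : IsIrreducible f) (e : X ≅ X')
    (e' : Y ≅ Y') : IsIrreducible (e.inv ≫ f ≫ e'.hom) where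
  not_splitMono := fun ⟨⟨s⟩⟩ => h.not_splitMono ⟨⟨⟨e'.hom ≫ s.retraction ≫ e.inv, by
    have := s.id
    rw [← cancel_epi e.inv, ← cancel_mono e.hom]
    simpa only [Category.assoc, Iso.inv_hom_id, Category.comp_id, Category.id_comp] using this⟩⟩⟩
  not_splitEpi := fun ⟨⟨s⟩⟩ => h.not_splitEpi ⟨⟨⟨e'.hom ≫ s.section_ ≫ e.inv, by
    have := s.id
    rw [← cancel_epi e'.inv, ← cancel_mono e'.hom]
    simpa only [Category.assoc, Iso.inv_hom_id, Iso.inv_hom_id_assoc, Category.comp_id,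
      Category.id_comp] using this⟩⟩⟩
  factor Z g g' hg := by
    refine (h.factor Z (e.hom ≫ g) (g' ≫ e'.inv) ?_).imp (fun ⟨⟨s⟩⟩ => ?_) fun ⟨⟨s⟩⟩ => ?_
    · rw [Category.assoc, ← Category.assoc g, hg]
      simp
    · refine ⟨⟨⟨s.retraction ≫ e.hom, ?_⟩⟩⟩
      have := s.id
      rw [← cancel_epi e.hom, ← Category.assoc, ← Category.assoc, this]
      simp
    · refine ⟨⟨⟨e'.inv ≫ s.section_, ?_⟩⟩⟩
      have := s.id
      rw [← cancel_mono e'.inv, Category.assoc, Category.assoc, this]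
      simp

theorem ARArrow.of_iso {X Y X' Y' : C} (h : ARArrow X Y) (e : X ≅ X') (e' : Y ≅ Y') :
    ARArrow X' Y' := by
  obtain ⟨hX, hY, f, hf⟩ := h
  exact ⟨hX.of_iso e, hY.of_iso e', _, hf.of_iso e e'⟩

/-- Self-embeddings of the quiver `ℤA∞` that are full and closed under successors are
translations. -/
theorem exists_translation (N : ℤ → ℕ → ℤ) (R : ℤ → ℕ → ℕ)
    (inj : ∀ n r m s, N n r = N m s → R n r = R m s → n = m ∧ r = s)
    (arr : ∀ n r m s, ZAArrow (N n r) (R n r) (N m s) (R m s) ↔ ZAArrow n r m s)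
    (closed : ∀ n r m' s', ZAArrow (N n r) (R n r) m' s' → ∃ m s, N m s = m' ∧ R m s = s') :
    ∃ c, ∀ n r, N n r = n + c ∧ R n r = r := by
  have succ_zero : ∀ n m s, ZAArrow n 0 m s ↔ m = n ∧ s = 1 := fun n m s => by
    unfold ZAArrow; omega
  -- The vertex `(n, 0)` has one successor, while a vertex off the base line has two, with different
  -- first coordinates. Closure under successors therefore keeps the base line on the base line.
  have h₀ : ∀ n, R n 0 = 0 := by
    intro n
    by_contra hR
    have key : ∀ m' s', ZAArrow (N n 0) (R n 0) m' s' → m' = N n 1 := by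
      intro m' s' h
      obtain ⟨m, s, rfl, rfl⟩ := closed n 0 m' s' h
      obtain ⟨rfl, rfl⟩ := (succ_zero _ _ _).1 ((arr _ _ _ _).1 h)
      rfl
    have h₁ := key (N n 0) (R n 0 + 1) (Or.inl ⟨rfl, rfl⟩)
    have h₂ := key (N n 0 + 1) (R n 0 - 1) (Or.inr ⟨rfl, by omega⟩)
    omega
  have h₁ : ∀ n, N n 1 = N n 0 ∧ R n 1 = 1 := by
    intro n
    have := (arr n 0 n 1).2 (Or.inl ⟨rfl, rfl⟩)
    rwa [h₀, succ_zero] at this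
  have h₂ : ∀ n, N (n + 1) 0 = N n 0 + 1 := by
    intro n
    have := (arr n 1 (n + 1) 0).2 (Or.inr ⟨rfl, rfl⟩)
    rw [(h₁ n).1, (h₁ n).2, h₀] at this
    unfold ZAArrow at this
    omega
  have h₃ : ∀ n, N n 0 = n + N 0 0 := by
    intro n
    induction n using Int.induction_on with
    | zero => simp
    | succ i ih => rw [h₂, ih]; ring
    | pred i ih =>
      have := h₂ (-i - 1)
      rw [sub_add_cancel, ih] at this
      omega
  refine ⟨N 0 0, fun n r => ?_⟩
  suffices H : ∀ r : ℕ, (∀ n, N n r = n + N 0 0 ∧ R n r = r) ∧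
      ∀ n, N n (r + 1) = n + N 0 0 ∧ R n (r + 1) = r + 1 from (H r).1 n
  intro r
  induction r with
  | zero => exact ⟨fun n => ⟨h₃ n, h₀ n⟩, fun n => ⟨by rw [(h₁ n).1, h₃], (h₁ n).2⟩⟩
  | succ r ih =>
    refine ⟨ih.2, fun n => ?_⟩
    have := (arr n (r + 1) n (r + 1 + 1)).2 (Or.inl ⟨rfl, rfl⟩)
    rw [(ih.2 n).1, (ih.2 n).2] at this
    rcases this with this | this
    · exact this
    -- The other possible target, down and to the right, is already the image of `(n + 1, r)`, so
    -- injectivity excludes it.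
    · have e := ih.1 (n + 1)
      have := inj n (r + 1 + 1) (n + 1) r (by rw [this.1, e.1]; ring) (by omega)
      omega

end Irreducible

/-! ### Classification of the indecomposable objects. -/

section ThickSubcategory

variable {k : Type u} [Field k]

variable (k) in
/-- The thick subcategory generated by the trivial DG module over `k[T]`. -/
abbrev TrivialThick := (thickGeneratedBy (A := polyDGA k 1) (trivialModule k 1)).FullSubcategory

theorem isZero_obj_iff {X : TrivialThick k} : IsZero X.obj ↔ IsZero X := by
  rw [IsZero.iff_id_eq_zero, IsZero.iff_id_eq_zero]
  exact ⟨fun h => ObjectProperty.hom_ext _ h, fun h => congrArg (·.hom) h⟩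

variable (k) in
/-- A standard object as an object of the thick subcategory. -/
noncomputable abbrev std {a b : ℤ} (h : a ≤ b) : TrivialThick k :=
  ⟨stdObj k a b, stdObj_mem h⟩

variable (k) in
/-- The nilpotent endomorphism of a standard object in the thick subcategory. -/
noncomputable abbrev eps {a b : ℤ} (h : a ≤ b) : std k h ⟶ std k h :=
  ObjectProperty.homMk (stdEps k (by omega))

variable (k) in
/-- The standard object at the vertex `(n, r)` of `ℤA∞`. -/
noncomputable abbrev vertex (n : ℤ) (r : ℕ) : TrivialThick k :=
  std k (by omega : -n - (r : ℤ) ≤ -n)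

theorem isDual_eps {a b : ℤ} (h : a ≤ b) : IsDual k (eps k h) := by
  have h := isDual_stdEps (k := k) h
  refine ⟨fun h₀ => h.ne_zero (congrArg (·.hom) h₀), ObjectProperty.hom_ext _ h.sq_zero,
    fun φ => ?_⟩
  obtain ⟨c, d, e⟩ := h.exists_eq φ.hom
  exact ⟨c, d, ObjectProperty.hom_ext _ e⟩

/-- Isomorphic objects would have a two-dimensional morphism space between them, whereas distinct
intervals give dimension at most one. -/
theorem stdObj_eq_of_iso {a b c d : ℤ} (h : a ≤ b) (e : stdObj k a b ≅ stdObj k c d) :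
    a = c ∧ b = d := by
  by_contra hne
  have h₂ := rank_hom_eq_two (k := k) h
  rw [(Linear.homCongr k (Iso.refl _) e).rank_eq] at h₂
  by_cases H : c ≤ a ∧ a ≤ d ∧ d ≤ b ∨ a ≤ c ∧ c ≤ b ∧ b ≤ d
  · rw [rank_hom_eq_one (by omega) H hne] at h₂
    exact absurd h₂ (by norm_num)
  · have h₀ := stdObj_hom_eq_zero (k := k) (by omega : a ≤ b + 1) (fun h => H (Or.inl h))
      (fun h => H (Or.inr h)) e.hom
    refine (isDual_stdEps (k := k) h).not_isZero ((IsZero.iff_id_eq_zero _).2 ?_)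
    rw [← e.hom_inv_id, h₀, zero_comp]

theorem std_eq_of_iso {a b c d : ℤ} (h : a ≤ b) (h' : c ≤ d) (e : std k h ≅ std k h') :
    a = c ∧ b = d :=
  stdObj_eq_of_iso (k := k) h
    ((thickGeneratedBy (A := polyDGA k 1) (trivialModule k 1)).ι.mapIso e)

theorem vertex_eq_of_iso {n m : ℤ} {r s : ℕ} (e : vertex k n r ≅ vertex k m s) :
    n = m ∧ r = s := by
  have := std_eq_of_iso _ _ e
  omega

/-- A DG module with torsion cohomology that is not exact has a standard object as a summand. -/
theorem exists_stdEps_comp_ne_zero {M : DGModule (polyDGA k 1)} (hM : IsTorsion M)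
    (hM' : ¬ IsAcyclic M) : ∃ (a b : ℤ) (h : a ≤ b) (p : cyclePairs a b M),
      stdEps k (by omega : a ≤ b + 1) ≫ pairHom (by omega) M p ≠ 0 := by
  classical
  obtain ⟨n, hn, hmin⟩ : ∃ n, (∀ a b : ℤ, a + (n : ℕ) ≤ b → ∀ x : M.X a, M.d a x = 0 →
      M.T a b x ∈ M.bdry b) ∧ ∀ m < n, ¬ ∀ a b : ℤ, a + (m : ℕ) ≤ b → ∀ x : M.X a, M.d a x = 0 →
      M.T a b x ∈ M.bdry b :=
    ⟨Nat.find hM, Nat.find_spec hM, fun m hm => Nat.find_min hM hm⟩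
  -- The least exponent is positive, since exponent zero would mean that every cycle is a boundary.
  obtain ⟨m, rfl⟩ : ∃ m, n = m + 1 := by
    refine Nat.exists_eq_succ_of_ne_zero fun h₀ => hM' fun a x hx => ?_
    simpa using hn a a (by omega) x hx
  have := hmin m (by omega)
  push Not at this
  obtain ⟨a, b, hab, x, hx, hb⟩ := this
  obtain rfl : b = a + m := by
    by_contra hne
    exact hb (hn a b (by push_cast; omega) x hx)
  -- The cycle `x` survives `T ^ m` but not `T ^ (m + 1)`, which makes it the first coordinate of a
  -- pair for `[a, a + m]`. If `ε` killed that pair, `T ^ m x` would be a boundary plus `T ^ (m + 1)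
  -- z` for a cycle `z`, hence a boundary.
  obtain ⟨y, hy⟩ := exists_of_mem_bdry (i := a + m) rfl
    (hn a (a + m + 1) (by push_cast; omega) x hx)
  refine ⟨a, a + m, by omega, ⟨(x, y), hx, hy⟩, fun h₀ => hb ?_⟩
  rw [stdEps_comp, pairHom_eq_zero_iff, soclePair_eq_zero_iff (sub_add_cancel a 1)
    (sub_add_cancel (a + (m : ℤ)) 1)] at h₀
  obtain ⟨z, w, hz, hw⟩ := h₀
  change _ = M.T a (a + m) x at hw
  rw [← hw]
  refine add_mem (dl_mem_bdry _ _ _) (hn (a - 1) _ (by push_cast; omega) z ?_)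
  have : ∀ (j : ℤ) (hj : a - 1 + 1 = j), M.dl (a - 1) j hj z = 0 → M.d (a - 1) z = 0 := by
    rintro j rfl h
    exact h
  exact this _ _ hz

/-- The indecomposable objects are the standard ones. -/
theorem exists_iso_vertex {t : TrivialThick k} (ht : IsIndecomposable t) :
    ∃ n r, Nonempty (t ≅ vertex k n r) := by
  have hT := isThick_thickGeneratedBy (trivialModule k 1)
  obtain ⟨M, ⟨e⟩⟩ := exists_toD_obj t.obj
  have hM := hT.of_iso e t.property
  obtain ⟨a, b, h, p, hp⟩ := exists_stdEps_comp_ne_zero (isTorsion_of_thickGeneratedBy hM)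
    fun hM' => ht.1 (isZero_obj_iff.1 (((isZero_toD_obj_iff M).2 hM').of_iso e.symm))
  obtain ⟨g, hg⟩ := exists_retraction h _ hp
  obtain ⟨N, q, -, hq, -, -⟩ := exists_quasiIso_comp (freeDesc (by omega) M p) (φ := g)
    (isQuasiIso_id _) (by rw [CategoryTheory.Functor.map_id]; exact hg)
  -- The splitting makes `M` the sum of `N`, a copy of the interval object, and the cone of the map
  -- from it. Indecomposability makes one of them zero; `N` is not, so the cone is acyclic.
  have hP := isQuasiIso_prodLift_coneInr _ _ hq
  have hN := (hT.of_quasiIso hq).1 (stdObj_mem h)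
  have hC := hT.of_cone₃ _ _ (freeDesc (by omega) M p) (stdObj_mem h) hM
  let Y : TrivialThick k := ⟨_, hN⟩
  let Z : TrivialThick k := ⟨_, hC⟩
  let W : TrivialThick k := ⟨_, (hT.of_quasiIso hP).1 hM⟩
  let B : BinaryBicone Y Z :=
    { pt := W
      fst := ObjectProperty.homMk ((toD _).map (prodFst _ _))
      snd := ObjectProperty.homMk ((toD _).map (prodSnd _ _))
      inl := ObjectProperty.homMk ((toD _).map (prodLift (𝟙 _) 0))
      inr := ObjectProperty.homMk ((toD _).map (prodLift 0 (𝟙 _)))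
      inl_fst := ObjectProperty.hom_ext _ (((toD _).map_comp _ _).symm.trans ((toD _).map_id _))
      inl_snd := ObjectProperty.hom_ext _ (((toD _).map_comp _ _).symm.trans ((toD _).map_zero _ _))
      inr_fst := ObjectProperty.hom_ext _ (((toD _).map_comp _ _).symm.trans ((toD _).map_zero _ _))
      inr_snd := ObjectProperty.hom_ext _ (((toD _).map_comp _ _).symm.trans ((toD _).map_id _)) }
  have hB : B.IsBilimit := isBinaryBilimitOfTotal B (ObjectProperty.hom_ext _ (by
    change (toD _).map _ ≫ (toD _).map _ + (toD _).map _ ≫ (toD _).map _ = 𝟙 _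
    rw [← Functor.map_comp, ← Functor.map_comp, ← Functor.map_add, prod_total,
      CategoryTheory.Functor.map_id]))
  have := isIso_toD_map hP
  have hW : Nonempty (B.pt ≅ t) :=
    ⟨ObjectProperty.isoMk _ ((asIso ((toD _).map (prodLift q (coneInr (freeDesc _ M p))))).symm ≪≫ e)⟩
  rcases ht.2 Y Z B ⟨hB⟩ hW with hY | hZ
  · have := isIso_toD_map hq
    exact absurd ((isZero_obj_iff.2 hY).of_iso (asIso ((toD _).map (freeDesc _ M p ≫ q))))
      (isDual_stdEps h).not_isZero
  · have := isIso_toD_map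
      (isQuasiIso_of_isAcyclic_cone ((isZero_toD_obj_iff _).1 (isZero_obj_iff.2 hZ)))
    obtain ⟨n, rfl⟩ : ∃ n : ℤ, b = -n := ⟨-b, by omega⟩
    obtain ⟨r, rfl⟩ : ∃ r : ℕ, a = -n - r := ⟨(-n - a).toNat, by omega⟩
    exact ⟨n, r, ⟨ObjectProperty.isoMk _
      (e.symm ≪≫ (asIso ((toD _).map (freeDesc _ M p))).symm)⟩⟩

end ThickSubcategory

/-! ### Irreducible morphisms between interval objects. -/

section Arrows

variable {k : Type u} [Field k] {a b c d : ℤ}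

/-- The morphisms out of a standard object that kill `ε` form at most a line. -/
theorem exists_eq_smul (h : a ≤ b) (h' : c ≤ d) {f g : stdObj k a b ⟶ stdObj k c d}
    (hf : stdEps k (by omega) ≫ f = 0) (hg : stdEps k (by omega) ≫ g = 0) (hg' : g ≠ 0) :
    ∃ r : k, f = r • g := by
  by_cases hne : a = c ∧ b = d
  · obtain ⟨rfl, rfl⟩ := hne
    have hd := isDual_stdEps (k := k) h
    have key : ∀ φ : stdObj k a b ⟶ stdObj k a b, stdEps k (by omega) ≫ φ = 0 →
        ∃ s : k, φ = s • stdEps k (by omega) := fun φ hφ =>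
      (hd.isIso_or φ).resolve_left fun _ => hd.ne_zero (by
        rw [← cancel_mono φ, hφ, zero_comp])
    obtain ⟨s, rfl⟩ := key f hf
    obtain ⟨t, rfl⟩ := key g hg
    have ht : t ≠ 0 := by
      rintro rfl
      exact hg' (zero_smul _ _)
    exact ⟨s * t⁻¹, by rw [smul_smul, inv_mul_cancel_right₀ ht]⟩
  by_cases H : c ≤ a ∧ a ≤ d ∧ d ≤ b ∨ a ≤ c ∧ c ≤ b ∧ b ≤ d
  · have := rank_hom_eq_one (k := k) (by omega) H hne
    rw [Module.rank_eq_one_iff_finrank_eq_one] at this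
    obtain ⟨r, hr⟩ := exists_smul_eq_of_finrank_eq_one this hg' f
    exact ⟨r, hr.symm⟩
  · exact absurd (stdObj_hom_eq_zero (by omega) (fun h => H (Or.inl h)) (fun h => H (Or.inr h)) g)
      hg'

/-- If `φ` were a multiple of `ε`, then `f = f ≫ φ ≫ φ` would vanish. -/
theorem IsDual.isIso_of_comp_eq {C : Type*} [Category* C] [Preadditive C] [Linear k C]
    {X Y : C} {ε : Y ⟶ Y} (h : IsDual k ε) {f : X ⟶ Y} (hf : f ≠ 0) {φ : Y ⟶ Y}
    (hφ : f ≫ φ = f) : IsIso φ := by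
  refine (h.isIso_or φ).resolve_right ?_
  rintro ⟨s, rfl⟩
  refine hf ?_
  rw [← hφ, ← hφ, Category.assoc]
  simp [h.sq_zero]

theorem isSplitMono_of_eps_comp_ne_zero (h : a ≤ b) {X : TrivialThick k} (g : std k h ⟶ X)
    (hg : eps k h ≫ g ≠ 0) : IsSplitMono g := by
  obtain ⟨g', hg'⟩ := exists_retraction h g.hom fun h₀ => hg (ObjectProperty.hom_ext _ h₀)
  exact ⟨⟨⟨ObjectProperty.homMk g', ObjectProperty.hom_ext _ hg'⟩⟩⟩

/-- A first factor not killed by `ε` is a split monomorphism, so only factorizations with `ε ≫ g =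
0` remain to be examined. -/
theorem isIrreducible_of_eps_comp_eq_zero (h : a ≤ b) (h' : c ≤ d) {f : std k h ⟶ std k h'}
    (hne : ¬(a = c ∧ b = d)) (hf : eps k h ≫ f = 0)
    (H : ∀ (Z : TrivialThick k) (g : std k h ⟶ Z) (g' : Z ⟶ std k h'),
      eps k h ≫ g = 0 → g ≫ g' = f → IsSplitEpi g') :
    IsIrreducible f where
  not_splitMono := fun _ => (isDual_eps (k := k) h).ne_zero (by
    rw [← cancel_mono f, hf, zero_comp])
  not_splitEpi := fun ⟨⟨s⟩⟩ => by
    have := (isDual_eps h).isIso_of_comp_eq_id (isDual_eps h').not_isZero s.id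
    exact hne (std_eq_of_iso _ _ (asIso f))
  factor Z g g' hg := by
    by_cases h₀ : eps k h ≫ g = 0
    · exact Or.inr (H Z g g' h₀ hg)
    · exact Or.inl (isSplitMono_of_eps_comp_ne_zero h g h₀)

/-- The factor `g` passes through the two neighbours. There is no non-zero morphism from `[i + 1,
j]` to `[i, j + 1]`, so the map equals itself followed by an endomorphism of its target, which must
be invertible; this splits `g'`. The argument for `stdDown` is symmetric. -/
theorem isIrreducible_stdUp {i j : ℤ} (h : i + 1 ≤ j + 1) :
    IsIrreducible (C := TrivialThick k) (X := std k h) (Y := std k (by omega))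
      (ObjectProperty.homMk (stdUp k i (j + 1) (by omega))) := by
  refine isIrreducible_of_eps_comp_eq_zero _ _ (by omega)
    (ObjectProperty.hom_ext _ (stdEps_stdUp h)) fun Z g g' h₀ hg => ?_
  obtain ⟨g₁, g₂, e⟩ := exists_eq_stdUp_add_stdDown h g.hom (congrArg (·.hom) h₀)
  have e' : g.hom ≫ g'.hom = stdUp k i (j + 1) (by omega) := congrArg (·.hom) hg
  rw [e, Preadditive.add_comp, Category.assoc, Category.assoc,
    stdObj_hom_eq_zero (by omega) (by omega) (by omega) (g₂ ≫ g'.hom), comp_zero, add_zero] at e'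
  have := (isDual_stdEps (by omega)).isIso_of_comp_eq (stdUp_ne_zero h) e'
  exact ⟨⟨⟨ObjectProperty.homMk (inv (g₁ ≫ g'.hom) ≫ g₁),
    ObjectProperty.hom_ext _ ((Category.assoc _ _ _).trans (IsIso.inv_hom_id _))⟩⟩⟩

theorem isIrreducible_stdDown {i j : ℤ} (h : i + 1 ≤ j) :
    IsIrreducible (C := TrivialThick k) (X := std k (by omega)) (Y := std k h)
      (ObjectProperty.homMk (stdDown k (i + 1) j (by omega))) := by
  refine isIrreducible_of_eps_comp_eq_zero _ _ (by omega)
    (ObjectProperty.hom_ext _ (stdEps_stdDown (by omega))) fun Z g g' h₀ hg => ?_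
  obtain ⟨g₁, g₂, e⟩ := exists_eq_stdUp_add_stdDown (by omega) g.hom (congrArg (·.hom) h₀)
  have e' : g.hom ≫ g'.hom = stdDown k (i + 1) j (by omega) := congrArg (·.hom) hg
  rw [e, Preadditive.add_comp, Category.assoc, Category.assoc,
    stdObj_hom_eq_zero (by omega) (by omega) (by omega) (g₁ ≫ g'.hom), comp_zero, zero_add] at e'
  have := (isDual_stdEps (by omega)).isIso_of_comp_eq (stdDown_ne_zero h) e'
  exact ⟨⟨⟨ObjectProperty.homMk (inv (g₂ ≫ g'.hom) ≫ g₂),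
    ObjectProperty.hom_ext _ ((Category.assoc _ _ _).trans (IsIso.inv_hom_id _))⟩⟩⟩

/-- A multiple of a morphism through a third standard object is irreducible only if it ends
there. -/
theorem IsIrreducible.eq_of_factor {a' b' : ℤ} (h : a ≤ b) (h' : c ≤ d) (hZ : a' ≤ b')
    {f : std k h ⟶ std k h'} (hf : IsIrreducible f) {p : std k h ⟶ std k hZ}
    {q : std k hZ ⟶ std k h'} (hp : eps k h ≫ p = 0) (hpq : p ≫ q = f) : a' = c ∧ b' = d := by
  rcases hf.factor _ p q hpq with H | ⟨⟨⟨s⟩⟩⟩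
  · exact absurd (by rw [← cancel_mono p, hp, zero_comp]) (isDual_eps (k := k) h).ne_zero
  · have := (isDual_eps hZ).isIso_of_comp_eq_id (isDual_eps h').not_isZero s.id
    exact std_eq_of_iso _ _ (asIso q)

/-- An irreducible map kills `ε`, hence is a sum of maps through the two neighbours. Maps killing
`ε` span at most a line, so it is a multiple of either non-zero summand and factors through one
neighbour alone, which must then be its target. -/
theorem IsIrreducible.eq_or_eq {i j : ℤ} (h : i + 1 ≤ j + 1) (h' : c ≤ d)
    {f : std k h ⟶ std k h'} (hf : IsIrreducible f) : (i = c ∧ j + 1 = d) ∨ (i + 1 = c ∧ j = d) := by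
  have hf₀ : f ≠ 0 := by
    rintro rfl
    rcases hf.factor (std k h) 0 0 zero_comp with ⟨⟨⟨s⟩⟩⟩ | ⟨⟨⟨s⟩⟩⟩
    · exact (isDual_eps h).not_isZero ((IsZero.iff_id_eq_zero _).2 (by rw [← s.id, zero_comp]))
    · exact (isDual_eps h').not_isZero ((IsZero.iff_id_eq_zero _).2 (by rw [← s.id, comp_zero]))
  have hε : stdEps k (by omega : i + 1 ≤ j + 1 + 1) ≫ f.hom = 0 := by
    by_contra h₀
    exact hf.not_splitMono (isSplitMono_of_eps_comp_ne_zero h f fun h₁ =>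
      h₀ (congrArg (·.hom) h₁))
  obtain ⟨g₁, g₂, e⟩ := exists_eq_stdUp_add_stdDown h f.hom hε
  by_cases h₁ : stdUp k i (j + 1) (by omega) ≫ g₁ = 0
  · by_cases h₂ : stdDown k (i + 1) j h ≫ g₂ = 0
    · exact absurd (ObjectProperty.hom_ext _ (by rw [e, h₁, h₂, add_zero]; rfl)) hf₀
    -- For `j = i` the lower neighbour is the empty interval, the zero object, and contributes
    -- nothing.
    have hij : i + 1 ≤ j := by
      by_contra hij
      exact h₂ (by rw [stdObj_hom_eq_zero h (by omega) (by omega) g₂, comp_zero])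
    obtain ⟨r, hr⟩ := exists_eq_smul h h' hε (by
      rw [← Category.assoc, stdEps_stdDown, zero_comp]) h₂
    exact Or.inr (hf.eq_of_factor h h' hij (p := ObjectProperty.homMk (stdDown k (i + 1) j h))
      (q := ObjectProperty.homMk (r • g₂)) (ObjectProperty.hom_ext _ (stdEps_stdDown h))
      (ObjectProperty.hom_ext _ ((Linear.comp_smul _ _ _ _ _ _).trans hr.symm)))
  · obtain ⟨r, hr⟩ := exists_eq_smul h h' hε (by
      rw [← Category.assoc, stdEps_stdUp h, zero_comp]) h₁
    exact Or.inl (hf.eq_of_factor h h' (by omega)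
      (p := ObjectProperty.homMk (stdUp k i (j + 1) (by omega)))
      (q := ObjectProperty.homMk (r • g₁)) (ObjectProperty.hom_ext _ (stdEps_stdUp h))
      (ObjectProperty.hom_ext _ ((Linear.comp_smul _ _ _ _ _ _).trans hr.symm)))

theorem arArrow_std_iff (h : a ≤ b) (h' : c ≤ d) :
    ARArrow (std k h) (std k h') ↔ (c + 1 = a ∧ b = d) ∨ (a = c ∧ d + 1 = b) := by
  constructor
  · rintro ⟨-, -, f, hf⟩
    obtain ⟨i, rfl⟩ : ∃ i, a = i + 1 := ⟨a - 1, by omega⟩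
    obtain ⟨j, rfl⟩ : ∃ j, b = j + 1 := ⟨b - 1, by omega⟩
    have := hf.eq_or_eq
    omega
  · rintro (⟨rfl, rfl⟩ | ⟨rfl, rfl⟩)
    · obtain ⟨j, rfl⟩ : ∃ j, b = j + 1 := ⟨b - 1, by omega⟩
      exact ⟨(isDual_eps _).isIndecomposable, (isDual_eps _).isIndecomposable, _,
        isIrreducible_stdUp h⟩
    · obtain ⟨i, rfl⟩ : ∃ i, a = i + 1 := ⟨a - 1, by omega⟩
      exact ⟨(isDual_eps _).isIndecomposable, (isDual_eps _).isIndecomposable, _,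
        isIrreducible_stdDown h'⟩

end Arrows

/-! ### The component `ℤA∞`, the regions `F⁺` and `F⁻`, and the dimension count. -/

section Component

variable {k : Type u} [Field k]

theorem arArrow_vertex_iff (n m : ℤ) (r s : ℕ) :
    ARArrow (vertex k n r) (vertex k m s) ↔ ZAArrow n r m s := by
  rw [arArrow_std_iff]
  unfold ZAArrow
  omega

variable (k) in
theorem isZAComponent_vertex : IsZAComponent (vertex k) where
  indecomposable _ _ := (isDual_eps _).isIndecomposable
  injective _ _ _ _ := fun ⟨e⟩ => vertex_eq_of_iso e
  arrow_iff n r m s := arArrow_vertex_iff n m r s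
  arrow_from _ _ _ h := exists_iso_vertex h.2.1
  arrow_to _ _ _ h := exists_iso_vertex h.1

/-- The Auslander-Reiten quiver has only one component `ℤA∞`, and its identification with `ℤA∞`
is unique up to a translation. -/
theorem IsZAComponent.exists_translation {φ : ℤ → ℕ → TrivialThick k} (hφ : IsZAComponent φ) :
    ∃ c, ∀ n r, Nonempty (φ n r ≅ vertex k (n + c) r) := by
  choose N R e using fun n r => exists_iso_vertex (hφ.indecomposable n r)
  have key : ∀ n r m s, ARArrow (φ n r) (vertex k m s) ↔ ZAArrow (N n r) (R n r) m s :=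
    fun n r m s => (⟨fun h => h.of_iso (e n r).some (Iso.refl _), fun h =>
      h.of_iso (e n r).some.symm (Iso.refl _)⟩ : _ ↔ _).trans (arArrow_vertex_iff _ _ _ _)
  obtain ⟨c, hc⟩ := DGCat.exists_translation N R
    (fun n r m s h₁ h₂ => hφ.injective n r m s ⟨(e n r).some ≪≫ eqToIso (by rw [h₁, h₂]) ≪≫
      (e m s).some.symm⟩)
    (fun n r m s => by
      rw [← hφ.arrow_iff n r m s, ← key]
      exact ⟨fun h => h.of_iso (Iso.refl _) (e m s).some.symm, fun h =>
        h.of_iso (Iso.refl _) (e m s).some⟩)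
    (fun n r m' s' h => by
      obtain ⟨m, s, ⟨e'⟩⟩ := hφ.arrow_from n r _ ((key _ _ _ _).2 h)
      exact ⟨m, s, vertex_eq_of_iso ((e m s).some.symm ≪≫ e'.symm)⟩)
  refine ⟨c, fun n r => ?_⟩
  have := e n r
  rwa [(hc n r).1, (hc n r).2] at this

variable {t u : TrivialThick k} {n m : ℤ} {r s : ℕ} (e : t ≅ vertex k n r) (e' : u ≅ vertex k m s)

include e e'

/-- `FPlus` allows any identification with `ℤA∞`; another choice shifts `n` and `m` by the same
constant, which leaves the inequalities unchanged. -/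
theorem mem_FPlus_iff : u ∈ FPlus t ↔ n ≤ m ∧ m ≤ n + r ∧ n + r ≤ m + s := by
  constructor
  · rintro ⟨φ, hφ, n', r', m', s', ⟨f⟩, ⟨f'⟩, h⟩
    obtain ⟨c, hc⟩ := hφ.exists_translation
    have := vertex_eq_of_iso (e.symm ≪≫ f ≪≫ (hc n' r').some)
    have := vertex_eq_of_iso (e'.symm ≪≫ f' ≪≫ (hc m' s').some)
    omega
  · exact fun h => ⟨_, isZAComponent_vertex k, n, r, m, s, ⟨e⟩, ⟨e'⟩, h⟩

theorem mem_FMinus_iff : u ∈ FMinus t ↔ m ≤ n ∧ n ≤ m + s ∧ m + s ≤ n + r := by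
  constructor
  · rintro ⟨φ, hφ, n', r', m', s', ⟨f⟩, ⟨f'⟩, h⟩
    obtain ⟨c, hc⟩ := hφ.exists_translation
    have := vertex_eq_of_iso (e.symm ≪≫ f ≪≫ (hc n' r').some)
    have := vertex_eq_of_iso (e'.symm ≪≫ f' ≪≫ (hc m' s').some)
    omega
  · exact fun h => ⟨_, isZAComponent_vertex k, n, r, m, s, ⟨e⟩, ⟨e'⟩, h⟩

theorem rank_hom_eq : Module.rank k (t ⟶ u) =
    Module.rank k (stdObj k (-n - r) (-n) ⟶ stdObj k (-m - s) (-m)) :=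
  (Linear.homCongr k e e').rank_eq.trans
    (InducedCategory.homLinearEquiv (R := k) (X := vertex k n r) (Y := vertex k m s)).rank_eq

theorem nonempty_iso_iff : Nonempty (u ≅ t) ↔ n = m ∧ r = s := by
  constructor
  · rintro ⟨f⟩
    exact vertex_eq_of_iso (e.symm ≪≫ f.symm ≪≫ e')
  · rintro ⟨rfl, rfl⟩
    exact ⟨e' ≪≫ e.symm⟩

end Component

/-- Under `[a, b] = [-n - r, -n]` and `[c, d] = [-m - s, -m]`, the region `F⁺` becomes `c ≤ a ≤ d ≤
b` and `F⁻` becomes `a ≤ c ≤ b ≤ d`, the conditions governing the two coordinates of a pair. -/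
theorem rank_hom_trivialThick {k : Type u} [Field k] {t u : TrivialThick k}
    (ht : IsIndecomposable t) (hu : IsIndecomposable u) :
    (Nonempty (u ≅ t) → Module.rank k (t ⟶ u) = 2) ∧
    (u ∈ FPlus t ∪ FMinus t → ¬ Nonempty (u ≅ t) → Module.rank k (t ⟶ u) = 1) ∧
    (u ∉ FPlus t ∪ FMinus t → ¬ Nonempty (u ≅ t) → Module.rank k (t ⟶ u) = 0) := by
  obtain ⟨n, r, ⟨e⟩⟩ := exists_iso_vertex ht
  obtain ⟨m, s, ⟨e'⟩⟩ := exists_iso_vertex hu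
  rw [Set.mem_union, mem_FPlus_iff e e', mem_FMinus_iff e e', nonempty_iso_iff e e',
    rank_hom_eq e e']
  refine ⟨?_, fun h hne => rank_hom_eq_one (by omega) (by omega) (by omega), fun h _ => ?_⟩
  · rintro ⟨rfl, rfl⟩
    exact rank_hom_eq_two (by omega)
  · have : Subsingleton (stdObj k (-n - r) (-n) ⟶ stdObj k (-m - s) (-m)) :=
      subsingleton_of_forall_eq 0 (stdObj_hom_eq_zero (by omega) (by omega) (by omega))
    exact rank_subsingleton' k _

/-- The case of a generator whose degree is only propositionally equal to `1`. -/
theorem rank_hom_thickGeneratedBy {k : Type u} [Field k] {e : ℤ} (he : e = 1)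
    (t u : (thickGeneratedBy (A := polyDGA k e) (trivialModule k e)).FullSubcategory)
    (ht : IsIndecomposable t) (hu : IsIndecomposable u) :
    (Nonempty (u ≅ t) → Module.rank k (t ⟶ u) = 2) ∧
    (u ∈ FPlus t ∪ FMinus t → ¬ Nonempty (u ≅ t) → Module.rank k (t ⟶ u) = 1) ∧
    (u ∉ FPlus t ∪ FMinus t → ¬ Nonempty (u ≅ t) → Module.rank k (t ⟶ u) = 0) := by
  subst he
  exact rank_hom_trivialThick ht hu

end DGCat

theorem mainTheorem5 (k : Type u) [Field k] [IsAlgClosed k] (t u : DGCat.TCat k 0)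
    (ht : DGCat.IsIndecomposable t) (hu : DGCat.IsIndecomposable u) :
    (Nonempty (u ≅ t) → Module.rank k (t ⟶ u) = 2) ∧
    (u ∈ DGCat.FPlus t ∪ DGCat.FMinus t → ¬ Nonempty (u ≅ t) → Module.rank k (t ⟶ u) = 1) ∧
    (u ∉ DGCat.FPlus t ∪ DGCat.FMinus t → ¬ Nonempty (u ≅ t) → Module.rank k (t ⟶ u) = 0) :=
  DGCat.rank_hom_thickGeneratedBy (by norm_num) t u ht hu
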